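/- **Theorem (the Pfaffian is $\Sigma^B_1$-definable in $\mathbf{V\#L}$).** Work in two-sorted bounded arithmetic with the vocabulary $0,1,+,\cdot,|\ |,\in,\le,=_1,=_2$; in the standard model numbers are natural numbers, strings are finite sets of natural numbers, and $|X|$ is $0$ for $X=\emptyset$ and $1+\max X$ otherwise. Let $\langle x,y\rangle=(x+y)(x+y+1)+2y$. A $\Sigma^B_0$ formula has only bounded number quantifiers and no string quantifiers; a $\Sigma^B_1$ formula is a block of bounded string quantifiers $\exists X_1\le t_1\cdots\exists X_r\le t_r$ (no $X_i$ occurring in any $t_j$) followed by a $\Sigma^B_0$ formula. The theory $\mathbf{V\#L}$ consists of * the axioms 2-BASIC; * $\Sigma^B_0$-comprehension: $\exists X\le y\,\forall z<y\,(X(z)\leftrightarrow\varphi(z))$ for every $\Sigma^B_0$ formula $\varphi$ in which $X$ is not free; * string multiplication: for all strings $X,Y$ (read as binary numbers) there is a string $Z=X\cdot Y$; * matrix powering: for all numbers $n,k$ and every string $X$, read as an $n\times n$ matrix of binary integers, there is a string $Y$ that codes the powers $X^0,X^1,\dots,X^k$. In the last two axioms the graphs "$Z=X\cdot Y$" and "$Y=(X^0,\dots,X^k)$"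 are $\Sigma^B_0$ formulas in the strings and in bounded strings that record the intermediate results of the computation (the partial sums of the school multiplications and of the inner products). An integer is coded by a string $X$: it is negative (or zero) if $0\in X$, nonnegative otherwise, and its absolute value is $\sum_{x+1\in X}2^x$; the code of an integer is the unique such string, with $0$ coded by $\emptyset$. An integer matrix $A$ is coded by a string $X$ in which $\{x:\langle i,\langle j,x\rangle\rangle\in X\}$ represents the entry $A_{ij}$. For a skew symmetric integer matrix $A\in\mathrm{Mat}(2n,2n)$ let $$\mathrm{Pf}(A)=\sum_{\sigma}\mathrm{sgn}(\sigma)\,a_{\sigma(1)\sigma(2)}\cdots a_{\sigma(2n-1)\sigma(2n)},$$ where $\sigma$ ranges over the permutations of $\{1,\dots,2n\}$ with $\sigma(2i-1)<\sigma(2i)$ for all $i$ and $\sigma(1)<\sigma(3)<\dots<\sigma(2n-1)$, that is, over the perfect matchings of $\{1,\dots,2n\}$. Let $F(n,X)$ be the code of $\mathrm{Pf}(A)$ if the $2n\times 2n$ matrix $A$ coded by $X$ is skew symmetric, and $\emptyset$ (the code of $0$) otherwise. Then $F$ is $\Sigma^B_1$-definable in $\mathbf{V\#L}$: there is a $\Sigma^B_1$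 formula $\varphi(n,X,Y)$, with no other free variables, such that in the standard model $Y=F(n,X)$ if and only if $\varphi(n,X,Y)$, and $$\mathbf{V\#L}\vdash\forall n\,\forall X\,\exists!Y\,\varphi(n,X,Y).$$ -/

import Mathlib

/-! ### Two-sorted first-order syntax over the vocabulary `0, 1, +, ·, | |, ≤, ∈, =₁, =₂` -/

namespace TwoSorted

/-- Number terms. The only string terms are the string variables, named by natural numbers,
so `len X` is the term `|X|` for the string variable with name `X`. -/
inductive NTerm where
  | var (x : ℕ)
  | zero
  | one
  | add (t u : NTerm)
  | mul (t u : NTerm)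
  | len (X : ℕ)

instance : Zero NTerm := ⟨NTerm.zero⟩
instance : One NTerm := ⟨NTerm.one⟩
instance : Add NTerm := ⟨NTerm.add⟩
instance : Mul NTerm := ⟨NTerm.mul⟩

/-- The number variables that occur in a term. -/
def NTerm.numVars : NTerm → Set ℕ
  | .var x => {x}
  | .zero => ∅
  | .one => ∅
  | .add t u => t.numVars ∪ u.numVars
  | .mul t u => t.numVars ∪ u.numVars
  | .len _ => ∅

/-- The string variables that occur in a term. -/
def NTerm.strVars : NTerm → Set ℕ
  | .var _ => ∅
  | .zero => ∅
  | .one => ∅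
  | .add t u => t.strVars ∪ u.strVars
  | .mul t u => t.strVars ∪ u.strVars
  | .len X => {X}

/-- Two-sorted formulas; `mem t X` is the atomic formula `t ∈ X`, also written `X(t)`. -/
inductive Formula where
  | eqN (t u : NTerm)
  | eqS (X Y : ℕ)
  | le (t u : NTerm)
  | mem (t : NTerm) (X : ℕ)
  | neg (φ : Formula)
  | and (φ ψ : Formula)
  | or (φ ψ : Formula)
  | allN (x : ℕ) (φ : Formula)
  | exN (x : ℕ) (φ : Formula)
  | allS (X : ℕ) (φ : Formula)
  | exS (X : ℕ) (φ : Formula)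

namespace Formula

/-- `φ → ψ` abbreviates `¬φ ∨ ψ`. -/
def imp (φ ψ : Formula) : Formula := or (neg φ) ψ

def iff (φ ψ : Formula) : Formula := and (imp φ ψ) (imp ψ φ)

/-- `t < u` abbreviates `t ≤ u ∧ t ≠ u`. -/
def lt (t u : NTerm) : Formula := and (le t u) (neg (eqN t u))

/-- The bounded quantifier `∀ x ≤ t`. -/
def ballN (x : ℕ) (t : NTerm) (φ : Formula) : Formula := allN x (imp (le (.var x) t) φ)

/-- The bounded quantifier `∃ x ≤ t`. -/
def bexN (x : ℕ) (t : NTerm) (φ : Formula) : Formula := exN x (and (le (.var x) t) φ)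

/-- The bounded string quantifier `∃ X ≤ t`, that is, `∃ X, |X| ≤ t ∧ …`. -/
def bexS (X : ℕ) (t : NTerm) (φ : Formula) : Formula := exS X (and (le (.len X) t) φ)

/-- The free number variables. -/
def freeNum : Formula → Set ℕ
  | eqN t u => t.numVars ∪ u.numVars
  | eqS _ _ => ∅
  | le t u => t.numVars ∪ u.numVars
  | mem t _ => t.numVars
  | neg φ => φ.freeNum
  | and φ ψ => φ.freeNum ∪ ψ.freeNum
  | or φ ψ => φ.freeNum ∪ ψ.freeNum
  | allN x φ => φ.freeNum \ {x}
  | exN x φ => φ.freeNum \ {x}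
  | allS _ φ => φ.freeNum
  | exS _ φ => φ.freeNum

/-- The free string variables. -/
def freeStr : Formula → Set ℕ
  | eqN t u => t.strVars ∪ u.strVars
  | eqS X Y => {X, Y}
  | le t u => t.strVars ∪ u.strVars
  | mem t X => t.strVars ∪ {X}
  | neg φ => φ.freeStr
  | and φ ψ => φ.freeStr ∪ ψ.freeStr
  | or φ ψ => φ.freeStr ∪ ψ.freeStr
  | allN _ φ => φ.freeStr
  | exN _ φ => φ.freeStr
  | allS X φ => φ.freeStr \ {X}
  | exS X φ => φ.freeStr \ {X}

/-- `Σ^B_0` formulas: no string quantifiers, and every number quantifier is bounded by a term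
that does not contain the quantified variable. -/
inductive IsSigmaB0 : Formula → Prop
  | eqN (t u : NTerm) : IsSigmaB0 (eqN t u)
  | eqS (X Y : ℕ) : IsSigmaB0 (eqS X Y)
  | le (t u : NTerm) : IsSigmaB0 (le t u)
  | mem (t : NTerm) (X : ℕ) : IsSigmaB0 (mem t X)
  | neg {φ : Formula} : IsSigmaB0 φ → IsSigmaB0 (neg φ)
  | and {φ ψ : Formula} : IsSigmaB0 φ → IsSigmaB0 ψ → IsSigmaB0 (and φ ψ)
  | or {φ ψ : Formula} : IsSigmaB0 φ → IsSigmaB0 ψ → IsSigmaB0 (or φ ψ)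
  | ballN {x : ℕ} {t : NTerm} {φ : Formula} :
      x ∉ t.numVars → IsSigmaB0 φ → IsSigmaB0 (ballN x t φ)
  | bexN {x : ℕ} {t : NTerm} {φ : Formula} :
      x ∉ t.numVars → IsSigmaB0 φ → IsSigmaB0 (bexN x t φ)

/-- `Σ^B_1` formulas: `∃ X₁ ≤ t₁ … ∃ X_r ≤ t_r, ψ` with `ψ` a `Σ^B_0` formula, where no `X_i`
occurs in any `t_j`. -/
def IsSigmaB1 (φ : Formula) : Prop :=
  ∃ (l : List (ℕ × NTerm)) (ψ : Formula), ψ.IsSigmaB0 ∧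
    (∀ p ∈ l, ∀ q ∈ l, p.1 ∉ q.2.strVars) ∧
    φ = l.foldr (fun p χ => bexS p.1 p.2 χ) ψ

end Formula

/-! ### Semantics -/

/-- A two-sorted structure for the vocabulary; both equality symbols are read as equality. -/
structure Struct where
  Num : Type
  Str : Type
  zero : Num
  one : Num
  add : Num → Num → Num
  mul : Num → Num → Num
  len : Str → Num
  le : Num → Num → Prop
  mem : Num → Str → Prop
  str_nonempty : Nonempty Str

def NTerm.eval (M : Struct) (v : ℕ → M.Num) (s : ℕ → M.Str) : NTerm → M.Num
  | .var x => v x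
  | .zero => M.zero
  | .one => M.one
  | .add t u => M.add (t.eval M v s) (u.eval M v s)
  | .mul t u => M.mul (t.eval M v s) (u.eval M v s)
  | .len X => M.len (s X)

/-- Tarski satisfaction under an assignment `v` of numbers and `s` of strings. -/
def Formula.Sat (M : Struct) : (ℕ → M.Num) → (ℕ → M.Str) → Formula → Prop
  | v, s, .eqN t u => t.eval M v s = u.eval M v s
  | _, s, .eqS X Y => s X = s Y
  | v, s, .le t u => M.le (t.eval M v s) (u.eval M v s)
  | v, s, .mem t X => M.mem (t.eval M v s) (s X)
  | v, s, .neg φ => ¬ Formula.Sat M v s φ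
  | v, s, .and φ ψ => Formula.Sat M v s φ ∧ Formula.Sat M v s ψ
  | v, s, .or φ ψ => Formula.Sat M v s φ ∨ Formula.Sat M v s ψ
  | v, s, .allN x φ => ∀ a : M.Num, Formula.Sat M (Function.update v x a) s φ
  | v, s, .exN x φ => ∃ a : M.Num, Formula.Sat M (Function.update v x a) s φ
  | v, s, .allS X φ => ∀ A : M.Str, Formula.Sat M v (Function.update s X A) φ
  | v, s, .exS X φ => ∃ A : M.Str, Formula.Sat M v (Function.update s X A) φ

/-- A formula holds in a structure if its universal closure does. -/
def Struct.Models (M : Struct) (φ : Formula) : Prop :=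
  ∀ (v : ℕ → M.Num) (s : ℕ → M.Str), φ.Sat M v s

/-- `T ⊢ φ`, for the universal closures of the formulas involved. By the completeness theorem
(and Löwenheim–Skolem, since the vocabulary is finite) provability is truth of `φ` in all
models of `T`, and models on types in the lowest universe suffice. -/
def Proves (T : Set Formula) (φ : Formula) : Prop :=
  ∀ M : Struct, (∀ ψ ∈ T, M.Models ψ) → M.Models φ

/-- The standard model: numbers are natural numbers, strings are finite sets of natural numbers,
and `|X|` is `0` for `X = ∅` and `1 + max X` otherwise. -/
abbrev stdModel : Struct where
  Num := ℕ
  Str := Finset ℕ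
  zero := 0
  one := 1
  add := (· + ·)
  mul := (· * ·)
  len X := X.sup Nat.succ
  le := (· ≤ ·)
  mem x X := x ∈ X
  str_nonempty := ⟨∅⟩

/-- A string function `F` of `p` number and `q` string arguments is `Σ^B_1`-definable in `T`:
there is a `Σ^B_1` formula `φ(x₀,…,x_{p-1}, X₀,…,X_{q-1}, Y)`, where `Y` is the string variable
with name `q`, that defines the graph of `F` in the standard model and for which `T` proves
`∀ x ∀ X ∃! Y φ`. Here `∃! Y φ` is written `∃ Z ∀ Y (φ ↔ Y = Z)`, where `Z`, with name `q + 1`,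
is not free in `φ`. -/
def SigmaB1Definable (T : Set Formula) (p q : ℕ)
    (F : (Fin p → ℕ) → (Fin q → Finset ℕ) → Finset ℕ) : Prop :=
  ∃ φ : Formula, φ.IsSigmaB1 ∧ φ.freeNum ⊆ Set.Iio p ∧ φ.freeStr ⊆ Set.Iic q ∧
    (∀ (v : ℕ → ℕ) (s : ℕ → Finset ℕ),
      φ.Sat stdModel v s ↔ s q = F (fun i => v i) (fun i => s i)) ∧
    Proves T (.exS (q + 1) (.allS q (φ.iff (.eqS q (q + 1)))))

/-! ### The basic axioms and comprehension -/

section BasicAxioms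

open Formula NTerm

/-- The axioms `2-BASIC`. -/
inductive Basic2 : Formula → Prop
  | B1 : Basic2 (neg (eqN (var 0 + 1) 0))
  | B2 : Basic2 (imp (eqN (var 0 + 1) (var 1 + 1)) (eqN (var 0) (var 1)))
  | B3 : Basic2 (eqN (var 0 + 0) (var 0))
  | B4 : Basic2 (eqN (var 0 + (var 1 + 1)) (var 0 + var 1 + 1))
  | B5 : Basic2 (eqN (var 0 * 0) 0)
  | B6 : Basic2 (eqN (var 0 * (var 1 + 1)) (var 0 * var 1 + var 0))
  | B7 : Basic2 (imp (and (le (var 0) (var 1)) (le (var 1) (var 0))) (eqN (var 0) (var 1)))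
  | B8 : Basic2 (le (var 0) (var 0 + var 1))
  | B9 : Basic2 (le 0 (var 0))
  | B10 : Basic2 (or (le (var 0) (var 1)) (le (var 1) (var 0)))
  | B11 : Basic2 (iff (le (var 0) (var 1)) (lt (var 0) (var 1 + 1)))
  | B12 : Basic2 (imp (neg (eqN (var 0) 0)) (bexN 1 (var 0) (eqN (var 1 + 1) (var 0))))
  | L1 : Basic2 (imp (mem (var 0) 0) (lt (var 0) (len 0)))
  | L2 : Basic2 (imp (eqN (var 0 + 1) (len 0)) (mem (var 0) 0))
  | SE : Basic2 (imp (and (eqN (len 0) (len 1))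
      (ballN 0 (len 0) (imp (lt (var 0) (len 0)) (iff (mem (var 0) 0) (mem (var 0) 1)))))
      (eqS 0 1))

/-- The comprehension axioms `∃ X ≤ y ∀ z < y (X(z) ↔ φ)` for `Σ^B_0` formulas `φ` in which `X`
is not free. -/
inductive SigmaB0Comp : Formula → Prop
  | comp (φ : Formula) (X y z : ℕ) (hφ : φ.IsSigmaB0) (hX : X ∉ φ.freeStr) (hyz : y ≠ z) :
      SigmaB0Comp (bexS X (var y)
        (ballN z (var y) (imp (lt (var z) (var y)) (iff (mem (var z) X) φ))))

end BasicAxioms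

/-! ### Writing larger formulas

An `FB` is a formula together with a supply of fresh variables: `f i j` is the formula in which
bound number variables get names `i, i + 1, …` and bound string variables get names
`j, j + 1, …`. All free variables have smaller names, so that no variable is ever captured. -/

abbrev FB := ℕ → ℕ → Formula

namespace FB

def eq (t u : NTerm) : FB := fun _ _ => .eqN t u
def le (t u : NTerm) : FB := fun _ _ => .le t u
def lt (t u : NTerm) : FB := fun _ _ => .lt t u
def mem (t : NTerm) (X : ℕ) : FB := fun _ _ => .mem t X
def not (φ : FB) : FB := fun i j => (φ i j).neg
def and (φ ψ : FB) : FB := fun i j => (φ i j).and (ψ i j)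
def or (φ ψ : FB) : FB := fun i j => (φ i j).or (ψ i j)
def imp (φ ψ : FB) : FB := fun i j => (φ i j).imp (ψ i j)
def iff (φ ψ : FB) : FB := fun i j => (φ i j).iff (ψ i j)
def xor (φ ψ : FB) : FB := not (iff φ ψ)

/-- `∀ x ≤ t`. -/
def allLe (t : NTerm) (f : NTerm → FB) : FB := fun i j => .ballN i t (f (.var i) (i + 1) j)
/-- `∃ x ≤ t`. -/
def exLe (t : NTerm) (f : NTerm → FB) : FB := fun i j => .bexN i t (f (.var i) (i + 1) j)
/-- `∀ x < t`. -/
def allLt (t : NTerm) (f : NTerm → FB) : FB := allLe t fun x => imp (lt x t) (f x)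
/-- `∃ x < t`. -/
def exLt (t : NTerm) (f : NTerm → FB) : FB := exLe t fun x => and (lt x t) (f x)
/-- `∃ X ≤ t` for a string `X`. -/
def exStr (t : NTerm) (f : ℕ → FB) : FB := fun i j => .bexS j t (f j i (j + 1))

end FB

/-! ### Arithmetic on binary numbers by `Σ^B_0` formulas -/

section Arithmetic

open FB

/-- The term for the pairing function `⟨x, y⟩ = (x + y)(x + y + 1) + 2y`. -/
def NTerm.pair (x y : NTerm) : NTerm := (x + y) * (x + y + 1) + (1 + 1) * y

/-- A finite set of numbers given by a formula. It is read as the natural number with these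
binary digits. -/
abbrev Bits := NTerm → FB

/-- The set `X`. -/
def bits (X : ℕ) : Bits := fun x => mem x X

/-- The row `{x : ⟨i, x⟩ ∈ a}`. -/
def Bits.row (a : Bits) (i : NTerm) : Bits := fun x => a (i.pair x)

/-- `a` has no element `≤ b`. -/
def isZero (b : NTerm) (a : Bits) : FB := allLe b fun x => not (a x)

/-- `a` and `c` have the same elements `≤ b`. -/
def sameBits (b : NTerm) (a c : Bits) : FB := allLe b fun x => iff (a x) (c x)

/-- There is a carry into position `x` when `a` and `c` are added. -/
def carry (a c : Bits) (x : NTerm) : FB :=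
  exLt x fun k => and (and (a k) (c k)) (allLt x fun j => imp (lt k j) (or (a j) (c j)))

/-- `e = a + c`, if all elements of `a`, `c` and `e` are less than `b`. -/
def isSum (b : NTerm) (a c e : Bits) : FB :=
  allLe b fun x => iff (e x) (xor (xor (a x) (c x)) (carry a c x))

/-- `a · 2 ^ i`. -/
def shift (a : Bits) (i : NTerm) : Bits := fun x => exLe x fun y => and (eq (y + i) x) (a y)

/-- The numbers `w 0, …, w m` are the partial sums `w i = ∑ j < i, c(j) · a · 2 ^ j` of the school
algorithm; so `w m = a · c` if all elements of `c` are less than `m`. -/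
def isMulRun (b m : NTerm) (a c : Bits) (w : NTerm → Bits) : FB :=
  and (isZero b (w 0)) (allLt m fun i =>
    and (imp (c i) (isSum b (w i) (shift a i) (w (i + 1))))
      (imp (not (c i)) (sameBits b (w i) (w (i + 1)))))

/-- An integer, given by its sign (`neg` holds for negative integers) and absolute value. -/
structure IntBits where
  neg : FB
  abs : Bits

/-- A string `a` codes an integer: `0 ∈ a` says that it is negative, and the digit of its absolute
value at position `x` is `a(x + 1)`. -/
def Bits.int (a : Bits) : IntBits := ⟨a 0, fun x => a (x + 1)⟩

/-- `e = a + c` for integers, where `e` is not a negative zero. -/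
def isIntSum (b : NTerm) (a c e : IntBits) : FB :=
  let hasSign (s : FB) : FB := iff e.neg (and s (not (isZero b e.abs)))
  or (and (iff a.neg c.neg) (and (isSum b a.abs c.abs e.abs) (hasSign a.neg)))
    (and (xor a.neg c.neg)
      (or (and (isSum b e.abs c.abs a.abs) (hasSign a.neg))
        (and (isSum b e.abs a.abs c.abs) (hasSign c.neg))))

end Arithmetic

/-! ### The theory -/

section Theory

open FB NTerm

/-- String multiplication `∀ X, Y ∃ Z (Z = X · Y)`. The record `W` of the school algorithm makes
the graph of multiplication a `Σ^B_0` formula. -/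
def mulAxiom : Formula :=
  let X := 0
  let Y := 1
  let axiomFB : FB :=
    exStr (len X + len Y) fun Z => exStr (pair (len Y) (len X + len Y) + 1) fun W =>
      let b := len X + len Y + len Z + len W
      and (isMulRun b (len Y) (bits X) (bits Y) (bits W).row)
        (sameBits b (bits Z) ((bits W).row (len Y)))
  axiomFB 0 2

/-- `Y` codes the sequence `X ^ 0, …, X ^ k` of powers of the integer `n × n` matrix `X`.
The entry of `X` in row `i` and column `j` (both less than `n`) is coded by the row
`{x : ⟨i, ⟨j, x⟩⟩ ∈ X}` as an integer, and `X ^ i` is coded by the row `i` of `Y`. For `i < k`,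
the rows of `U` record the computations of all products `(X ^ i) a l · X l c` of absolute values,
and the rows of `S` record the partial sums `∑ l' < l, (X ^ i) a l' · X l' c`. -/
def isPowSeq (n k : NTerm) (X Y S U : ℕ) : FB :=
  let b := len X + len Y + len S + len U
  let x (i j : NTerm) : Bits := ((bits X).row i).row j
  let y (i a c : NTerm) : Bits := (((bits Y).row i).row a).row c
  let s (i a c l : NTerm) : Bits := ((((bits S).row i).row a).row c).row l
  let u (i a c l m : NTerm) : Bits := (((((bits U).row i).row a).row c).row l).row m
  and
    (allLt n fun a => allLt n fun c => allLe b fun z => iff (y 0 a c z) (and (eq a c) (eq z 1)))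
    (allLt k fun i => allLt n fun a => allLt n fun c =>
      and (isZero b (s i a c 0))
        (and
          (allLt n fun l =>
            and (isMulRun b (len X) (y i a l).int.abs (x l c).int.abs (u i a c l))
              (isIntSum b (s i a c l).int
                ⟨xor (y i a l).int.neg (x l c).int.neg, u i a c l (len X)⟩
                (s i a c (l + 1)).int))
          (sameBits b (y (i + 1) a c) (s i a c n))))

/-- Matrix powering: `∀ X ∀ n ∀ k`, the powers `X ^ 0, …, X ^ k` of the integer `n × n`
matrix `X` exist. All indices and digit positions that occur are at most
`B = (k + 1)(n + |X| + 1)`. -/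
def powAxiom : Formula :=
  let n := var 0
  let k := var 1
  let X := 0
  let B := (k + 1) * (n + len X + 1)
  let t := pair B (pair B (pair B (pair B (pair B B)))) + 1
  let axiomFB : FB :=
    exStr t fun Y => exStr t fun S => exStr t fun U => isPowSeq n k X Y S U
  axiomFB 2 1

/-- The theory `V#L`. -/
def VSharpL : Set Formula :=
  {φ | Basic2 φ} ∪ {φ | SigmaB0Comp φ} ∪ {mulAxiom, powAxiom}

end Theory

/-! ### The Pfaffian as a function on strings -/

/-- The permutations `σ` of `{0, …, 2n - 1}` that list the perfect matching
`{σ 0, σ 1}, {σ 2, σ 3}, …` in normal form: `σ (2i) < σ (2i + 1)` and `σ 0 < σ 2 < σ 4 < ⋯`.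
Each perfect matching is listed by exactly one such permutation. -/
def IsMatching {n : ℕ} (σ : Equiv.Perm (Fin (2 * n))) : Prop :=
  (∀ i : Fin n, σ ⟨2 * i, by omega⟩ < σ ⟨2 * i + 1, by omega⟩) ∧
    ∀ i j : Fin n, i < j → σ ⟨2 * i, by omega⟩ < σ ⟨2 * j, by omega⟩

open Classical in
/-- The Pfaffian. -/
noncomputable def pfaffian {n : ℕ} (A : Matrix (Fin (2 * n)) (Fin (2 * n)) ℤ) : ℤ :=
  ∑ σ : Equiv.Perm (Fin (2 * n)) with IsMatching σ,
    (Equiv.Perm.sign σ : ℤ) * ∏ i : Fin n, A (σ ⟨2 * i, by omega⟩) (σ ⟨2 * i + 1, by omega⟩)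

/-- The pairing function on natural numbers. -/
def natPair (x y : ℕ) : ℕ := (x + y) * (x + y + 1) + 2 * y

/-- The integer coded by a string: `0 ∈ X` says that it is not positive, and its absolute value
is `∑ 2 ^ x` over the `x` with `x + 1 ∈ X`. -/
def decodeInt (X : Finset ℕ) : ℤ :=
  (if 0 ∈ X then -1 else 1) * ∑ x ∈ X.erase 0, 2 ^ (x - 1)

/-- The code of an integer; `0` is coded by the empty string. -/
def encodeInt (z : ℤ) : Finset ℕ :=
  (z.natAbs.bitIndices.toFinset.image Nat.succ) ∪ (if z < 0 then {0} else ∅)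

/-- The integer `d × d` matrix coded by a string: the entry `(i, j)` is coded by
`{x : ⟨i, ⟨j, x⟩⟩ ∈ X}`. -/
def decodeMatrix (d : ℕ) (X : Finset ℕ) : Matrix (Fin d) (Fin d) ℤ :=
  Matrix.of fun i j =>
    decodeInt ((Finset.range (X.sup Nat.succ)).filter fun x => natPair i (natPair j x) ∈ X)

open Classical in
/-- The Pfaffian as a function on strings: the code of `pfaffian A` if `X` codes a skew
symmetric `2n × 2n` matrix `A`, and the code `∅` of zero otherwise. -/
noncomputable def pfaffianString (n : ℕ) (X : Finset ℕ) : Finset ℕ :=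
  let A := decodeMatrix (2 * n) X
  if A.transpose = -A then encodeInt (pfaffian A) else ∅

end TwoSorted

/-!
Let `J` be the standard symplectic form and `A` a skew symmetric matrix of dimension `2n`. The
Pfaffian of `A` is the coefficient of `t ^ n` in `Pf (J + t A)`, a polynomial in `t`. Eliminating
the pairs of vertices `{2h, 2h + 1}` one after the other splits off factors `1 + z h (2h)`, power
series in `t` whose coefficients add up the weights of closed walks through higher pairs. The
product of these factors is the generating function of sequences of closed walks with increasing
heads, so `Pf A` is one entry of the power `n + 1` of an integer matrix, the transfer matrix of the
walks, whose states are pairs of a head and a current vertex.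

The formula says that strings `P`, `Q`, `S`, `U` code the transfer matrix, its powers and the
intermediate results of the powering, and that `Y` consists of the digits of the entry in question,
or is empty if `A` is not skew symmetric. In `V#L` the string `P` exists by comprehension and `Q`,
`S`, `U` by the axiom of matrix powering; they are unique since every step of the computation
determines the next one, by induction for `Σ^B_0` properties. That the entry is the Pfaffian need
not be proved in `V#L`: it is a statement about the standard model.
-/

namespace TwoSorted

/-! ### Renaming of variables -/

/-- Renaming of the number variables by `f` and of the string variables by `g`. -/
def NTerm.rename (f g : ℕ → ℕ) : NTerm → NTerm
  | .var x => .var (f x)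
  | .zero => .zero
  | .one => .one
  | .add t u => .add (t.rename f g) (u.rename f g)
  | .mul t u => .mul (t.rename f g) (u.rename f g)
  | .len X => .len (g X)

/-- Renaming of all number variables by `f` and of all string variables by `g`, the bound ones
included, so that injectivity of `f` and `g` is what prevents capture. -/
def Formula.rename (f g : ℕ → ℕ) : Formula → Formula
  | .eqN t u => .eqN (t.rename f g) (u.rename f g)
  | .eqS X Y => .eqS (g X) (g Y)
  | .le t u => .le (t.rename f g) (u.rename f g)
  | .mem t X => .mem (t.rename f g) (g X)
  | .neg φ => .neg (φ.rename f g)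
  | .and φ ψ => .and (φ.rename f g) (ψ.rename f g)
  | .or φ ψ => .or (φ.rename f g) (ψ.rename f g)
  | .allN x φ => .allN (f x) (φ.rename f g)
  | .exN x φ => .exN (f x) (φ.rename f g)
  | .allS X φ => .allS (g X) (φ.rename f g)
  | .exS X φ => .exS (g X) (φ.rename f g)

theorem NTerm.eval_rename (M : Struct) (f g : ℕ → ℕ) (v : ℕ → M.Num) (s : ℕ → M.Str)
    (t : NTerm) : (t.rename f g).eval M v s = t.eval M (v ∘ f) (s ∘ g) := by
  induction t <;> simp_all [NTerm.rename, NTerm.eval]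

theorem NTerm.numVars_rename (f g : ℕ → ℕ) (t : NTerm) :
    (t.rename f g).numVars = f '' t.numVars := by
  induction t <;> simp_all [NTerm.rename, NTerm.numVars, Set.image_union]

theorem NTerm.strVars_rename (f g : ℕ → ℕ) (t : NTerm) :
    (t.rename f g).strVars = g '' t.strVars := by
  induction t <;> simp_all [NTerm.rename, NTerm.strVars, Set.image_union]

theorem Formula.sat_rename (M : Struct) {f g : ℕ → ℕ} (hf : f.Injective) (hg : g.Injective)
    (φ : Formula) (v : ℕ → M.Num) (s : ℕ → M.Str) :
    (φ.rename f g).Sat M v s ↔ φ.Sat M (v ∘ f) (s ∘ g) := by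
  induction φ generalizing v s <;>
    simp_all [Formula.rename, Formula.Sat, NTerm.eval_rename, Function.update_comp_eq_of_injective]

theorem Formula.freeStr_rename {g : ℕ → ℕ} (f : ℕ → ℕ) (hg : g.Injective) (φ : Formula) :
    (φ.rename f g).freeStr = g '' φ.freeStr := by
  induction φ <;>
    simp_all [Formula.rename, Formula.freeStr, NTerm.strVars_rename, Set.image_union,
      Set.image_sdiff, Set.image_insert_eq]

theorem Formula.IsSigmaB0.rename {f : ℕ → ℕ} (hf : f.Injective) (g : ℕ → ℕ) {φ : Formula}
    (hφ : φ.IsSigmaB0) : (φ.rename f g).IsSigmaB0 := by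
  induction hφ with
  | eqN t u => exact .eqN _ _
  | eqS X Y => exact .eqS _ _
  | le t u => exact .le _ _
  | mem t X => exact .mem _ _
  | neg _ ih => exact .neg ih
  | and _ _ ih ih' => exact .and ih ih'
  | or _ _ ih ih' => exact .or ih ih'
  | ballN hx _ ih => exact .ballN (by rwa [NTerm.numVars_rename, hf.mem_set_image]) ih
  | bexN hx _ ih => exact .bexN (by rwa [NTerm.numVars_rename, hf.mem_set_image]) ih

/-! ### Relations definable by `Σ^B_0` formulas with parameters -/

section Sequences

variable {α : Type*}

/-- The sequence with first member `x` and tail `a`. -/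
def consSeq (x : α) (a : ℕ → α) : ℕ → α
  | 0 => x
  | k + 1 => a k

@[simp] theorem consSeq_zero (x : α) (a : ℕ → α) : consSeq x a 0 = x := rfl

@[simp] theorem consSeq_succ (x : α) (a : ℕ → α) (k : ℕ) : consSeq x a (k + 1) = a k := rfl

@[simp] theorem consSeq_comp_succ (x : α) (a : ℕ → α) : consSeq x a ∘ Nat.succ = a := rfl

/-- The variable name of a slot: the slots `inl k` are for arguments and the slots `inr k` for
parameters, so that there are infinitely many names for both. -/
def slotName : ℕ ⊕ ℕ ≃ ℕ := Equiv.natSumNatEquivNat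

/-- The assignment of the sequence `a` to the argument slots and of `c` to the parameter slots. -/
def merge (a c : ℕ → α) (k : ℕ) : α := Sum.elim a c (slotName.symm k)

@[simp] theorem merge_slotName (a c : ℕ → α) (i : ℕ ⊕ ℕ) :
    merge a c (slotName i) = Sum.elim a c i := by simp [merge]

theorem merge_comp_inl (a c : ℕ → α) : merge a c ∘ (slotName ∘ Sum.inl) = a := by
  ext; simp

theorem merge_comp_inr (a c : ℕ → α) : merge a c ∘ (slotName ∘ Sum.inr) = c := by
  ext; simp

/-- The renaming of variables by a map on slots. -/
def renameSlots (f : ℕ ⊕ ℕ → ℕ ⊕ ℕ) : ℕ → ℕ := slotName ∘ f ∘ slotName.symm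

theorem renameSlots_slotName (f : ℕ ⊕ ℕ → ℕ ⊕ ℕ) (i : ℕ ⊕ ℕ) :
    renameSlots f (slotName i) = slotName (f i) := by simp [renameSlots]

theorem renameSlots_injective {f : ℕ ⊕ ℕ → ℕ ⊕ ℕ} (hf : f.Injective) :
    (renameSlots f).Injective :=
  slotName.injective.comp (hf.comp slotName.symm.injective)

theorem merge_comp_renameSlots (a c : ℕ → α) (ρ : ℕ → ℕ) :
    merge a c ∘ renameSlots (Sum.map id ρ) = merge a (c ∘ ρ) := by
  ext k
  obtain ⟨i, rfl⟩ := slotName.surjective k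
  rcases i with i | i <;> simp [renameSlots_slotName]

/-- The map on slots that turns the first argument into the first parameter. -/
def bindSlot : ℕ ⊕ ℕ → ℕ ⊕ ℕ
  | .inl 0 => .inr 0
  | .inl (k + 1) => .inl k
  | .inr k => .inr (k + 1)

theorem bindSlot_injective : bindSlot.Injective := by
  rintro ((_ | _) | _) ((_ | _) | _) <;> simp [bindSlot]

open Function in
theorem update_merge_comp_bindSlot (a c : ℕ → α) (x y : α) :
    update (merge a (consSeq y c)) (slotName (.inr 0)) x ∘ renameSlots bindSlot =
      merge (consSeq x a) c := by
  ext k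
  obtain ⟨i, rfl⟩ := slotName.surjective k
  rcases i with (_ | _) | _ <;> simp [renameSlots_slotName, bindSlot, update_apply]

end Sequences

variable {M : Struct}

instance (M : Struct) : Zero M.Num := ⟨M.zero⟩
instance (M : Struct) : One M.Num := ⟨M.one⟩
instance (M : Struct) : Add M.Num := ⟨M.add⟩
instance (M : Struct) : Mul M.Num := ⟨M.mul⟩
instance (M : Struct) : LE M.Num := ⟨M.le⟩

/-- `f` is given by a term, with the number parameters `c` and the string parameters `s`. -/
def TermFunWith (c : ℕ → M.Num) (s : ℕ → M.Str) (f : (ℕ → M.Num) → M.Num) : Prop :=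
  ∃ t : NTerm, ∀ a, t.eval M (merge a c) s = f a

/-- `P` is given by a `Σ^B_0` formula, with the number parameters `c` and the string
parameters `s`. -/
def SigmaB0RelWith (c : ℕ → M.Num) (s : ℕ → M.Str) (P : (ℕ → M.Num) → Prop) : Prop :=
  ∃ φ : Formula, φ.IsSigmaB0 ∧ ∀ a, φ.Sat M (merge a c) s ↔ P a

/-- The number-valued functions of a sequence of numbers that are given by a term with
parameters. -/
def IsTermFun (f : (ℕ → M.Num) → M.Num) : Prop :=
  ∃ (c : ℕ → M.Num) (s : ℕ → M.Str), TermFunWith c s f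

/-- The relations between the members of a sequence of numbers that are given by a `Σ^B_0` formula
with parameters. Induction and comprehension in models of the theory are available for these. -/
def IsSigmaB0Rel (P : (ℕ → M.Num) → Prop) : Prop :=
  ∃ (c : ℕ → M.Num) (s : ℕ → M.Str), SigmaB0RelWith c s P

section Parameters

variable {c d : ℕ → M.Num} {s r : ℕ → M.Str} {f g : (ℕ → M.Num) → M.Num}
  {P Q : (ℕ → M.Num) → Prop}

theorem TermFunWith.of_comp {ρ τ : ℕ → ℕ} (hf : TermFunWith (c ∘ ρ) (s ∘ τ) f) :
    TermFunWith c s f := by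
  obtain ⟨t, ht⟩ := hf
  exact ⟨t.rename (renameSlots (Sum.map id ρ)) τ, fun a => by
    rw [NTerm.eval_rename, merge_comp_renameSlots, ht]⟩

theorem SigmaB0RelWith.of_comp {ρ τ : ℕ → ℕ} (hρ : ρ.Injective) (hτ : τ.Injective)
    (hP : SigmaB0RelWith (c ∘ ρ) (s ∘ τ) P) : SigmaB0RelWith c s P := by
  obtain ⟨φ, hφ, h⟩ := hP
  have hinj := renameSlots_injective (Function.injective_id.sumMap hρ)
  exact ⟨φ.rename (renameSlots (Sum.map id ρ)) τ, hφ.rename hinj τ, fun a => by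
    rw [Formula.sat_rename _ hinj hτ, merge_comp_renameSlots, h]⟩

theorem TermFunWith.merge_left (hf : TermFunWith c s f) :
    TermFunWith (merge c d) (merge s r) f :=
  .of_comp (ρ := slotName ∘ .inl) (τ := slotName ∘ .inl) (by rwa [merge_comp_inl, merge_comp_inl])

theorem TermFunWith.merge_right (hf : TermFunWith d r f) :
    TermFunWith (merge c d) (merge s r) f :=
  .of_comp (ρ := slotName ∘ .inr) (τ := slotName ∘ .inr) (by rwa [merge_comp_inr, merge_comp_inr])

theorem SigmaB0RelWith.merge_left (hP : SigmaB0RelWith c s P) :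
    SigmaB0RelWith (merge c d) (merge s r) P :=
  have hinj := slotName.injective.comp Sum.inl_injective
  .of_comp hinj hinj (by rwa [merge_comp_inl, merge_comp_inl])

theorem SigmaB0RelWith.merge_right (hP : SigmaB0RelWith d r P) :
    SigmaB0RelWith (merge c d) (merge s r) P :=
  have hinj := slotName.injective.comp Sum.inr_injective
  .of_comp hinj hinj (by rwa [merge_comp_inr, merge_comp_inr])

theorem IsTermFun.common (hf : IsTermFun f) (hg : IsTermFun g) :
    ∃ (c : ℕ → M.Num) (s : ℕ → M.Str), TermFunWith c s f ∧ TermFunWith c s g :=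
  have ⟨_, _, hf⟩ := hf
  have ⟨_, _, hg⟩ := hg
  ⟨_, _, hf.merge_left, hg.merge_right⟩

theorem SigmaB0RelWith.ball {P : (ℕ → M.Num) → M.Num → Prop} (hf : TermFunWith c s f)
    (hP : SigmaB0RelWith c s fun b => P (fun k => b (k + 1)) (b 0)) :
    SigmaB0RelWith (consSeq M.zero c) s fun a => ∀ x ≤ f a, P a x := by
  obtain ⟨t, ht⟩ := hf
  obtain ⟨φ, hφ, h⟩ := hP
  let z := slotName (.inr 0)
  let t' := t.rename (renameSlots (Sum.map id Nat.succ)) id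
  have hz : ∀ k, renameSlots (Sum.map id Nat.succ) k ≠ z := fun k => by
    obtain ⟨i, rfl⟩ := slotName.surjective k
    rw [renameSlots_slotName, slotName.injective.ne_iff]
    rcases i with i | i <;> simp
  have ht' (a : ℕ → M.Num) (x : M.Num) :
      t'.eval M (Function.update (merge a (consSeq M.zero c)) z x) s = f a := by
    rw [NTerm.eval_rename, Function.update_comp_eq_of_notMem_range _ _ fun ⟨k, hk⟩ => hz k hk,
      merge_comp_renameSlots, consSeq_comp_succ, Function.comp_id, ht]
  have hinj := renameSlots_injective bindSlot_injective
  refine ⟨.ballN z t' (φ.rename (renameSlots bindSlot) id), .ballN ?_ (hφ.rename hinj id),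
    fun a => forall_congr' fun x => ?_⟩
  · rw [NTerm.numVars_rename]
    exact fun ⟨k, _, hk⟩ => hz k hk
  · simp only [Formula.imp, Formula.Sat, NTerm.eval, ht', Function.update_self,
      Formula.sat_rename _ hinj Function.injective_id]
    rw [update_merge_comp_bindSlot, Function.comp_id, h]
    exact imp_iff_not_or.symm

end Parameters

namespace IsTermFun

variable {f g : (ℕ → M.Num) → M.Num}

theorem var (k : ℕ) : IsTermFun (M := M) fun a => a k :=
  ⟨fun _ => M.zero, fun _ => M.str_nonempty.some, .var (slotName (.inl k)), fun a => by
    simp [NTerm.eval]⟩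

theorem const (x : M.Num) : IsTermFun fun _ => x :=
  ⟨fun _ => x, fun _ => M.str_nonempty.some, .var (slotName (.inr 0)), fun a => by
    simp [NTerm.eval]⟩

theorem add (hf : IsTermFun f) (hg : IsTermFun g) : IsTermFun fun a => f a + g a :=
  have ⟨c, s, ⟨t, ht⟩, u, hu⟩ := hf.common hg
  ⟨c, s, .add t u, fun a => congrArg₂ M.add (ht a) (hu a)⟩

theorem mul (hf : IsTermFun f) (hg : IsTermFun g) : IsTermFun fun a => f a * g a :=
  have ⟨c, s, ⟨t, ht⟩, u, hu⟩ := hf.common hg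
  ⟨c, s, .mul t u, fun a => congrArg₂ M.mul (ht a) (hu a)⟩

end IsTermFun

namespace IsSigmaB0Rel

variable {f g : (ℕ → M.Num) → M.Num} {P Q : (ℕ → M.Num) → Prop}

theorem congr (hP : IsSigmaB0Rel P) (h : ∀ a, P a ↔ Q a) : IsSigmaB0Rel Q :=
  funext (fun a => propext (h a)) ▸ hP

theorem le (hf : IsTermFun f) (hg : IsTermFun g) : IsSigmaB0Rel fun a => f a ≤ g a :=
  have ⟨c, s, ⟨t, ht⟩, u, hu⟩ := hf.common hg
  ⟨c, s, .le t u, .le _ _, fun a => Iff.of_eq (congrArg₂ M.le (ht a) (hu a))⟩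

theorem eq (hf : IsTermFun f) (hg : IsTermFun g) : IsSigmaB0Rel fun a => f a = g a :=
  have ⟨c, s, ⟨t, ht⟩, u, hu⟩ := hf.common hg
  ⟨c, s, .eqN t u, .eqN _ _, fun a => Iff.of_eq (congrArg₂ Eq (ht a) (hu a))⟩

theorem mem (hf : IsTermFun f) (X : M.Str) : IsSigmaB0Rel fun a => M.mem (f a) X :=
  have ⟨c, s, hf⟩ := hf
  have ⟨t, ht⟩ : TermFunWith c (consSeq X s) f := .of_comp (ρ := id) (τ := Nat.succ) hf
  ⟨c, consSeq X s, .mem t 0, .mem _ _, fun a => Iff.of_eq (congrArg (M.mem · X) (ht a))⟩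

theorem not (hP : IsSigmaB0Rel P) : IsSigmaB0Rel fun a => ¬ P a :=
  have ⟨c, s, φ, hφ, h⟩ := hP
  ⟨c, s, .neg φ, .neg hφ, fun a => not_congr (h a)⟩

theorem and (hP : IsSigmaB0Rel P) (hQ : IsSigmaB0Rel Q) : IsSigmaB0Rel fun a => P a ∧ Q a :=
  have ⟨c, s, hP⟩ := hP
  have ⟨d, r, hQ⟩ := hQ
  have ⟨φ, hφ, h⟩ := hP.merge_left (d := d) (r := r)
  have ⟨ψ, hψ, h'⟩ := hQ.merge_right (c := c) (s := s)
  ⟨merge c d, merge s r, .and φ ψ, .and hφ hψ, fun a => and_congr (h a) (h' a)⟩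

theorem or (hP : IsSigmaB0Rel P) (hQ : IsSigmaB0Rel Q) : IsSigmaB0Rel fun a => P a ∨ Q a :=
  (hP.not.and hQ.not).not.congr fun a => by tauto

theorem imp (hP : IsSigmaB0Rel P) (hQ : IsSigmaB0Rel Q) : IsSigmaB0Rel fun a => P a → Q a :=
  (hP.and hQ.not).not.congr fun a => by tauto

theorem iff (hP : IsSigmaB0Rel P) (hQ : IsSigmaB0Rel Q) : IsSigmaB0Rel fun a => P a ↔ Q a :=
  ((hP.imp hQ).and (hQ.imp hP)).congr fun a => by tauto

/-- The bound variable is the member `0` of the sequence, as in de Bruijn's notation. -/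
theorem ball {P : (ℕ → M.Num) → M.Num → Prop} (hf : IsTermFun f)
    (hP : IsSigmaB0Rel fun b => P (fun k => b (k + 1)) (b 0)) :
    IsSigmaB0Rel fun a => ∀ x ≤ f a, P a x :=
  have ⟨_, _, hf⟩ := hf
  have ⟨_, _, hP⟩ := hP
  ⟨_, _, .ball hf.merge_left hP.merge_right⟩

theorem bex {P : (ℕ → M.Num) → M.Num → Prop} (hf : IsTermFun f)
    (hP : IsSigmaB0Rel fun b => P (fun k => b (k + 1)) (b 0)) :
    IsSigmaB0Rel fun a => ∃ x ≤ f a, P a x :=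
  (ball (P := fun a x => ¬ P a x) hf hP.not).not.congr fun a => by push Not; rfl

end IsSigmaB0Rel

/-! ### Models of `2-BASIC` and `Σ^B_0`-comprehension -/

/-- Models of the theory `V⁰`, axiomatized by `2-BASIC` and `Σ^B_0`-comprehension. In such a model
the numbers turn out to form an ordered semiring with induction for `Σ^B_0` formulas. -/
class IsV0 (M : Struct) : Prop where
  basic : ∀ φ, Basic2 φ → M.Models φ
  comp : ∀ φ, SigmaB0Comp φ → M.Models φ

namespace IsV0

open Formula

variable {M : Struct} [IsV0 M]

theorem exists_str_mem_iff {P : M.Num → Prop} (hP : IsSigmaB0Rel fun a => P (a 0)) (y : M.Num) :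
    ∃ X : M.Str, M.len X ≤ y ∧ ∀ z ≤ y, z ≠ y → (M.mem z X ↔ P z) := by
  obtain ⟨c, s, φ, hφ, h⟩ := hP
  let ρ := renameSlots (Sum.map id Nat.succ)
  have hρ : ρ.Injective :=
    renameSlots_injective (Function.injective_id.sumMap Nat.succ_injective)
  have hX : 0 ∉ (φ.rename ρ Nat.succ).freeStr := by
    rw [freeStr_rename _ Nat.succ_injective]
    exact fun ⟨k, _, hk⟩ => k.succ_ne_zero hk
  have hne : slotName (.inr 0) ≠ slotName (.inl 0) := slotName.injective.ne Sum.inr_ne_inl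
  obtain ⟨X, hXy, hmem⟩ := comp _
    (.comp (φ.rename ρ Nat.succ) 0 (slotName (.inr 0)) (slotName (.inl 0))
      (hφ.rename hρ Nat.succ) hX hne)
    (merge (fun _ => 0) (consSeq y c)) (consSeq M.str_nonempty.some s)
  have hv (z : M.Num) : Function.update (merge (fun _ => 0) (consSeq y c)) (slotName (.inl 0)) z =
      merge (consSeq z fun _ => 0) (consSeq y c) := by
    ext k
    obtain ⟨i, rfl⟩ := slotName.surjective k
    rcases i with (_ | _) | _ <;> simp
  have hs : Function.update (consSeq M.str_nonempty.some s) 0 X ∘ Nat.succ = s :=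
    funext fun k => by simp
  refine ⟨X, by simpa [Sat, NTerm.eval] using! hXy, fun z hz hzy => ?_⟩
  have hz := hmem z
  simp only [imp, iff, lt, Sat, NTerm.eval, sat_rename _ hρ Nat.succ_injective, hv, ρ,
    merge_comp_renameSlots, consSeq_comp_succ, hs, h, merge_slotName, Sum.elim_inl, Sum.elim_inr,
    consSeq_zero, Function.update_self] at hz
  have : M.le z y := ‹z ≤ y›
  tauto

theorem sat_of_basic {φ : Formula} (hφ : Basic2 φ) (x y : M.Num) (X Y : M.Str) :
    φ.Sat M (consSeq x fun _ => y) (consSeq X fun _ => Y) := basic φ hφ _ _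

theorem sat_of_basic_num {φ : Formula} (hφ : Basic2 φ) (x y : M.Num) :
    φ.Sat M (consSeq x fun _ => y) fun _ => M.str_nonempty.some := basic φ hφ _ _

protected theorem add_one_ne_zero (x : M.Num) : x + 1 ≠ 0 := sat_of_basic_num .B1 x x

protected theorem add_one_inj {x y : M.Num} (h : x + 1 = y + 1) : x = y :=
  (sat_of_basic_num .B2 x y).resolve_left (not_not.2 h)

protected theorem add_zero (x : M.Num) : x + 0 = x := sat_of_basic_num .B3 x x

protected theorem add_add_one (x y : M.Num) : x + (y + 1) = x + y + 1 := sat_of_basic_num .B4 x y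

protected theorem mul_zero (x : M.Num) : x * 0 = 0 := sat_of_basic_num .B5 x x

protected theorem mul_add_one (x y : M.Num) : x * (y + 1) = x * y + x := sat_of_basic_num .B6 x y

protected theorem le_antisymm {x y : M.Num} (h : x ≤ y) (h' : y ≤ x) : x = y :=
  (sat_of_basic_num .B7 x y).resolve_left (not_not.2 ⟨h, h'⟩)

protected theorem le_add_right (x y : M.Num) : x ≤ x + y := sat_of_basic_num .B8 x y

protected theorem zero_le (x : M.Num) : 0 ≤ x := sat_of_basic_num .B9 x x

protected theorem le_total (x y : M.Num) : x ≤ y ∨ y ≤ x := sat_of_basic_num .B10 x y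

protected theorem le_and_ne_add_one {x y : M.Num} (h : x ≤ y) : x ≤ y + 1 ∧ x ≠ y + 1 :=
  (sat_of_basic_num .B11 x y).1.resolve_left (not_not.2 h)

protected theorem le_of_le_of_ne_add_one {x y : M.Num} (h : x ≤ y + 1) (hne : x ≠ y + 1) : x ≤ y :=
  (sat_of_basic_num .B11 x y).2.resolve_left (not_not.2 ⟨h, hne⟩)

theorem exists_add_one_eq {x : M.Num} (h : x ≠ 0) : ∃ w, w + 1 = x :=
  have ⟨w, _, hw⟩ := (sat_of_basic_num .B12 x x).resolve_left (not_not.2 h)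
  ⟨w, hw⟩

theorem le_and_ne_len_of_mem {x : M.Num} {X : M.Str} (h : M.mem x X) :
    x ≤ M.len X ∧ x ≠ M.len X :=
  (sat_of_basic .L1 x x X X).resolve_left (not_not.2 h)

theorem mem_of_add_one_eq_len {x : M.Num} {X : M.Str} (h : x + 1 = M.len X) : M.mem x X :=
  (sat_of_basic .L2 x x X X).resolve_left (not_not.2 h)

theorem ext_of_len_eq {X Y : M.Str} (hlen : M.len X = M.len Y)
    (hmem : ∀ x, M.mem x X ↔ M.mem x Y) : X = Y := by
  refine (sat_of_basic .SE M.zero M.zero X Y).resolve_left (not_not.2 ⟨hlen, fun x => ?_⟩)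
  have := hmem x
  change (¬ x ≤ M.len X) ∨ (¬ (x ≤ M.len X ∧ x ≠ M.len X) ∨
    ((¬ M.mem x X ∨ M.mem x Y) ∧ (¬ M.mem x Y ∨ M.mem x X)))
  tauto

protected theorem le_refl (x : M.Num) : x ≤ x := (IsV0.le_total x x).elim id id

protected theorem le_of_add_one_le_add_one {x y : M.Num} (h : x + 1 ≤ y + 1) : x ≤ y := by
  rcases IsV0.le_total x y with hxy | hyx
  · exact hxy
  by_cases heq : x + 1 = y + 1
  · rw [IsV0.add_one_inj heq]
    exact IsV0.le_refl y
  have ⟨hle, hne⟩ := IsV0.le_and_ne_add_one hyx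
  exact absurd (IsV0.le_antisymm hle (IsV0.le_of_le_of_ne_add_one h heq)) hne

protected theorem add_one_le_of_le_of_ne {x y : M.Num} (h : x ≤ y) (hne : x ≠ y) : x + 1 ≤ y := by
  rcases IsV0.le_total (x + 1) y with hle | hle
  · exact hle
  by_cases heq : y = x + 1
  · rw [heq]
    exact IsV0.le_refl _
  · exact absurd (IsV0.le_antisymm h (IsV0.le_of_le_of_ne_add_one hle heq)) hne

/-- Comprehension gives the string of all `z ≤ x` below which `P` holds throughout. By the axioms
for `| |` its largest element is `|X| - 1`, and this cannot be less than `x`. -/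
theorem induction {P : M.Num → Prop} (hP : IsSigmaB0Rel fun a => P (a 0)) (zero : P 0)
    (succ : ∀ x, P x → P (x + 1)) (x : M.Num) : P x := by
  obtain ⟨X, hlen, hX⟩ := exists_str_mem_iff (P := fun z => ∀ u ≤ z, P u)
    (.ball (P := fun _ x => P x) (.var 0) hP) (x + 1)
  have zero_mem : M.mem 0 X := by
    refine (hX 0 (IsV0.zero_le _) (IsV0.add_one_ne_zero x).symm).2 fun u hu => ?_
    rwa [IsV0.le_antisymm hu (IsV0.zero_le u)]
  obtain ⟨w, hw⟩ : ∃ w, w + 1 = M.len X :=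
    exists_add_one_eq fun h => (le_and_ne_len_of_mem zero_mem).2 h.symm
  have hwx : w ≤ x := IsV0.le_of_add_one_le_add_one (hw ▸ hlen)
  have hPw : ∀ u ≤ w, P u :=
    have ⟨hle, hne⟩ := IsV0.le_and_ne_add_one hwx
    (hX w hle hne).1 (mem_of_add_one_eq_len hw)
  by_cases heq : w = x
  · exact heq ▸ hPw w (IsV0.le_refl w)
  have succ_mem : M.mem (w + 1) X := by
    have ⟨hle, hne⟩ := IsV0.le_and_ne_add_one (IsV0.add_one_le_of_le_of_ne hwx heq)
    refine (hX _ hle hne).2 fun u hu => ?_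
    by_cases hu' : u = w + 1
    · exact hu' ▸ succ w (hPw w (IsV0.le_refl w))
    · exact hPw u (IsV0.le_of_le_of_ne_add_one hu hu')
  exact absurd hw (le_and_ne_len_of_mem succ_mem).2

protected theorem zero_add (x : M.Num) : 0 + x = x :=
  induction (P := fun x => 0 + x = x) (.eq (.add (.const 0) (.var 0)) (.var 0))
    (IsV0.add_zero 0) (fun x h => by rw [IsV0.add_add_one, h]) x

protected theorem add_assoc (x y z : M.Num) : x + y + z = x + (y + z) :=
  induction (P := fun z => x + y + z = x + (y + z))
    (.eq (.add (.add (.const x) (.const y)) (.var 0))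
      (.add (.const x) (.add (.const y) (.var 0))))
    (by rw [IsV0.add_zero, IsV0.add_zero])
    (fun z h => by rw [IsV0.add_add_one, h, IsV0.add_add_one, IsV0.add_add_one]) z

protected theorem one_add (x : M.Num) : 1 + x = x + 1 :=
  induction (P := fun x => 1 + x = x + 1)
    (.eq (.add (.const 1) (.var 0)) (.add (.var 0) (.const 1)))
    (by rw [IsV0.add_zero, IsV0.zero_add]) (fun x h => by rw [IsV0.add_add_one, h]) x

protected theorem add_comm (x y : M.Num) : x + y = y + x :=
  induction (P := fun y => x + y = y + x)
    (.eq (.add (.const x) (.var 0)) (.add (.var 0) (.const x)))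
    (by rw [IsV0.add_zero, IsV0.zero_add])
    (fun y h => by
      rw [IsV0.add_add_one, h, IsV0.add_assoc y 1 x, IsV0.one_add, IsV0.add_assoc]) y

protected theorem add_right_cancel {x y z : M.Num} (h : x + z = y + z) : x = y :=
  induction (P := fun z => x + z = y + z → x = y)
    (.imp (.eq (.add (.const x) (.var 0)) (.add (.const y) (.var 0)))
      (.eq (.const x) (.const y)))
    (by rw [IsV0.add_zero, IsV0.add_zero]; exact id)
    (fun z ih h => ih (IsV0.add_one_inj (by rwa [IsV0.add_add_one, IsV0.add_add_one] at h))) z h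

protected theorem mul_add (x y z : M.Num) : x * (y + z) = x * y + x * z :=
  induction (P := fun z => x * (y + z) = x * y + x * z)
    (.eq (.mul (.const x) (.add (.const y) (.var 0)))
      (.add (.mul (.const x) (.const y)) (.mul (.const x) (.var 0))))
    (by rw [IsV0.add_zero, IsV0.mul_zero, IsV0.add_zero])
    (fun z h => by
      rw [IsV0.add_add_one, IsV0.mul_add_one, h, IsV0.mul_add_one, IsV0.add_assoc]) z

protected theorem mul_assoc (x y z : M.Num) : x * y * z = x * (y * z) :=
  induction (P := fun z => x * y * z = x * (y * z))
    (.eq (.mul (.mul (.const x) (.const y)) (.var 0))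
      (.mul (.const x) (.mul (.const y) (.var 0))))
    (by rw [IsV0.mul_zero, IsV0.mul_zero, IsV0.mul_zero])
    (fun z h => by rw [IsV0.mul_add_one, h, IsV0.mul_add_one, IsV0.mul_add]) z

protected theorem zero_mul (x : M.Num) : 0 * x = 0 :=
  induction (P := fun x => 0 * x = 0) (.eq (.mul (.const 0) (.var 0)) (.const 0))
    (IsV0.mul_zero 0) (fun x h => by rw [IsV0.mul_add_one, h, IsV0.add_zero]) x

protected theorem mul_one (x : M.Num) : x * 1 = x := by
  rw [← IsV0.zero_add 1, IsV0.mul_add_one, IsV0.mul_zero, IsV0.zero_add]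

protected theorem add_one_mul (x y : M.Num) : (x + 1) * y = x * y + y :=
  induction (P := fun y => (x + 1) * y = x * y + y)
    (.eq (.mul (.add (.const x) (.const 1)) (.var 0))
      (.add (.mul (.const x) (.var 0)) (.var 0)))
    (by rw [IsV0.mul_zero, IsV0.mul_zero, IsV0.add_zero])
    (fun y h => by
      rw [IsV0.mul_add_one, h, IsV0.mul_add_one, IsV0.add_assoc, IsV0.add_assoc,
        ← IsV0.add_assoc y x 1, ← IsV0.add_assoc x y 1, IsV0.add_comm x y]) y

protected theorem mul_comm (x y : M.Num) : x * y = y * x :=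
  induction (P := fun y => x * y = y * x)
    (.eq (.mul (.const x) (.var 0)) (.mul (.var 0) (.const x)))
    (by rw [IsV0.mul_zero, IsV0.zero_mul])
    (fun y h => by rw [IsV0.mul_add_one, h, IsV0.add_one_mul]) y

noncomputable instance : CommSemiring M.Num where
  add_assoc := IsV0.add_assoc
  zero_add := IsV0.zero_add
  add_zero := IsV0.add_zero
  add_comm := IsV0.add_comm
  left_distrib := IsV0.mul_add
  right_distrib x y z := by
    rw [IsV0.mul_comm, IsV0.mul_add, IsV0.mul_comm z x, IsV0.mul_comm z y]
  zero_mul := IsV0.zero_mul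
  mul_zero := IsV0.mul_zero
  mul_assoc := IsV0.mul_assoc
  one_mul x := by rw [IsV0.mul_comm, IsV0.mul_one]
  mul_one := IsV0.mul_one
  mul_comm := IsV0.mul_comm
  nsmul := nsmulRec

protected theorem exists_add_of_le {x y : M.Num} (h : x ≤ y) : ∃ z, x + z = y := by
  obtain ⟨z, -, hz⟩ := induction (P := fun y => ∀ x ≤ y, ∃ z ≤ y, x + z = y)
    (.ball (P := fun a x => ∃ z ≤ a 0, x + z = a 0) (.var 0)
      (.bex (P := fun a z => a 0 + z = a 1) (.var 1) (.eq (.add (.var 1) (.var 0)) (.var 2))))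
    (fun x hx => ⟨0, IsV0.le_refl 0, by rw [IsV0.le_antisymm hx (IsV0.zero_le x), add_zero]⟩)
    (fun y ih x hx => by
      by_cases hxy : x = y + 1
      · exact ⟨0, IsV0.zero_le _, by rw [hxy, add_zero]⟩
      · obtain ⟨z, -, rfl⟩ := ih x (IsV0.le_of_le_of_ne_add_one hx hxy)
        refine ⟨z + 1, ?_, (add_assoc _ _ _).symm⟩
        rw [add_assoc, add_comm x]
        exact IsV0.le_add_right (z + 1) x) y x h
  exact ⟨z, hz⟩

noncomputable instance : LinearOrder M.Num where
  le_refl := IsV0.le_refl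
  le_trans x y z hxy hyz := by
    obtain ⟨u, rfl⟩ := IsV0.exists_add_of_le hxy
    obtain ⟨w, rfl⟩ := IsV0.exists_add_of_le hyz
    rw [add_assoc]
    exact IsV0.le_add_right _ _
  le_antisymm _ _ := IsV0.le_antisymm
  le_total := IsV0.le_total
  toDecidableLE := Classical.decRel _

instance : IsOrderedCancelAddMonoid M.Num where
  add_le_add_left x y h z := by
    obtain ⟨u, rfl⟩ := IsV0.exists_add_of_le h
    rw [add_right_comm]
    exact IsV0.le_add_right _ _
  le_of_add_le_add_left x y z h := by
    obtain ⟨u, hu⟩ := IsV0.exists_add_of_le h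
    rw [add_assoc, add_comm x, add_comm x] at hu
    rw [← IsV0.add_right_cancel hu]
    exact IsV0.le_add_right _ _

instance : CanonicallyOrderedAdd M.Num where
  le_self_add := IsV0.le_add_right
  le_add_self x y := by
    rw [add_comm]
    exact IsV0.le_add_right _ _
  exists_add_of_le h := have ⟨z, hz⟩ := IsV0.exists_add_of_le h; ⟨z, hz.symm⟩

protected theorem lt_add_one_iff {x y : M.Num} : x < y + 1 ↔ x ≤ y :=
  ⟨fun h => IsV0.le_of_le_of_ne_add_one h.le h.ne, fun h =>
    have ⟨hle, hne⟩ := IsV0.le_and_ne_add_one h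
    lt_of_le_of_ne hle hne⟩

protected theorem add_one_le_iff {x y : M.Num} : x + 1 ≤ y ↔ x < y :=
  ⟨(IsV0.lt_add_one_iff.2 le_rfl).trans_le, fun h => IsV0.add_one_le_of_le_of_ne h.le h.ne⟩

instance : IsOrderedRing M.Num where
  zero_le_one := IsV0.zero_le 1
  mul_le_mul_of_nonneg_left x _ y z h := by
    obtain ⟨u, rfl⟩ := IsV0.exists_add_of_le h
    rw [mul_add]
    exact IsV0.le_add_right _ _
  mul_le_mul_of_nonneg_right x _ y z h := by
    obtain ⟨u, rfl⟩ := IsV0.exists_add_of_le h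
    rw [add_mul]
    exact IsV0.le_add_right _ _

theorem lt_len_of_mem {x : M.Num} {X : M.Str} (h : M.mem x X) : x < M.len X :=
  have ⟨hle, hne⟩ := le_and_ne_len_of_mem h
  lt_of_le_of_ne hle hne

theorem len_le_of_subset {X Y : M.Str} (h : ∀ x, M.mem x X → M.mem x Y) : M.len X ≤ M.len Y := by
  by_cases h0 : M.len X = 0
  · exact h0 ▸ IsV0.zero_le _
  · obtain ⟨w, hw⟩ := exists_add_one_eq h0
    exact hw ▸ IsV0.add_one_le_iff.2 (lt_len_of_mem (h w (mem_of_add_one_eq_len hw)))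

theorem str_ext {X Y : M.Str} (h : ∀ x, M.mem x X ↔ M.mem x Y) : X = Y :=
  ext_of_len_eq (le_antisymm (len_le_of_subset fun x => (h x).1)
    (len_le_of_subset fun x => (h x).2)) h

theorem strong_induction {P : M.Num → Prop} (hP : IsSigmaB0Rel fun a => P (a 0))
    (step : ∀ x, (∀ y < x, P y) → P x) (x : M.Num) : P x :=
  induction (P := fun x => ∀ u ≤ x, P u) (.ball (P := fun _ x => P x) (.var 0) hP)
    (fun u hu => step u fun _ hy => absurd (hy.trans_le hu) not_lt_zero)
    (fun _ ih u hu => step u fun y hy => ih y (IsV0.lt_add_one_iff.1 (hy.trans_le hu))) x x le_rfl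

theorem comprehension {P : M.Num → Prop} (hP : IsSigmaB0Rel fun a => P (a 0)) (y : M.Num) :
    ∃ X : M.Str, M.len X ≤ y ∧ ∀ z, M.mem z X ↔ z < y ∧ P z := by
  obtain ⟨X, hlen, hX⟩ := exists_str_mem_iff hP y
  refine ⟨X, hlen, fun z => ⟨fun hz => ?_, fun ⟨hz, hPz⟩ => (hX z hz.le hz.ne).2 hPz⟩⟩
  have hzy := (lt_len_of_mem hz).trans_le hlen
  exact ⟨hzy, (hX z hzy.le hzy.ne).1 hz⟩

end IsV0

namespace IsSigmaB0Rel

variable {M : Struct} [IsV0 M] {f g : (ℕ → M.Num) → M.Num}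

theorem lt (hf : IsTermFun f) (hg : IsTermFun g) : IsSigmaB0Rel fun a => f a < g a :=
  ((le hf hg).and (eq hf hg).not).congr fun _ => lt_iff_le_and_ne.symm

theorem ballLt {P : (ℕ → M.Num) → M.Num → Prop} (x : M.Num)
    (hP : IsSigmaB0Rel fun b => P (fun k => b (k + 1)) (b 0)) :
    IsSigmaB0Rel fun a => ∀ y < x, P a y :=
  (ball (P := fun a y => y < x → P a y) (.const x) ((lt (.var 0) (.const x)).imp hP)).congr
    fun _ => ⟨fun h y hy => h y hy.le hy, fun h y _ hy => h y hy⟩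

end IsSigmaB0Rel

/-! ### The arithmetic of `isPowSeq`, as relations between sets of numbers -/

section Relations

variable {R : Type} [Zero R] [One R] [Add R] [Mul R]

/-- The pairing function `⟨x, y⟩`. -/
def pairNum (x y : R) : R := (x + y) * (x + y + 1) + (1 + 1) * y

/-- The row `{x : ⟨i, x⟩ ∈ A}`. -/
def row (A : R → Prop) (i : R) : R → Prop := fun x => A (pairNum i x)

/-- An integer, given by its sign and the set of binary digits of its absolute value. This is what
`IntBits` denotes. -/
structure SignedBits (R : Type) where
  neg : Prop
  abs : R → Prop

/-- The integer coded by a set, which is what `Bits.int` denotes. -/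
def signedBits (A : R → Prop) : SignedBits R := ⟨A 0, fun x => A (x + 1)⟩

variable [LE R]

/-- The meaning of `isZero`. -/
def IsZero (b : R) (A : R → Prop) : Prop := ∀ x ≤ b, ¬ A x

/-- The meaning of `sameBits`. -/
def SameBits (b : R) (A C : R → Prop) : Prop := ∀ x ≤ b, (A x ↔ C x)

/-- The meaning of `shift`. -/
def Shift (A : R → Prop) (i : R) : R → Prop := fun x => ∃ y ≤ x, y + i = x ∧ A y

variable [LT R]

/-- The meaning of `carry`. -/
def Carry (A C : R → Prop) (x : R) : Prop :=
  ∃ k < x, (A k ∧ C k) ∧ ∀ j < x, k < j → A j ∨ C j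

/-- The meaning of `isSum`. -/
def IsSum (b : R) (A C E : R → Prop) : Prop :=
  ∀ x ≤ b, (E x ↔ ¬ (¬ (A x ↔ C x) ↔ Carry A C x))

/-- The meaning of `isMulRun`. -/
def IsMulRun (b m : R) (A C : R → Prop) (W : R → R → Prop) : Prop :=
  IsZero b (W 0) ∧ ∀ i < m,
    (C i → IsSum b (W i) (Shift A i) (W (i + 1))) ∧ (¬ C i → SameBits b (W i) (W (i + 1)))

/-- The meaning of `isIntSum`. -/
def IsIntSum (b : R) (A C E : SignedBits R) : Prop :=
  ((A.neg ↔ C.neg) ∧ IsSum b A.abs C.abs E.abs ∧ (E.neg ↔ A.neg ∧ ¬ IsZero b E.abs)) ∨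
    (¬ (A.neg ↔ C.neg) ∧
      ((IsSum b E.abs C.abs A.abs ∧ (E.neg ↔ A.neg ∧ ¬ IsZero b E.abs)) ∨
        (IsSum b E.abs A.abs C.abs ∧ (E.neg ↔ C.neg ∧ ¬ IsZero b E.abs))))

/-- `E` codes the inner product `∑ l < n, P l · Q l` of integers whose factors `Q l` have at most
`m` digits. The rows of `S` are the partial sums, and the row `l` of `U` records the computation
of the product `P l · Q l`. -/
def IsInnerProduct (b m n : R) (P Q : R → R → Prop) (S U E : R → Prop) : Prop :=
  IsZero b (row S 0) ∧
    (∀ l < n,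
      IsMulRun b m (signedBits (P l)).abs (signedBits (Q l)).abs (row (row U l)) ∧
        IsIntSum b (signedBits (row S l))
          ⟨¬ ((signedBits (P l)).neg ↔ (signedBits (Q l)).neg), row (row U l) m⟩
          (signedBits (row S (l + 1)))) ∧
    SameBits b E (row S n)

/-- The meaning of `isPowSeq`, with bounds `b` for all digit positions and `m` for those of the
entries of the matrix. -/
def IsPowSeq (b m n k : R) (X Y S U : R → Prop) : Prop :=
  (∀ a < n, ∀ c < n, ∀ z ≤ b, (row (row (row Y 0) a) c z ↔ a = c ∧ z = 1)) ∧
    ∀ i < k, ∀ a < n, ∀ c < n,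
      IsInnerProduct b m n (row (row (row Y i) a)) (fun l => row (row X l) c)
        (row (row (row S i) a) c) (row (row (row U i) a) c) (row (row (row Y (i + 1)) a) c)

end Relations

/-! ### The meaning of formulas with a supply of fresh variables -/

section Meaning

variable {M : Struct}

/-- The first unused name of a number variable, with the values of the variables in use. -/
structure Scope (M : Struct) where
  next : ℕ
  val : ℕ → M.Num

/-- `w ≤ w'` if `w'` extends `w` by further variables. -/
instance : Preorder (Scope M) where
  le w w' := w.next ≤ w'.next ∧ ∀ k < w.next, w'.val k = w.val k
  le_refl _ := ⟨le_rfl, fun _ _ => rfl⟩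
  le_trans _ _ _ h h' :=
    ⟨h.1.trans h'.1, fun k hk => (h'.2 k (hk.trans_le h.1)).trans (h.2 k hk)⟩

/-- The scope with one more variable, of value `x`. -/
def Scope.push (w : Scope M) (x : M.Num) : Scope M :=
  ⟨w.next + 1, Function.update w.val w.next x⟩

theorem Scope.le_push (w : Scope M) (x : M.Num) : w ≤ w.push x :=
  ⟨Nat.le_succ _, fun _ hk => Function.update_of_ne (ne_of_lt hk) _ _⟩

/-- On the numbers of `M`, the relation `<` is the one expressed by `FB.lt`. -/
class LawfulLT (M : Struct) [LT M.Num] : Prop where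
  lt_iff : ∀ x y : M.Num, x < y ↔ x ≤ y ∧ x ≠ y

instance [IsV0 M] : LawfulLT M := ⟨fun _ _ => lt_iff_le_and_ne⟩

/-- The term `t` uses variables of the scope `w` and strings from `J`, and has the value `x`. -/
structure TermDenotes (J : Set ℕ) (s : ℕ → M.Str) (w : Scope M) (t : NTerm) (x : M.Num) :
    Prop where
  numVars_subset : t.numVars ⊆ Set.Iio w.next
  strVars_subset : t.strVars ⊆ J
  eval_eq : t.eval M w.val s = x

/-- The `Σ^B_0` formula `φ` uses variables of the scope `w` and strings from `J`, and says `P`. -/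
structure FormulaDenotes (J : Set ℕ) (s : ℕ → M.Str) (w : Scope M) (φ : Formula) (P : Prop) :
    Prop where
  isSigmaB0 : φ.IsSigmaB0
  freeNum_subset : φ.freeNum ⊆ Set.Iio w.next
  freeStr_subset : φ.freeStr ⊆ J
  sat_iff : φ.Sat M w.val s ↔ P

/-- In every extension of the scope `w`, the formula `φ` says `P`. -/
def Denotes (J : Set ℕ) (s : ℕ → M.Str) (w : Scope M) (φ : FB) (P : Prop) : Prop :=
  ∀ w' ≥ w, ∀ j, FormulaDenotes J s w' (φ w'.next j) P

/-- In every extension of the scope `w`, the formula `a t` says `A x`, where `x` is the value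
of `t`. -/
def BitsDenotes (J : Set ℕ) (s : ℕ → M.Str) (w : Scope M) (a : NTerm → FB) (A : M.Num → Prop) :
    Prop :=
  ∀ w' ≥ w, ∀ t x, TermDenotes J s w' t x → Denotes J s w' (a t) (A x)

/-- In every extension of the scope `w`, the integer `a` has the sign and the digits given
by `A`. -/
structure IntDenotes (J : Set ℕ) (s : ℕ → M.Str) (w : Scope M) (a : IntBits)
    (A : SignedBits M.Num) : Prop where
  neg : Denotes J s w a.neg A.neg
  abs : BitsDenotes J s w a.abs A.abs

variable {J : Set ℕ} {s : ℕ → M.Str} {w w' : Scope M}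

theorem NTerm.eval_congr (s : ℕ → M.Str) {v v' : ℕ → M.Num} {t : NTerm}
    (h : ∀ k ∈ t.numVars, v' k = v k) : t.eval M v' s = t.eval M v s := by
  induction t with
  | var x => exact h x rfl
  | zero => rfl
  | one => rfl
  | add t u iht ihu =>
    exact congrArg₂ M.add (iht fun k hk => h k (.inl hk)) (ihu fun k hk => h k (.inr hk))
  | mul t u iht ihu =>
    exact congrArg₂ M.mul (iht fun k hk => h k (.inl hk)) (ihu fun k hk => h k (.inr hk))
  | len X => rfl

namespace TermDenotes

variable {t u : NTerm} {x y : M.Num}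

theorem mono (h : TermDenotes J s w t x) (hw : w ≤ w') : TermDenotes J s w' t x where
  numVars_subset := h.numVars_subset.trans (Set.Iio_subset_Iio hw.1)
  strVars_subset := h.strVars_subset
  eval_eq := (NTerm.eval_congr s fun k hk => hw.2 k (h.numVars_subset hk)).trans h.eval_eq

theorem var_push (w : Scope M) (x : M.Num) : TermDenotes J s (w.push x) (.var w.next) x :=
  ⟨Set.singleton_subset_iff.2 (Nat.lt_succ_self _), Set.empty_subset _, Function.update_self ..⟩

theorem zero : TermDenotes J s w 0 (0 : M.Num) := ⟨Set.empty_subset _, Set.empty_subset _, rfl⟩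

theorem one : TermDenotes J s w 1 (1 : M.Num) := ⟨Set.empty_subset _, Set.empty_subset _, rfl⟩

theorem add (ht : TermDenotes J s w t x) (hu : TermDenotes J s w u y) :
    TermDenotes J s w (t + u) (x + y) :=
  ⟨Set.union_subset ht.1 hu.1, Set.union_subset ht.2 hu.2, congrArg₂ M.add ht.3 hu.3⟩

theorem mul (ht : TermDenotes J s w t x) (hu : TermDenotes J s w u y) :
    TermDenotes J s w (t * u) (x * y) :=
  ⟨Set.union_subset ht.1 hu.1, Set.union_subset ht.2 hu.2, congrArg₂ M.mul ht.3 hu.3⟩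

theorem len {X : ℕ} (hX : X ∈ J) : TermDenotes J s w (.len X) (M.len (s X)) :=
  ⟨Set.empty_subset _, Set.singleton_subset_iff.2 hX, rfl⟩

theorem pair (ht : TermDenotes J s w t x) (hu : TermDenotes J s w u y) :
    TermDenotes J s w (t.pair u) (pairNum x y) :=
  ((ht.add hu).mul ((ht.add hu).add one)).add ((one.add one).mul hu)

end TermDenotes

namespace BitsDenotes

variable {a : NTerm → FB} {A : M.Num → Prop} {t : NTerm} {x : M.Num}

theorem mono (h : BitsDenotes J s w a A) (hw : w ≤ w') : BitsDenotes J s w' a A :=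
  fun w'' hw'' => h w'' (hw.trans hw'')

theorem apply (h : BitsDenotes J s w a A) (ht : TermDenotes J s w t x) :
    Denotes J s w (a t) (A x) :=
  h w le_rfl t x ht

end BitsDenotes

namespace Denotes

variable {t u : NTerm} {x y : M.Num} {φ ψ : FB} {P Q : Prop}

theorem eq (ht : TermDenotes J s w t x) (hu : TermDenotes J s w u y) :
    Denotes J s w (FB.eq t u) (x = y) := fun _ hw _ =>
  have ht := ht.mono hw
  have hu := hu.mono hw
  ⟨.eqN _ _, Set.union_subset ht.1 hu.1, Set.union_subset ht.2 hu.2,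
    Iff.of_eq (congrArg₂ Eq ht.3 hu.3)⟩

theorem le (ht : TermDenotes J s w t x) (hu : TermDenotes J s w u y) :
    Denotes J s w (FB.le t u) (x ≤ y) := fun _ hw _ =>
  have ht := ht.mono hw
  have hu := hu.mono hw
  ⟨.le _ _, Set.union_subset ht.1 hu.1, Set.union_subset ht.2 hu.2,
    Iff.of_eq (congrArg₂ M.le ht.3 hu.3)⟩

theorem mem {X : ℕ} (ht : TermDenotes J s w t x) (hX : X ∈ J) :
    Denotes J s w (FB.mem t X) (M.mem x (s X)) := fun _ hw _ =>
  have ht := ht.mono hw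
  ⟨.mem _ _, ht.1, Set.union_subset ht.2 (Set.singleton_subset_iff.2 hX),
    Iff.of_eq (congrArg (M.mem · (s X)) ht.3)⟩

theorem not (h : Denotes J s w φ P) : Denotes J s w φ.not (¬ P) := fun _ hw j =>
  have h := h _ hw j
  ⟨.neg h.1, h.2, h.3, not_congr h.4⟩

theorem and (h : Denotes J s w φ P) (h' : Denotes J s w ψ Q) :
    Denotes J s w (φ.and ψ) (P ∧ Q) := fun _ hw j =>
  have h := h _ hw j
  have h' := h' _ hw j
  ⟨.and h.1 h'.1, Set.union_subset h.2 h'.2, Set.union_subset h.3 h'.3, and_congr h.4 h'.4⟩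

theorem or (h : Denotes J s w φ P) (h' : Denotes J s w ψ Q) :
    Denotes J s w (φ.or ψ) (P ∨ Q) := fun _ hw j =>
  have h := h _ hw j
  have h' := h' _ hw j
  ⟨.or h.1 h'.1, Set.union_subset h.2 h'.2, Set.union_subset h.3 h'.3, or_congr h.4 h'.4⟩

theorem congr (h : Denotes J s w φ P) (hPQ : P ↔ Q) : Denotes J s w φ Q := propext hPQ ▸ h

theorem imp (h : Denotes J s w φ P) (h' : Denotes J s w ψ Q) :
    Denotes J s w (φ.imp ψ) (P → Q) :=
  congr (h.not.or h') imp_iff_not_or.symm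

theorem iff (h : Denotes J s w φ P) (h' : Denotes J s w ψ Q) :
    Denotes J s w (φ.iff ψ) (P ↔ Q) :=
  congr ((h.imp h').and (h'.imp h)) iff_iff_implies_and_implies.symm

theorem xor (h : Denotes J s w φ P) (h' : Denotes J s w ψ Q) :
    Denotes J s w (φ.xor ψ) (¬ (P ↔ Q)) :=
  (h.iff h').not

end Denotes

section Quantifiers

open Formula Denotes

variable {t u : NTerm} {x y : M.Num} {f : NTerm → FB} {P : M.Num → Prop}

theorem BitsDenotes.push (hf : BitsDenotes J s w f P) (hw : w ≤ w') (y : M.Num) (j : ℕ) :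
    FormulaDenotes J s (w'.push y) (f (.var w'.next) (w'.next + 1) j) (P y) :=
  hf _ (hw.trans (w'.le_push y)) _ _ (.var_push w' y) _ le_rfl j

theorem TermDenotes.next_notMem (ht : TermDenotes J s w t x) : w.next ∉ t.numVars :=
  fun h => (Set.mem_Iio.1 (ht.numVars_subset h)).false

theorem freeNum_bounded_subset {φ : Formula} (ht : TermDenotes J s w t x)
    (hφ : φ.freeNum ⊆ Set.Iio (w.next + 1)) :
    ({w.next} ∪ t.numVars ∪ φ.freeNum) \ {w.next} ⊆ Set.Iio w.next := by
  rintro k ⟨(hk | hk) | hk, hne⟩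
  · exact absurd hk hne
  · exact ht.numVars_subset hk
  · exact lt_of_le_of_ne (Nat.lt_succ_iff.1 (hφ hk)) hne

theorem sat_le_push (ht : TermDenotes J s w t x) (y : M.Num) :
    (le (.var w.next) t).Sat M (w.push y).val s ↔ y ≤ x :=
  Iff.of_eq (congrArg₂ M.le (TermDenotes.var_push (J := J) w y).eval_eq
    (ht.mono (w.le_push y)).eval_eq)

theorem Denotes.allLe (ht : TermDenotes J s w t x) (hf : BitsDenotes J s w f P) :
    Denotes J s w (FB.allLe t f) (∀ y ≤ x, P y) := by
  intro w' hw j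
  have ht := ht.mono hw
  have hf := hf.push hw (j := j)
  exact ⟨.ballN ht.next_notMem (hf x).1, freeNum_bounded_subset ht (hf x).2,
    Set.union_subset (Set.union_subset (Set.empty_subset _) ht.2) (hf x).3,
    forall_congr' fun y =>
      (or_congr (not_congr (sat_le_push ht y)) (hf y).4).trans imp_iff_not_or.symm⟩

theorem Denotes.exLe (ht : TermDenotes J s w t x) (hf : BitsDenotes J s w f P) :
    Denotes J s w (FB.exLe t f) (∃ y ≤ x, P y) := by
  intro w' hw j
  have ht := ht.mono hw
  have hf := hf.push hw (j := j)
  exact ⟨.bexN ht.next_notMem (hf x).1, freeNum_bounded_subset ht (hf x).2,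
    Set.union_subset (Set.union_subset (Set.empty_subset _) ht.2) (hf x).3,
    exists_congr fun y => and_congr (sat_le_push ht y) (hf y).4⟩

variable [LT M.Num] [LawfulLT M]

theorem Denotes.lt (ht : TermDenotes J s w t x) (hu : TermDenotes J s w u y) :
    Denotes J s w (FB.lt t u) (x < y) :=
  ((le ht hu).and (eq ht hu).not).congr (LawfulLT.lt_iff x y).symm

theorem LawfulLT.le_of_lt (h : x < y) : x ≤ y := ((LawfulLT.lt_iff x y).1 h).1

theorem Denotes.allLt (ht : TermDenotes J s w t x) (hf : BitsDenotes J s w f P) :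
    Denotes J s w (FB.allLt t f) (∀ y < x, P y) :=
  (allLe (P := fun y => y < x → P y) ht fun _ hw _ _ hu =>
    (lt hu (ht.mono hw)).imp (hf _ hw _ _ hu)).congr
    ⟨fun h y hy => h y (LawfulLT.le_of_lt hy) hy, fun h y _ => h y⟩

theorem Denotes.exLt (ht : TermDenotes J s w t x) (hf : BitsDenotes J s w f P) :
    Denotes J s w (FB.exLt t f) (∃ y < x, P y) :=
  (exLe (P := fun y => y < x ∧ P y) ht fun _ hw _ _ hu =>
    (lt hu (ht.mono hw)).and (hf _ hw _ _ hu)).congr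
    ⟨fun ⟨y, _, h⟩ => ⟨y, h⟩, fun ⟨y, h⟩ => ⟨y, LawfulLT.le_of_lt h.1, h⟩⟩

end Quantifiers

section Arithmetic

variable {a c e : Bits} {A C E : M.Num → Prop} {b m t : NTerm} {x y : M.Num}

theorem BitsDenotes.bits {X : ℕ} (hX : X ∈ J) :
    BitsDenotes J s w (bits X) fun x => M.mem x (s X) :=
  fun _ _ _ _ ht => .mem ht hX

theorem BitsDenotes.row (ha : BitsDenotes J s w a A) (ht : TermDenotes J s w t x) :
    BitsDenotes J s w (a.row t) (row A x) :=
  fun _ hw _ _ hu => ha _ hw _ _ ((ht.mono hw).pair hu)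

theorem BitsDenotes.int (ha : BitsDenotes J s w a A) : IntDenotes J s w a.int (signedBits A) :=
  ⟨ha.apply .zero, fun _ hw _ _ hu => ha _ hw _ _ (hu.add .one)⟩

theorem BitsDenotes.shift (ha : BitsDenotes J s w a A) (ht : TermDenotes J s w t x) :
    BitsDenotes J s w (shift a t) (Shift A x) :=
  fun _ hw _ _ hu => .exLe hu fun _ hw' _ _ hy =>
    (Denotes.eq (hy.add (ht.mono (hw.trans hw'))) (hu.mono hw')).and
      (ha _ (hw.trans hw') _ _ hy)

theorem Denotes.isZero (hb : TermDenotes J s w b x) (ha : BitsDenotes J s w a A) :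
    Denotes J s w (isZero b a) (IsZero x A) :=
  .allLe hb fun _ hw _ _ hu => (ha _ hw _ _ hu).not

theorem Denotes.sameBits (hb : TermDenotes J s w b x) (ha : BitsDenotes J s w a A)
    (hc : BitsDenotes J s w c C) : Denotes J s w (sameBits b a c) (SameBits x A C) :=
  .allLe hb fun _ hw _ _ hu => (ha _ hw _ _ hu).iff (hc _ hw _ _ hu)

variable [LT M.Num] [LawfulLT M]

theorem BitsDenotes.carry (ha : BitsDenotes J s w a A) (hc : BitsDenotes J s w c C) :
    BitsDenotes J s w (carry a c) (Carry A C) := by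
  intro w₁ hw₁ t x ht
  refine .exLt ht fun w₂ hw₂ u k hk => ?_
  have ha := ha.mono (hw₁.trans hw₂)
  have hc := hc.mono (hw₁.trans hw₂)
  refine ((ha.apply hk).and (hc.apply hk)).and (.allLt (ht.mono hw₂) fun w₃ hw₃ u' j hj => ?_)
  exact (Denotes.lt (hk.mono hw₃) hj).imp ((ha _ hw₃ _ _ hj).or (hc _ hw₃ _ _ hj))

theorem Denotes.isSum (hb : TermDenotes J s w b x) (ha : BitsDenotes J s w a A)
    (hc : BitsDenotes J s w c C) (he : BitsDenotes J s w e E) :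
    Denotes J s w (isSum b a c e) (IsSum x A C E) :=
  .allLe hb fun _ hw _ _ hu => (he _ hw _ _ hu).iff
    (((ha _ hw _ _ hu).xor (hc _ hw _ _ hu)).xor ((ha.carry hc) _ hw _ _ hu))

theorem Denotes.isMulRun {f : NTerm → Bits} {F : M.Num → M.Num → Prop}
    (hb : TermDenotes J s w b x) (hm : TermDenotes J s w m y)
    (ha : BitsDenotes J s w a A) (hc : BitsDenotes J s w c C)
    (hf : ∀ w' ≥ w, ∀ t i, TermDenotes J s w' t i → BitsDenotes J s w' (f t) (F i)) :
    Denotes J s w (isMulRun b m a c f) (IsMulRun x y A C F) := by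
  refine (Denotes.isZero hb (hf _ le_rfl _ _ .zero)).and (.allLt hm fun w₁ hw _ i hi => ?_)
  have hfi := hf _ hw _ _ hi
  have hfi' := hf _ hw _ _ (hi.add .one)
  exact ((hc _ hw _ _ hi).imp (.isSum (hb.mono hw) hfi ((ha.mono hw).shift hi) hfi')).and
    ((hc _ hw _ _ hi).not.imp (.sameBits (hb.mono hw) hfi hfi'))

theorem Denotes.isIntSum {a c e : IntBits} {A C E : SignedBits M.Num}
    (hb : TermDenotes J s w b x) (ha : IntDenotes J s w a A) (hc : IntDenotes J s w c C)
    (he : IntDenotes J s w e E) : Denotes J s w (isIntSum b a c e) (IsIntSum x A C E) := by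
  have sign {φ : FB} {P : Prop} (h : Denotes J s w φ P) :
      Denotes J s w (e.neg.iff (φ.and (.not (TwoSorted.isZero b e.abs))))
        (E.neg ↔ P ∧ ¬ IsZero x E.abs) :=
    he.neg.iff (h.and (Denotes.isZero hb he.abs).not)
  exact ((ha.1.iff hc.1).and ((Denotes.isSum hb ha.2 hc.2 he.2).and (sign ha.1))).or
    ((ha.1.xor hc.1).and (((Denotes.isSum hb he.2 hc.2 ha.2).and (sign ha.1)).or
      ((Denotes.isSum hb he.2 ha.2 hc.2).and (sign hc.1))))

theorem Denotes.isPowSeq {n k : NTerm} {x y : M.Num} {X Y S U : ℕ} (hn : TermDenotes J s w n x)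
    (hk : TermDenotes J s w k y) (hX : X ∈ J) (hY : Y ∈ J) (hS : S ∈ J) (hU : U ∈ J) :
    Denotes J s w (isPowSeq n k X Y S U)
      (IsPowSeq (M.len (s X) + M.len (s Y) + M.len (s S) + M.len (s U)) (M.len (s X)) x y
        (M.mem · (s X)) (M.mem · (s Y)) (M.mem · (s S)) (M.mem · (s U))) := by
  have hb {w : Scope M} := (((TermDenotes.len hX (s := s) (w := w)).add (.len hY)).add
    (.len hS)).add (.len hU)
  refine .and (.allLt hn fun w₁ h₁ a a' ha => .allLt (hn.mono h₁) fun w₂ h₂ c c' hc =>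
    .allLe hb fun w₃ h₃ z z' hz => ?_) (.allLt hk fun w₁ h₁ i i' hi =>
    .allLt (hn.mono h₁) fun w₂ h₂ a a' ha =>
    .allLt (hn.mono (h₁.trans h₂)) fun w₃ h₃ c c' hc => ?_)
  · have ha := ha.mono (h₂.trans h₃)
    have hc := hc.mono h₃
    exact ((((BitsDenotes.bits hY).row .zero).row ha).row hc |>.apply hz).iff
      ((Denotes.eq ha hc).and (.eq hz .one))
  · have hi := hi.mono (h₂.trans h₃)
    have ha := ha.mono h₃
    have hn := hn.mono (h₁.trans (h₂.trans h₃))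
    have cell {Z : ℕ} (hZ : Z ∈ J) {w : Scope M} (hw : w₃ ≤ w) :=
      ((((BitsDenotes.bits hZ (s := s) (w := w)).row (hi.mono hw)).row (ha.mono hw)).row
        (hc.mono hw))
    refine .and (.isZero hb ((cell hS le_rfl).row .zero)) (.and
      (.allLt hn fun w₄ h₄ l l' hl => ?_)
      (.sameBits hb ((((BitsDenotes.bits hY).row (hi.add .one)).row ha).row hc)
        ((cell hS le_rfl).row hn)))
    have hy := ((((BitsDenotes.bits hY).row (hi.mono h₄)).row (ha.mono h₄)).row hl).int
    have hx := (((BitsDenotes.bits hX).row hl).row (hc.mono h₄)).int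
    have hu {w : Scope M} (hw : w₄ ≤ w) := (cell hU (h₄.trans hw)).row (hl.mono hw)
    exact .and (.isMulRun hb (.len hX) hy.abs hx.abs fun w₅ h₅ m m' hm => (hu h₅).row hm)
      (.isIntSum hb ((cell hS h₄).row hl).int
        ⟨hy.neg.xor hx.neg, (hu le_rfl).row (.len hX)⟩ ((cell hS h₄).row (hl.add .one)).int)

end Arithmetic

end Meaning

/-! ### Uniqueness of sums, products and powers -/

section Bounds

variable {R : Type} [LinearOrder R]

/-- The set `A` has only elements below `b`. Such sets are determined by the bounded relations
`SameBits`, `IsSum`, … with the bound `b`. -/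
def IsBelow (A : R → Prop) (b : R) : Prop := ∀ y, A y → y < b

variable {A C E A' C' : R → Prop} {b b' x : R}

theorem IsBelow.mono (hA : IsBelow A b) (hb : b ≤ b') : IsBelow A b' :=
  fun y hy => (hA y hy).trans_le hb

theorem isZero_iff (hA : IsBelow A b) : IsZero b A ↔ ∀ x, ¬ A x :=
  ⟨fun h x hx => h x (hA x hx).le hx, fun h x _ => h x⟩

theorem sameBits_iff (hA : IsBelow A b) (hC : IsBelow C b) : SameBits b A C ↔ A = C :=
  ⟨fun h => funext fun x => propext
      ⟨fun hx => (h x (hA x hx).le).1 hx, fun hx => (h x (hC x hx).le).2 hx⟩,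
    fun h x _ => iff_of_eq (congrFun h x)⟩

theorem carry_congr (hA : ∀ y < x, (A y ↔ A' y)) (hC : ∀ y < x, (C y ↔ C' y)) :
    Carry A C x ↔ Carry A' C' x := by
  refine exists_congr fun k => and_congr_right fun hk => ?_
  refine and_congr (and_congr (hA k hk) (hC k hk)) (forall₂_congr fun j hj => ?_)
  rw [hA j hj, hC j hj]

theorem not_carry_of_lt (hA : IsBelow A b) (hC : IsBelow C b) (hx : b < x) : ¬ Carry A C x := by
  rintro ⟨k, -, hk, hlink⟩
  rcases hlink b hx (hA k hk.1) with hAb | hCb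
  · exact lt_irrefl _ (hA b hAb)
  · exact lt_irrefl _ (hC b hCb)

theorem carry_add_one [One R] [Add R]
    (lt_add_one_iff : ∀ x y : R, x < y + 1 ↔ x ≤ y) :
    Carry A C (x + 1) ↔ (A x ∧ C x) ∨ ((A x ∨ C x) ∧ Carry A C x) := by
  simp only [Carry, lt_add_one_iff]
  constructor
  · rintro ⟨k, hk, hAC, hlink⟩
    rcases hk.lt_or_eq with hk | rfl
    · exact .inr ⟨hlink x le_rfl hk, k, hk, hAC, fun j hj => hlink j hj.le⟩
    · exact .inl hAC
  · rintro (hAC | ⟨hx, k, hk, hAC, hlink⟩)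
    · exact ⟨x, le_rfl, hAC, fun j hj hj' => absurd hj hj'.not_ge⟩
    · refine ⟨k, hk.le, hAC, fun j hj => ?_⟩
      rcases hj.lt_or_eq with hj | rfl
      · exact hlink j hj
      · exact fun _ => hx

theorem isSum_iff (hA : IsBelow A b) (hC : IsBelow C b) (hE : IsBelow E b) :
    IsSum b A C E ↔ ∀ x, (E x ↔ ¬ (¬ (A x ↔ C x) ↔ Carry A C x)) := by
  refine ⟨fun h x => ?_, fun h x _ => h x⟩
  rcases le_or_gt x b with hx | hx
  · exact h x hx
  · have not_carry := not_carry_of_lt hA hC hx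
    have not_A : ¬ A x := fun h => lt_asymm hx (hA x h)
    have not_C : ¬ C x := fun h => lt_asymm hx (hC x h)
    have not_E : ¬ E x := fun h => lt_asymm hx (hE x h)
    tauto

theorem IsIntSum.mono {A C E : SignedBits R} (hA : IsBelow A.abs b) (hC : IsBelow C.abs b)
    (hE : IsBelow E.abs b) (hb : b ≤ b') (h : IsIntSum b A C E) : IsIntSum b' A C E := by
  unfold IsIntSum at h ⊢
  rw [isZero_iff hE, isSum_iff hA hC hE, isSum_iff hE hC hA, isSum_iff hE hA hC] at h
  rwa [isZero_iff (hE.mono hb), isSum_iff (hA.mono hb) (hC.mono hb) (hE.mono hb),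
    isSum_iff (hE.mono hb) (hC.mono hb) (hA.mono hb),
    isSum_iff (hE.mono hb) (hA.mono hb) (hC.mono hb)]

end Bounds

section BoundsOfRows

variable {M : Struct} [IsV0 M]

open IsV0

theorem le_pairNum_right (x y : M.Num) : y ≤ pairNum x y := by
  unfold pairNum
  calc y ≤ x + y := le_add_self
    _ ≤ (x + y) * (x + y + 1) := le_mul_of_one_le_right zero_le le_add_self
    _ ≤ _ := le_self_add

theorem pairNum_mono {x y x' y' : M.Num} (hx : x ≤ x') (hy : y ≤ y') :
    pairNum x y ≤ pairNum x' y' := by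
  unfold pairNum
  gcongr

variable {A C E : M.Num → Prop} {b b' m n : M.Num}

theorem IsBelow.row (hA : IsBelow A b) (i : M.Num) : IsBelow (row A i) b :=
  fun y hy => (le_pairNum_right i y).trans_lt (hA _ hy)

theorem IsBelow.signedBits_abs (hA : IsBelow A b) : IsBelow (signedBits A).abs b :=
  fun y hy => (le_self_add : y ≤ y + 1).trans_lt (hA _ hy)

theorem IsBelow.shift (hA : IsBelow A b) {i : M.Num} (hi : i < m) :
    IsBelow (Shift A i) (b + m) := by
  rintro _ ⟨z, -, rfl, hz⟩
  exact add_lt_add (hA z hz) hi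

theorem IsMulRun.mono {d : M.Num} {W : M.Num → M.Num → Prop} (hA : IsBelow A d) (hd : d + m ≤ b)
    (hW : ∀ i, IsBelow (W i) b) (hb : b ≤ b') (h : IsMulRun b m A C W) :
    IsMulRun b' m A C W := by
  refine ⟨(isZero_iff ((hW 0).mono hb)).2 ((isZero_iff (hW 0)).1 h.1), fun i hi => ?_⟩
  have shift_below := (hA.shift hi).mono hd
  have step := h.2 i hi
  rw [isSum_iff (hW i) shift_below (hW _), sameBits_iff (hW _) (hW _)] at step
  rwa [isSum_iff ((hW i).mono hb) (shift_below.mono hb) ((hW _).mono hb),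
    sameBits_iff ((hW _).mono hb) ((hW _).mono hb)]

theorem IsInnerProduct.mono {d : M.Num} {P Q : M.Num → M.Num → Prop} {S U : M.Num → Prop}
    (hP : ∀ l, IsBelow (P l) d) (hd : d + m ≤ b) (hS : IsBelow S b) (hU : IsBelow U b)
    (hE : IsBelow E b) (hb : b ≤ b') (h : IsInnerProduct b m n P Q S U E) :
    IsInnerProduct b' m n P Q S U E := by
  obtain ⟨zero, step, last⟩ := h
  refine ⟨(isZero_iff ((hS.row 0).mono hb)).2 ((isZero_iff (hS.row 0)).1 zero), fun l hl => ?_,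
    (sameBits_iff (hE.mono hb) ((hS.row n).mono hb)).2 ((sameBits_iff hE (hS.row n)).1 last)⟩
  exact ⟨(step l hl).1.mono (hP l).signedBits_abs hd (hU.row l).row hb,
    (step l hl).2.mono (hS.row l).signedBits_abs ((hU.row l).row m) (hS.row _).signedBits_abs hb⟩

theorem IsPowSeq.mono {d k : M.Num} {X Y S U : M.Num → Prop} (hY : IsBelow Y d)
    (hd : d + m ≤ b) (one_le : 1 ≤ b) (hS : IsBelow S b) (hU : IsBelow U b) (hb : b ≤ b')
    (h : IsPowSeq b m n k X Y S U) : IsPowSeq b' m n k X Y S U := by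
  have hdb : d ≤ b := le_self_add.trans hd
  refine ⟨fun a ha c hc z _ => ?_, fun i hi a ha c hc => ?_⟩
  · rcases le_or_gt z b with hz | hz
    · exact h.1 a ha c hc z hz
    · refine iff_of_false (fun hzY => ?_) fun hz1 => ?_
      · exact lt_asymm hz (((((hY.row _).row _).row _).mono hdb) z hzY)
      · exact absurd one_le (hz1.2 ▸ hz).not_ge
  · exact (h.2 i hi a ha c hc).mono ((hY.row i).row a).row hd ((hS.row i).row a |>.row c)
      ((hU.row i).row a |>.row c) ((((hY.row _).row a).row c).mono hdb) hb

end BoundsOfRows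

section SigmaB0Sets

variable {M : Struct} {A C : M.Num → Prop}

/-- Membership in `A` is a `Σ^B_0` relation, also after substitution of a term. -/
def IsSigmaB0Set (A : M.Num → Prop) : Prop :=
  ∀ f, IsTermFun f → IsSigmaB0Rel fun a => A (f a)

theorem IsTermFun.pairNum {f g : (ℕ → M.Num) → M.Num} (hf : IsTermFun f) (hg : IsTermFun g) :
    IsTermFun fun a => pairNum (f a) (g a) :=
  ((hf.add hg).mul ((hf.add hg).add (.const 1))).add (((IsTermFun.const 1).add (.const 1)).mul hg)

theorem IsTermFun.tail {f : (ℕ → M.Num) → M.Num} (hf : IsTermFun f) :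
    IsTermFun fun a => f fun k => a (k + 1) := by
  obtain ⟨c, s, t, ht⟩ := hf
  refine ⟨c, s, t.rename (renameSlots (Sum.map Nat.succ id)) id, fun a => ?_⟩
  refine Eq.trans ?_ (ht _)
  rw [NTerm.eval_rename]
  congr 1
  funext k
  obtain ⟨k, rfl⟩ := slotName.surjective k
  cases k <;> simp [merge, renameSlots]

theorem IsSigmaB0Set.mem (X : M.Str) : IsSigmaB0Set (M.mem · X) := fun _ hf => .mem hf X

theorem IsSigmaB0Set.row (hA : IsSigmaB0Set A) (i : M.Num) : IsSigmaB0Set (row A i) :=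
  fun _ hf => hA _ ((IsTermFun.const i).pairNum hf)

theorem IsSigmaB0Set.signedBits_abs (hA : IsSigmaB0Set A) : IsSigmaB0Set (signedBits A).abs :=
  fun _ hf => hA _ (hf.add (.const 1))

theorem IsSigmaB0Set.carry [IsV0 M] (hA : IsSigmaB0Set A) (hC : IsSigmaB0Set C) :
    IsSigmaB0Set (Carry A C) := fun f hf => by
  have link : IsSigmaB0Rel fun a : ℕ → M.Num =>
      ∀ j ≤ f fun k => a (k + 1), j < (f fun k => a (k + 1)) → a 0 < j → A j ∨ C j :=
    .ball (P := fun a j => j < (f fun k => a (k + 1)) → a 0 < j → A j ∨ C j) hf.tail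
      ((IsSigmaB0Rel.lt (.var 0) hf.tail.tail).imp
        ((IsSigmaB0Rel.lt (.var 1) (.var 0)).imp ((hA _ (.var 0)).or (hC _ (.var 0)))))
  refine (IsSigmaB0Rel.bex (P := fun a k => k < f a ∧ (A k ∧ C k) ∧
    ∀ j ≤ f a, j < f a → k < j → A j ∨ C j) hf ((IsSigmaB0Rel.lt (.var 0) hf.tail).and
      (((hA _ (.var 0)).and (hC _ (.var 0))).and link))).congr fun a => ?_
  exact ⟨fun ⟨k, _, hk, hAC, hlink⟩ => ⟨k, hk, hAC, fun j hj => hlink j hj.le hj⟩,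
    fun ⟨k, hk, hAC, hlink⟩ => ⟨k, hk.le, hk, hAC, fun j _ hj => hlink j hj⟩⟩

end SigmaB0Sets

section Uniqueness

variable {M : Struct} [IsV0 M] {b : M.Num}

open IsV0

/-- The set `A` is `Σ^B_0` and has only elements below `b`. By comprehension these are the sets
coded by strings of length at most `b`. -/
structure IsCodedBelow (b : M.Num) (A : M.Num → Prop) : Prop where
  isSigmaB0Set : IsSigmaB0Set A
  isBelow : IsBelow A b

namespace IsCodedBelow

variable {A : M.Num → Prop}

theorem mem {X : M.Str} (hX : M.len X ≤ b) : IsCodedBelow b (M.mem · X) :=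
  ⟨.mem X, fun _ hz => (lt_len_of_mem hz).trans_le hX⟩

theorem row (hA : IsCodedBelow b A) (i : M.Num) : IsCodedBelow b (row A i) :=
  ⟨hA.1.row i, hA.2.row i⟩

theorem signedBits_abs (hA : IsCodedBelow b A) : IsCodedBelow b (signedBits A).abs :=
  ⟨hA.1.signedBits_abs, hA.2.signedBits_abs⟩

end IsCodedBelow

variable {A C E E' : M.Num → Prop}

theorem IsSum.cancel (hE : IsSigmaB0Set E) (hE' : IsSigmaB0Set E') (h : IsSum b E C A)
    (h' : IsSum b E' C A) : SameBits b E E' := fun x => by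
  refine strong_induction (P := fun x => x ≤ b → (E x ↔ E' x))
    ((IsSigmaB0Rel.le (.var 0) (.const b)).imp ((hE _ (.var 0)).iff (hE' _ (.var 0))))
    (fun x ih hx => ?_) x
  have sum := h x hx
  have sum' := h' x hx
  have same_carry := carry_congr (fun y hy => ih y hy (hy.le.trans hx))
    (fun y _ => Iff.rfl (a := C y))
  tauto

/-- One digit of `E + C = A` and `E' + A = C`: a carry in one of the two sums persists, since
`E + E' = 0`, and before the first carry all digits of `E` and `E'` vanish. -/
theorem carry_cases {e e' a c k k' K K' : Prop} (sum : a ↔ ¬ (¬ (e ↔ c) ↔ k))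
    (sum' : c ↔ ¬ (¬ (e' ↔ a) ↔ k')) (next : K ↔ (e ∧ c) ∨ ((e ∨ c) ∧ k))
    (next' : K' ↔ (e' ∧ a) ∨ ((e' ∨ a) ∧ k')) :
    (K ∨ K') ∨ (¬ (k ∨ k') ∧ ¬ e ∧ ¬ e') := by
  by_cases e <;> by_cases c <;> by_cases k <;> by_cases e' <;> by_cases k' <;> simp_all

theorem IsSum.carry_or_zero (hE : IsSigmaB0Set E) (hE' : IsSigmaB0Set E') (hA : IsSigmaB0Set A)
    (hC : IsSigmaB0Set C) (h : IsSum b E C A) (h' : IsSum b E' A C) {x : M.Num} (hx : x ≤ b) :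
    (Carry E C x ∨ Carry E' A x) ∨ ∀ y < x, ¬ E y ∧ ¬ E' y := by
  refine induction (P := fun x => x ≤ b → (Carry E C x ∨ Carry E' A x) ∨
    ∀ y ≤ x, y < x → ¬ E y ∧ ¬ E' y) ?_ ?_ ?_ x hx |>.imp_right fun h y hy => h y hy.le hy
  · exact (IsSigmaB0Rel.le (.var 0) (.const b)).imp (((hE.carry hC _ (.var 0)).or
      (hE'.carry hA _ (.var 0))).or (.ball (P := fun a y => y < a 0 → ¬ E y ∧ ¬ E' y)
        (.var 0) ((IsSigmaB0Rel.lt (.var 0) (.var 1)).imp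
          ((hE _ (.var 0)).not.and (hE' _ (.var 0)).not))))
  · exact fun _ => .inr fun y _ hy => absurd hy zero_le.not_gt
  · intro x ih hx
    have hx' : x ≤ b := le_self_add.trans hx
    refine (carry_cases (h x hx') (h' x hx') (carry_add_one fun _ _ : M.Num => IsV0.lt_add_one_iff)
      (carry_add_one fun _ _ : M.Num => IsV0.lt_add_one_iff)).imp_right
      fun ⟨no_carry, digit_zero⟩ y _ hy => ?_
    rcases (IsV0.lt_add_one_iff.1 hy).lt_or_eq with hy | rfl
    · exact (ih hx').resolve_left no_carry y hy.le hy
    · exact digit_zero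

theorem IsSum.eq_zero (hE : IsCodedBelow b E) (hE' : IsCodedBelow b E') (hA : IsCodedBelow b A)
    (hC : IsCodedBelow b C) (h : IsSum b E C A) (h' : IsSum b E' A C) :
    (∀ x, ¬ E x) ∧ ∀ x, ¬ E' x := by
  have top_zero {B : M.Num → Prop} (hB : IsCodedBelow b B) : ¬ B b :=
    fun h => lt_irrefl _ (hB.2 b h)
  have no_carry : ¬ (Carry E C b ∨ Carry E' A b) := by
    have sum := h b le_rfl
    have sum' := h' b le_rfl
    have := top_zero hE
    have := top_zero hE'
    have := top_zero hA
    have := top_zero hC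
    tauto
  have zero := (h.carry_or_zero hE.1 hE'.1 hA.1 hC.1 h' le_rfl).resolve_left no_carry
  exact ⟨fun x hx => (zero x (hE.2 x hx)).1 hx, fun x hx => (zero x (hE'.2 x hx)).2 hx⟩

theorem IsIntSum.unique {A C E E' : SignedBits M.Num} (hA : IsCodedBelow b A.abs)
    (hC : IsCodedBelow b C.abs) (hE : IsCodedBelow b E.abs) (hE' : IsCodedBelow b E'.abs)
    (h : IsIntSum b A C E) (h' : IsIntSum b A C E') :
    (E.neg ↔ E'.neg) ∧ E.abs = E'.abs := by
  have of_same (P : Prop) (same : SameBits b E.abs E'.abs) (sign : E.neg ↔ P ∧ ¬ IsZero b E.abs)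
      (sign' : E'.neg ↔ P ∧ ¬ IsZero b E'.abs) : (E.neg ↔ E'.neg) ∧ E.abs = E'.abs := by
    rw [sameBits_iff hE.2 hE'.2] at same
    rw [sign, sign', same]
    exact ⟨Iff.rfl, rfl⟩
  have of_zero (P Q : Prop) (zero : (∀ x, ¬ E.abs x) ∧ ∀ x, ¬ E'.abs x)
      (sign : E.neg ↔ P ∧ ¬ IsZero b E.abs) (sign' : E'.neg ↔ Q ∧ ¬ IsZero b E'.abs) :
      (E.neg ↔ E'.neg) ∧ E.abs = E'.abs := by
    rw [isZero_iff hE.2] at sign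
    rw [isZero_iff hE'.2] at sign'
    exact ⟨by tauto, funext fun x => propext (iff_of_false (zero.1 x) (zero.2 x))⟩
  rcases h with ⟨same_sign, sum, sign⟩ | ⟨diff_sign, ⟨sum, sign⟩ | ⟨sum, sign⟩⟩ <;>
    rcases h' with ⟨same_sign', sum', sign'⟩ | ⟨diff_sign', ⟨sum', sign'⟩ | ⟨sum', sign'⟩⟩ <;>
    try contradiction
  · exact of_same _ (fun x hx => (sum x hx).trans (sum' x hx).symm) sign sign'
  · exact of_same _ (sum.cancel hE.1 hE'.1 sum') sign sign'
  · exact of_zero _ _ (sum.eq_zero hE hE' hA hC sum') sign sign'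
  · exact of_zero _ _ (sum'.eq_zero hE' hE hA hC sum).symm sign sign'
  · exact of_same _ (sum.cancel hE.1 hE'.1 sum') sign sign'

theorem IsMulRun.unique {m : M.Num} {U U' : M.Num → Prop} (hU : IsCodedBelow b U)
    (hU' : IsCodedBelow b U') (h : IsMulRun b m A C (row U)) (h' : IsMulRun b m A C (row U'))
    {i : M.Num} (hi : i ≤ m) : row U i = row U' i := by
  rw [← sameBits_iff (hU.2.row i) (hU'.2.row i)]
  refine induction (P := fun i => i ≤ m → ∀ z ≤ b, (row U i z ↔ row U' i z)) ?_ ?_ ?_ i hi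
  · have entry : IsTermFun fun e : ℕ → M.Num => pairNum (e 1) (e 0) :=
      (IsTermFun.var 1).pairNum (.var 0)
    exact (IsSigmaB0Rel.le (.var 0) (.const m)).imp (.ball
      (P := fun a z => row U (a 0) z ↔ row U' (a 0) z) (.const b)
      ((hU.1 _ entry).iff (hU'.1 _ entry)))
  · exact fun _ z hz => iff_of_false (h.1 z hz) (h'.1 z hz)
  · intro i ih hi
    have hi' : i < m := IsV0.add_one_le_iff.1 hi
    have same := (sameBits_iff (hU.2.row i) (hU'.2.row i)).1 (ih hi'.le)
    have step := h.2 i hi'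
    have step' := h'.2 i hi'
    rw [← same] at step'
    by_cases hC : C i
    · exact fun z hz => (step.1 hC z hz).trans (step'.1 hC z hz).symm
    · exact fun z hz => (step.2 hC z hz).symm.trans (step'.2 hC z hz)

theorem signedBits_inj (sign : (signedBits A).neg ↔ (signedBits C).neg)
    (abs : (signedBits A).abs = (signedBits C).abs) : A = C := by
  funext z
  rcases eq_or_ne z 0 with rfl | hz
  · exact propext sign
  · obtain ⟨y, rfl⟩ := exists_add_one_eq hz
    exact congrFun abs y

theorem IsInnerProduct.unique {m n : M.Num} {P P' Q : M.Num → M.Num → Prop}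
    {S U S' U' : M.Num → Prop} (hS : IsCodedBelow b S) (hU : IsCodedBelow b U)
    (hS' : IsCodedBelow b S') (hU' : IsCodedBelow b U') (hP : ∀ l < n, P l = P' l)
    (h : IsInnerProduct b m n P Q S U E) (h' : IsInnerProduct b m n P' Q S' U' E') :
    SameBits b E E' := by
  suffices ∀ l ≤ n, ∀ z ≤ b, (row S l z ↔ row S' l z) from
    fun z hz => ((h.2.2 z hz).trans (this n le_rfl z hz)).trans (h'.2.2 z hz).symm
  intro l
  refine induction (P := fun l => l ≤ n → ∀ z ≤ b, (row S l z ↔ row S' l z)) ?_ ?_ ?_ l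
  · have entry : IsTermFun fun e : ℕ → M.Num => pairNum (e 1) (e 0) :=
      (IsTermFun.var 1).pairNum (.var 0)
    exact (IsSigmaB0Rel.le (.var 0) (.const n)).imp (.ball
      (P := fun e z => row S (e 0) z ↔ row S' (e 0) z) (.const b)
      ((hS.1 _ entry).iff (hS'.1 _ entry)))
  · exact fun _ z hz => iff_of_false (h.1 z hz) (h'.1 z hz)
  · intro l ih hl
    have hl' : l < n := IsV0.add_one_le_iff.1 hl
    have same_sum := (sameBits_iff (hS.2.row l) (hS'.2.row l)).1 (ih hl'.le)
    obtain ⟨mul, add⟩ := h.2.1 l hl'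
    obtain ⟨mul', add'⟩ := h'.2.1 l hl'
    rw [← hP l hl'] at mul' add'
    rw [← same_sum, ← mul.unique (hU.row l) (hU'.row l) mul' le_rfl] at add'
    obtain ⟨sign, abs⟩ := add.unique (hS.row l).signedBits_abs ((hU.row l).row m)
      (hS.row _).signedBits_abs (hS'.row _).signedBits_abs add'
    exact fun z _ => iff_of_eq (congrFun (signedBits_inj sign abs) z)

theorem IsPowSeq.unique {m n k : M.Num} {X Y S U Y' S' U' : M.Num → Prop}
    (hY : IsCodedBelow b Y) (hS : IsCodedBelow b S) (hU : IsCodedBelow b U)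
    (hY' : IsCodedBelow b Y') (hS' : IsCodedBelow b S') (hU' : IsCodedBelow b U')
    (h : IsPowSeq b m n k X Y S U) (h' : IsPowSeq b m n k X Y' S' U')
    {i a c : M.Num} (hi : i ≤ k) (ha : a < n) (hc : c < n) :
    row (row (row Y i) a) c = row (row (row Y' i) a) c := by
  have of_same {i a c : M.Num} :=
    (sameBits_iff (((hY.2.row i).row a).row c) (((hY'.2.row i).row a).row c)).1
  refine of_same (induction (P := fun i => i ≤ k → ∀ a < n, ∀ c < n, ∀ z ≤ b,
    (row (row (row Y i) a) c z ↔ row (row (row Y' i) a) c z)) ?_ ?_ ?_ i hi a ha c hc)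
  · have entry :
        IsTermFun fun e : ℕ → M.Num => pairNum (e 3) (pairNum (e 2) (pairNum (e 1) (e 0))) :=
      (IsTermFun.var 3).pairNum ((IsTermFun.var 2).pairNum ((IsTermFun.var 1).pairNum (.var 0)))
    refine (IsSigmaB0Rel.le (.var 0) (.const k)).imp (.ballLt (P := fun e a =>
      ∀ c < n, ∀ z ≤ b, (row (row (row Y (e 0)) a) c z ↔ row (row (row Y' (e 0)) a) c z)) n ?_)
    refine .ballLt (P := fun e c => ∀ z ≤ b,
      (row (row (row Y (e 1)) (e 0)) c z ↔ row (row (row Y' (e 1)) (e 0)) c z)) n ?_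
    exact .ball (P := fun e z =>
      row (row (row Y (e 2)) (e 1)) (e 0) z ↔ row (row (row Y' (e 2)) (e 1)) (e 0) z) (.const b)
      ((hY.1 _ entry).iff (hY'.1 _ entry))
  · exact fun _ a ha c hc z hz => (h.1 a ha c hc z hz).trans (h'.1 a ha c hc z hz).symm
  · intro i ih hi a ha c hc
    have hi' : i < k := IsV0.add_one_le_iff.1 hi
    exact (h.2 i hi' a ha c hc).unique (((hS.row i).row a).row c) (((hU.row i).row a).row c)
      (((hS'.row i).row a).row c) (((hU'.row i).row a).row c)
      (fun l hl => of_same (ih hi'.le a ha l hl)) (h'.2 i hi' a ha c hc)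

end Uniqueness

/-! ### The formula for the Pfaffian -/

section States

variable {R : Type} [One R] [Add R] [Mul R]

/-- The number of vertices of the walks: the vertices `v < 2n` of the graph, the exit `2n` and the
entrance `2n + 1`. Like the following functions, it is used for numbers and for terms. -/
def numVertices (n : R) : R := (1 + 1) * n + (1 + 1)

/-- The number of the state `(h, v)` of a walk, where `h ≤ n` is the head of the current closed
walk and `v` is the current vertex. -/
def state (n h v : R) : R := h * numVertices n + v

/-- The state in which the walks start. -/
def entryState (n : R) : R := state n n ((1 + 1) * n + 1)

/-- The state in which the walks end. -/
def exitState (n : R) : R := state n n ((1 + 1) * n)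

/-- The number of states. -/
def numStates (n : R) : R := (n + 1) * numVertices n

/-- The bound for the code of the transfer matrix of a matrix with a code of length `l`. -/
def transferBound (n l : R) : R := pairNum (numStates n) (pairNum (numStates n) (l + 1)) + 1

/-- The bound that occurs in the axiom for matrix powering. -/
def powBound (n k l : R) : R :=
  let B := (k + 1) * (n + l + 1)
  pairNum B (pairNum B (pairNum B (pairNum B (pairNum B B)))) + 1

end States

section PfaffianFormula

open FB NTerm

/-- The digits of the weight of a step from the state `(h, v)` to the state `(h', v')`. From the
entrance a walk moves to some head, where a closed walk starts. A closed walk with head `h` visits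
vertices `2c` and `2c + 1` with `c > h`, and it ends with a move to a head `h' > h`, or to the
exit. -/
def stepBits (n : NTerm) (X : ℕ) (h v h' v' : NTerm) : Bits := fun z =>
  let entry (v w : NTerm) : FB := ((bits X).row v).row w z
  let two : NTerm := 1 + 1
  or (and (and (eq h n) (eq v (two * n + 1))) (and (eq v' (two * h')) (eq z 1)))
    (and (and (lt h n) (lt v (two * n)))
      (or (and (and (lt h h') (eq v' (two * h'))) (entry v (two * h + 1)))
        (and (eq h' h) (exLt n fun c => and (lt h c)
          (or (and (eq v' (two * c)) (entry (two * c + 1) v))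
            (and (eq v' (two * c + 1)) (entry v (two * c))))))))

/-- The digits of the entry `(p, q)` of the transfer matrix. -/
def transitionBits (n : NTerm) (X : ℕ) (p q : NTerm) : Bits := fun z =>
  exLe n fun h => exLt (numVertices n) fun v => exLe n fun h₁ => exLt (numVertices n) fun v₁ =>
    and (and (eq p (state n h v)) (eq q (state n h₁ v₁))) (stepBits n X h v h₁ v₁ z)

/-- The code of the transfer matrix. -/
def transferBits (n : NTerm) (X : ℕ) : Bits := fun w =>
  exLe (numStates n) fun p => exLe (numStates n) fun q => exLe (len X + 1) fun z =>
    and (eq w (pairNum p (pairNum q z))) (transitionBits n X p q z)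

/-- The string `X` codes a skew symmetric `d × d` matrix. -/
def isSkew (d : NTerm) (X : ℕ) : FB :=
  let x (i j : NTerm) : IntBits := (((bits X).row i).row j).int
  allLt d fun i => allLt d fun j =>
    and (sameBits (len X) (x i j).abs (x j i).abs)
      (or (isZero (len X) (x i j).abs) (xor (x i j).neg (x j i).neg))

/-- The code of the Pfaffian, an entry of a power of the transfer matrix. The string `Q` codes
these powers. -/
def pfaffianBits (n : NTerm) (X Q : ℕ) : Bits := fun z =>
  and (isSkew ((1 + 1) * n) X)
    ((((bits Q).row (n + 1)).row (entryState n)).row (exitState n) z)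

/-- The string `P` is the code of the transfer matrix, `Q` is the code of its powers, with the
intermediate results `S` and `U`, and `Y` is the code of the Pfaffian. -/
def pfaffianBody (n : NTerm) (X Y P Q S U : ℕ) : FB :=
  and (allLt (transferBound n (len X)) fun w => iff (mem w P) (transferBits n X w))
    (and (isPowSeq (numStates n) (n + 1) P Q S U)
      (and (le (len Y) (len Q)) (allLt (len Q) fun z => iff (mem z Y) (pfaffianBits n X Q z))))

/-- The formula `φ(n, X, Y)` that defines the Pfaffian. -/
def pfaffianFormula : Formula :=
  let n := var 0
  let t := transferBound n (len 0)
  let t' := powBound (numStates n) (n + 1) t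
  .bexS 2 t (.bexS 3 t' (.bexS 4 t' (.bexS 5 t' (pfaffianBody n 0 1 2 3 4 5 1 6))))

end PfaffianFormula

section PfaffianSemantics

variable {R : Type} [Zero R] [One R] [Add R] [Mul R] [LE R] [LT R]

/-- The meaning of `stepBits`. -/
def StepBits (n : R) (X : R → Prop) (h v h' v' z : R) : Prop :=
  ((h = n ∧ v = (1 + 1) * n + 1) ∧ v' = (1 + 1) * h' ∧ z = 1) ∨
    ((h < n ∧ v < (1 + 1) * n) ∧
      (((h < h' ∧ v' = (1 + 1) * h') ∧ row (row X v) ((1 + 1) * h + 1) z) ∨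
        (h' = h ∧ ∃ c < n, h < c ∧
          ((v' = (1 + 1) * c ∧ row (row X ((1 + 1) * c + 1)) v z) ∨
            (v' = (1 + 1) * c + 1 ∧ row (row X v) ((1 + 1) * c) z)))))

/-- The meaning of `transitionBits`. -/
def TransitionBits (n : R) (X : R → Prop) (p q z : R) : Prop :=
  ∃ h ≤ n, ∃ v < numVertices n, ∃ h₁ ≤ n, ∃ v₁ < numVertices n,
    (p = state n h v ∧ q = state n h₁ v₁) ∧ StepBits n X h v h₁ v₁ z

/-- The meaning of `transferBits`, where `l` is the length of the code of the matrix. -/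
def TransferBits (n l : R) (X : R → Prop) (w : R) : Prop :=
  ∃ p ≤ numStates n, ∃ q ≤ numStates n, ∃ z ≤ l + 1,
    w = pairNum p (pairNum q z) ∧ TransitionBits n X p q z

/-- The meaning of `isSkew`, where `l` is the length of the code of the matrix. -/
def IsSkew (d l : R) (X : R → Prop) : Prop :=
  ∀ i < d, ∀ j < d,
    SameBits l (signedBits (row (row X i) j)).abs (signedBits (row (row X j) i)).abs ∧
      (IsZero l (signedBits (row (row X i) j)).abs ∨
        ¬ ((signedBits (row (row X i) j)).neg ↔ (signedBits (row (row X j) i)).neg))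

/-- The meaning of `pfaffianBits`, where `l` is the length of the code of the matrix. -/
def PfaffianBits (n l : R) (X Q : R → Prop) (z : R) : Prop :=
  IsSkew ((1 + 1) * n) l X ∧ row (row (row Q (n + 1)) (entryState n)) (exitState n) z

/-- The meaning of `isPowSeq` for strings of the structure `M`. -/
def IsPowRun {M : Struct} [LT M.Num] (n k : M.Num) (X Y S U : M.Str) : Prop :=
  IsPowSeq (M.len X + M.len Y + M.len S + M.len U) (M.len X) n k (M.mem · X) (M.mem · Y)
    (M.mem · S) (M.mem · U)

/-- The meaning of `pfaffianBody`. -/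
def PfaffianBody {M : Struct} [LT M.Num] (n : M.Num) (X Y P Q S U : M.Str) : Prop :=
  (∀ w < transferBound n (M.len X), M.mem w P ↔ TransferBits n (M.len X) (M.mem · X) w) ∧
    IsPowRun (numStates n) (n + 1) P Q S U ∧
    M.len Y ≤ M.len Q ∧
    ∀ z < M.len Q, M.mem z Y ↔ PfaffianBits n (M.len X) (M.mem · X) (M.mem · Q) z

end PfaffianSemantics

section PfaffianBodyMeaning

variable {M : Struct} {J : Set ℕ} {s : ℕ → M.Str} {w : Scope M}

namespace TermDenotes

variable {t h v k l : NTerm} {n h' v' k' l' : M.Num}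

theorem two : TermDenotes J s w (1 + 1) (1 + 1 : M.Num) := one.add one

theorem numVertices (ht : TermDenotes J s w t n) :
    TermDenotes J s w (numVertices t) (numVertices n) :=
  (two.mul ht).add two

theorem state (ht : TermDenotes J s w t n) (hh : TermDenotes J s w h h')
    (hv : TermDenotes J s w v v') : TermDenotes J s w (state t h v) (state n h' v') :=
  (hh.mul ht.numVertices).add hv

theorem entryState (ht : TermDenotes J s w t n) :
    TermDenotes J s w (entryState t) (entryState n) :=
  ht.state ht ((two.mul ht).add one)

theorem exitState (ht : TermDenotes J s w t n) : TermDenotes J s w (exitState t) (exitState n) :=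
  ht.state ht (two.mul ht)

theorem numStates (ht : TermDenotes J s w t n) : TermDenotes J s w (numStates t) (numStates n) :=
  (ht.add one).mul ht.numVertices

theorem transferBound (ht : TermDenotes J s w t n) (hl : TermDenotes J s w l l') :
    TermDenotes J s w (transferBound t l) (transferBound n l') :=
  (ht.numStates.pair (ht.numStates.pair (hl.add one))).add one

theorem powBound (ht : TermDenotes J s w t n) (hk : TermDenotes J s w k k')
    (hl : TermDenotes J s w l l') : TermDenotes J s w (powBound t k l) (powBound n k' l') := by
  have hB := (hk.add one).mul ((ht.add hl).add one)
  exact (hB.pair (hB.pair (hB.pair (hB.pair (hB.pair hB))))).add one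

end TermDenotes

open TermDenotes (one two)

variable [LT M.Num] [LawfulLT M] {X Q : ℕ} {t : NTerm} {n : M.Num}

theorem BitsDenotes.stepBits {th tv th' tv' : NTerm} {h v h' v' : M.Num} (hX : X ∈ J)
    (hn : TermDenotes J s w t n) (hh : TermDenotes J s w th h) (hv : TermDenotes J s w tv v)
    (hh' : TermDenotes J s w th' h') (hv' : TermDenotes J s w tv' v') :
    BitsDenotes J s w (stepBits t X th tv th' tv') (StepBits n (M.mem · (s X)) h v h' v') := by
  intro w₁ hw tz z hz
  replace hn := hn.mono hw
  replace hh := hh.mono hw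
  replace hv := hv.mono hw
  replace hh' := hh'.mono hw
  replace hv' := hv'.mono hw
  have entry {w₂ : Scope M} {t u : NTerm} {x y : M.Num} (hw₂ : w₁ ≤ w₂)
      (ht : TermDenotes J s w₂ t x) (hu : TermDenotes J s w₂ u y) :=
    (((BitsDenotes.bits hX).row ht).row hu).apply (hz.mono hw₂)
  refine .or (.and (.and (.eq hh hn) (.eq hv ((two.mul hn).add one)))
    (.and (.eq hv' (two.mul hh')) (.eq hz one))) (.and (.and (.lt hh hn) (.lt hv (two.mul hn)))
    (.or (.and (.and (.lt hh hh') (.eq hv' (two.mul hh')))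
      (entry le_rfl hv ((two.mul hh).add one)))
      (.and (.eq hh' hh) (.exLt hn fun w₂ hw₂ _ c hc => ?_))))
  exact .and (.lt (hh.mono hw₂) hc)
    (.or (.and (.eq (hv'.mono hw₂) (two.mul hc)) (entry hw₂ ((two.mul hc).add one) (hv.mono hw₂)))
      (.and (.eq (hv'.mono hw₂) ((two.mul hc).add one)) (entry hw₂ (hv.mono hw₂) (two.mul hc))))

theorem BitsDenotes.transitionBits {tp tq : NTerm} {p q : M.Num} (hX : X ∈ J)
    (hn : TermDenotes J s w t n) (hp : TermDenotes J s w tp p) (hq : TermDenotes J s w tq q) :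
    BitsDenotes J s w (transitionBits t X tp tq) (TransitionBits n (M.mem · (s X)) p q) := by
  intro w₀ hw₀ tz z hz
  refine .exLe (hn.mono hw₀) fun w₁ hw₁ _ h hh =>
    .exLt (hn.mono (hw₀.trans hw₁)).numVertices fun w₂ hw₂ _ v hv =>
    .exLe (hn.mono ((hw₀.trans hw₁).trans hw₂)) fun w₃ hw₃ _ h' hh' =>
    .exLt (hn.mono (((hw₀.trans hw₁).trans hw₂).trans hw₃)).numVertices fun w₄ hw₄ _ v' hv' => ?_
  have hw := hw₁.trans (hw₂.trans (hw₃.trans hw₄))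
  replace hn := hn.mono (hw₀.trans hw)
  replace hh := hh.mono (hw₂.trans (hw₃.trans hw₄))
  replace hv := hv.mono (hw₃.trans hw₄)
  replace hh' := hh'.mono hw₄
  exact .and (.and (.eq (hp.mono (hw₀.trans hw)) (hn.state hh hv))
    (.eq (hq.mono (hw₀.trans hw)) (hn.state hh' hv')))
    ((BitsDenotes.stepBits hX hn hh hv hh' hv').apply (hz.mono hw))

theorem BitsDenotes.transferBits (hX : X ∈ J) (hn : TermDenotes J s w t n) :
    BitsDenotes J s w (transferBits t X) (TransferBits n (M.len (s X)) (M.mem · (s X))) := by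
  intro w₀ hw₀ tx x hx
  replace hn := hn.mono hw₀
  refine .exLe hn.numStates fun w₁ hw₁ _ p hp => .exLe (hn.mono hw₁).numStates fun w₂ hw₂ _ q hq =>
    .exLe ((TermDenotes.len hX).add one) fun w₃ hw₃ _ z hz => ?_
  have hw := hw₁.trans (hw₂.trans hw₃)
  replace hp := hp.mono (hw₂.trans hw₃)
  replace hq := hq.mono hw₃
  exact .and (.eq (hx.mono hw) (hp.pair (hq.pair hz)))
    ((BitsDenotes.transitionBits hX (hn.mono hw) hp hq).apply hz)

theorem Denotes.isSkew (hX : X ∈ J) (ht : TermDenotes J s w t n) :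
    Denotes J s w (isSkew t X) (IsSkew n (M.len (s X)) (M.mem · (s X))) := by
  refine .allLt ht fun w₁ hw₁ _ i hi => .allLt (ht.mono hw₁) fun w₂ hw₂ _ j hj => ?_
  replace hi := hi.mono hw₂
  have entry := (((BitsDenotes.bits hX).row hi).row hj).int
  have entry' := (((BitsDenotes.bits hX).row hj).row hi).int
  exact .and (.sameBits (.len hX) entry.abs entry'.abs)
    (.or (.isZero (.len hX) entry.abs) (.xor entry.neg entry'.neg))

theorem BitsDenotes.pfaffianBits (hX : X ∈ J) (hQ : Q ∈ J) (hn : TermDenotes J s w t n) :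
    BitsDenotes J s w (pfaffianBits t X Q)
      (PfaffianBits n (M.len (s X)) (M.mem · (s X)) (M.mem · (s Q))) := by
  intro w₁ hw _ x hx
  replace hn := hn.mono hw
  exact .and (.isSkew hX (two.mul hn))
    (((((BitsDenotes.bits hQ).row (hn.add one)).row hn.entryState).row hn.exitState).apply hx)

theorem Denotes.pfaffianBody {Y P S U : ℕ} (hX : X ∈ J) (hY : Y ∈ J) (hP : P ∈ J) (hQ : Q ∈ J)
    (hS : S ∈ J) (hU : U ∈ J) (hn : TermDenotes J s w t n) :
    Denotes J s w (pfaffianBody t X Y P Q S U)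
      (PfaffianBody n (s X) (s Y) (s P) (s Q) (s S) (s U)) :=
  .and (.allLt (hn.transferBound (.len hX)) fun _ hw _ _ hx => (Denotes.mem hx hP).iff
      (BitsDenotes.transferBits hX hn _ hw _ _ hx))
    (.and (.isPowSeq hn.numStates (hn.add one) hP hQ hS hU)
      (.and (.le (.len hY) (.len hQ)) (.allLt (.len hQ) fun _ hw _ _ hx =>
        (Denotes.mem hx hY).iff (BitsDenotes.pfaffianBits hX hQ hn _ hw _ _ hx))))

end PfaffianBodyMeaning

theorem BitsDenotes.isSigmaB0Rel {M : Struct} {J : Set ℕ} {s : ℕ → M.Str} {w : Scope M}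
    {a : Bits} {A : M.Num → Prop} (h : BitsDenotes J s w a A) :
    IsSigmaB0Rel fun e => A (e 0) := by
  have sat := h.push le_rfl (j := 0)
  let ρ : ℕ → ℕ := fun k => slotName (if k = w.next then .inl 0 else .inr k)
  have hρ : ρ.Injective := by
    refine slotName.injective.comp fun k l hkl => ?_
    split_ifs at hkl <;> simp_all
  refine ⟨w.val, s, (a (.var w.next) (w.next + 1) 0).rename ρ id, (sat M.zero).1.rename hρ id,
    fun e => (Formula.sat_rename _ hρ Function.injective_id _ _ _).trans ?_⟩
  have : merge e w.val ∘ ρ = (w.push (e 0)).val := by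
    ext k
    by_cases hk : k = w.next <;> simp [ρ, hk, merge, Scope.push]
  rw [this, Function.comp_id]
  exact (sat (e 0)).sat_iff

section PfaffianFormulaProperties

variable {M : Struct} {J : Set ℕ} {s : ℕ → M.Str} {v : ℕ → M.Num}

theorem TermDenotes.var_of_lt {i k : ℕ} (hi : i < k) : TermDenotes J s ⟨k, v⟩ (.var i) (v i) :=
  ⟨Set.singleton_subset_iff.2 hi, Set.empty_subset _, rfl⟩

theorem transferBound_denotes (h0 : 0 ∈ J) : TermDenotes J s ⟨1, v⟩
    (transferBound (.var 0) (.len 0)) (transferBound (v 0) (M.len (s 0))) :=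
  (TermDenotes.var_of_lt Nat.zero_lt_one).transferBound (.len h0)

theorem powBound_denotes (h0 : 0 ∈ J) : TermDenotes J s ⟨1, v⟩
    (powBound (numStates (.var 0)) (.var 0 + 1) (transferBound (.var 0) (.len 0)))
    (powBound (numStates (v 0)) (v 0 + 1) (transferBound (v 0) (M.len (s 0)))) :=
  have hn := TermDenotes.var_of_lt Nat.zero_lt_one
  hn.numStates.powBound (hn.add .one) (transferBound_denotes h0)

theorem pfaffianBody_denotes [LT M.Num] [LawfulLT M] (hJ : Set.Iio 6 ⊆ J) :
    FormulaDenotes J s ⟨1, v⟩ (pfaffianBody (.var 0) 0 1 2 3 4 5 1 6)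
      (PfaffianBody (v 0) (s 0) (s 1) (s 2) (s 3) (s 4) (s 5)) :=
  Denotes.pfaffianBody (hJ (by simp)) (hJ (by simp)) (hJ (by simp)) (hJ (by simp)) (hJ (by simp))
    (hJ (by simp)) (.var_of_lt Nat.zero_lt_one) _ le_rfl 6

theorem sat_pfaffianFormula [LT M.Num] [LawfulLT M] :
    pfaffianFormula.Sat M v s ↔
      ∃ P, M.len P ≤ transferBound (v 0) (M.len (s 0)) ∧
        let t := powBound (numStates (v 0)) (v 0 + 1) (transferBound (v 0) (M.len (s 0)))
        ∃ Q, M.len Q ≤ t ∧ ∃ S, M.len S ≤ t ∧ ∃ U, M.len U ≤ t ∧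
          PfaffianBody (v 0) (s 0) (s 1) P Q S U := by
  have body (s : ℕ → M.Str) :=
    (pfaffianBody_denotes (s := s) (v := v) (Set.subset_univ _)).sat_iff
  have transferBound_eval (s : ℕ → M.Str) :=
    (transferBound_denotes (s := s) (v := v) (Set.mem_univ 0)).eval_eq
  have powBound_eval (s : ℕ → M.Str) :=
    (powBound_denotes (s := s) (v := v) (Set.mem_univ 0)).eval_eq
  simp only [pfaffianFormula, Formula.bexS, Formula.Sat, body, NTerm.eval]
  simp only [transferBound_eval, powBound_eval, ne_eq, Nat.reduceEqDiff, not_false_eq_true,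
    Function.update_of_ne, OfNat.zero_ne_ofNat, OfNat.one_ne_ofNat, Function.update_self]
  rfl

instance : LawfulLT stdModel := ⟨fun _ _ => lt_iff_le_and_ne⟩

theorem pfaffianFormula_isSigmaB1 : pfaffianFormula.IsSigmaB1 := by
  let s : ℕ → stdModel.Str := fun _ => ∅
  let v : ℕ → stdModel.Num := fun _ => 0
  have body := pfaffianBody_denotes (s := s) (v := v) subset_rfl
  have bounds := (transferBound_denotes (J := {0}) (s := s) (v := v) rfl).strVars_subset
  have bounds' := (powBound_denotes (J := {0}) (s := s) (v := v) rfl).strVars_subset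
  refine ⟨[(2, _), (3, _), (4, _), (5, _)], _, body.isSigmaB0, ?_, rfl⟩
  simp only [List.forall_mem_cons, List.not_mem_nil, false_imp_iff, implies_true, and_true]
  have not_bounds {k : ℕ} (hk : k ≠ 0) := fun h => hk (bounds h : k = 0)
  have not_bounds' {k : ℕ} (hk : k ≠ 0) := fun h => hk (bounds' h : k = 0)
  refine ⟨?_, ?_, ?_, ?_⟩ <;>
    exact ⟨not_bounds (by decide), not_bounds' (by decide), not_bounds' (by decide),
      not_bounds' (by decide)⟩

theorem freeNum_bexS_subset {I : Set ℕ} {X : ℕ} {t : NTerm} {φ : Formula} (ht : t.numVars ⊆ I)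
    (hφ : φ.freeNum ⊆ I) : (Formula.bexS X t φ).freeNum ⊆ I :=
  Set.union_subset (Set.union_subset (Set.empty_subset _) ht) hφ

theorem freeStr_bexS_subset {k : ℕ} {t : NTerm} {φ : Formula} (ht : t.strVars ⊆ Set.Iio k)
    (hφ : φ.freeStr ⊆ Set.Iio (k + 1)) : (Formula.bexS k t φ).freeStr ⊆ Set.Iio k := by
  rintro X ⟨(hX | hX) | hX, hne⟩
  · exact absurd hX hne
  · exact ht hX
  · exact lt_of_le_of_ne (Nat.lt_succ_iff.1 (hφ hX)) hne

theorem pfaffianFormula_freeNum : pfaffianFormula.freeNum ⊆ Set.Iio 1 := by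
  let s : ℕ → stdModel.Str := fun _ => ∅
  let v : ℕ → stdModel.Num := fun _ => 0
  have bound := (powBound_denotes (s := s) (v := v) (Set.mem_univ 0)).numVars_subset
  exact freeNum_bexS_subset (transferBound_denotes (s := s) (v := v) (Set.mem_univ 0)).1
    (freeNum_bexS_subset bound (freeNum_bexS_subset bound (freeNum_bexS_subset bound
      (pfaffianBody_denotes (s := s) (v := v) (Set.subset_univ _)).2)))

theorem pfaffianFormula_freeStr : pfaffianFormula.freeStr ⊆ Set.Iic 1 := by
  let s : ℕ → stdModel.Str := fun _ => ∅
  let v : ℕ → stdModel.Num := fun _ => 0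
  have bound {k : ℕ} (hk : 0 < k) :=
    (powBound_denotes (J := Set.Iio k) (s := s) (v := v) hk).strVars_subset
  rw [show Set.Iic 1 = Set.Iio 2 from Set.ext fun _ => Nat.lt_succ_iff.symm]
  refine freeStr_bexS_subset
    (transferBound_denotes (s := s) (v := v) (Set.mem_Iio.2 Nat.zero_lt_two)).2 ?_
  exact freeStr_bexS_subset (bound (by decide)) (freeStr_bexS_subset (bound (by decide))
    (freeStr_bexS_subset (bound (by decide)) (pfaffianBody_denotes (s := s) (v := v) subset_rfl).3))

end PfaffianFormulaProperties

/-! ### Existence and uniqueness of the value of the formula -/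

theorem exists_isPowRun {M : Struct} [LT M.Num] [LawfulLT M] (hM : M.Models powAxiom)
    (n k : M.Num) (X : M.Str) :
    ∃ Y, M.len Y ≤ powBound n k (M.len X) ∧ ∃ S, M.len S ≤ powBound n k (M.len X) ∧
      ∃ U, M.len U ≤ powBound n k (M.len X) ∧ IsPowRun n k X Y S U := by
  let v : ℕ → M.Num := consSeq n fun _ => k
  have n_denotes (s : ℕ → M.Str) : TermDenotes Set.univ s ⟨2, v⟩ (.var 0) n :=
    .var_of_lt Nat.zero_lt_two
  have k_denotes (s : ℕ → M.Str) : TermDenotes Set.univ s ⟨2, v⟩ (.var 1) k :=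
    .var_of_lt Nat.one_lt_two
  have bound {s : ℕ → M.Str} {Y : M.Str} (hs : s 0 = X)
      (hY : M.len Y ≤ (powBound (NTerm.var 0) (.var 1) (.len 0)).eval M v s) :
      M.len Y ≤ powBound n k (M.len X) := by
    rwa [((n_denotes s).powBound (k_denotes s) (.len (Set.mem_univ _))).eval_eq, hs] at hY
  have run (s : ℕ → M.Str) :=
    (Denotes.isPowSeq (n_denotes s) (k_denotes s) (Set.mem_univ 0) (Set.mem_univ 1)
      (Set.mem_univ 2) (Set.mem_univ 3) _ le_rfl 4).sat_iff
  obtain ⟨Y, hY, S, hS, U, hU, hrun⟩ := hM v fun _ => X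
  exact ⟨Y, bound (s := Function.update _ 1 Y) rfl hY, S,
    bound (s := Function.update (Function.update _ 1 Y) 2 S) rfl hS, U,
    bound (s := Function.update (Function.update (Function.update _ 1 Y) 2 S) 3 U) rfl hU,
    (run _).1 hrun⟩

section ValueInModels

variable {M : Struct} [IsV0 M]

open IsV0

theorem IsPowRun.unique {n k : M.Num} {X Y S U Y' S' U' : M.Str} (hX : 0 < M.len X)
    (h : IsPowRun n k X Y S U) (h' : IsPowRun n k X Y' S' U') {i a c : M.Num} (hi : i ≤ k)
    (ha : a < n) (hc : c < n) :
    row (row (row (M.mem · Y) i) a) c = row (row (row (M.mem · Y') i) a) c := by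
  let bound (Y S U : M.Str) : M.Num := M.len X + M.len Y + M.len S + M.len U
  have le_bound (Y S U : M.Str) :
      M.len Y ≤ bound Y S U ∧ M.len S ≤ bound Y S U ∧ M.len U ≤ bound Y S U :=
    ⟨le_add_self.trans (le_self_add.trans le_self_add), le_add_self.trans le_self_add, le_add_self⟩
  have one_le : 1 ≤ M.len X := (zero_add 1).symm.trans_le (IsV0.add_one_le_iff.2 hX)
  have mono {Y S U : M.Str} {b : M.Num} (hb : bound Y S U ≤ b) (h : IsPowRun n k X Y S U) :
      IsPowSeq b (M.len X) n k (M.mem · X) (M.mem · Y) (M.mem · S) (M.mem · U) :=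
    IsPowSeq.mono (d := M.len Y) (fun _ => lt_len_of_mem)
      ((add_comm _ _).trans_le (le_self_add.trans le_self_add))
      (one_le.trans (le_self_add.trans (le_self_add.trans le_self_add)))
      (fun _ hz => (lt_len_of_mem hz).trans_le (le_bound Y S U).2.1)
      (fun _ hz => (lt_len_of_mem hz).trans_le (le_bound Y S U).2.2) hb h
  have left : bound Y S U ≤ bound Y S U + bound Y' S' U' := le_self_add
  have right : bound Y' S' U' ≤ bound Y S U + bound Y' S' U' := le_add_self
  obtain ⟨hY, hS, hU⟩ := le_bound Y S U
  obtain ⟨hY', hS', hU'⟩ := le_bound Y' S' U'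
  exact IsPowSeq.unique (.mem (hY.trans left)) (.mem (hS.trans left)) (.mem (hU.trans left))
    (.mem (hY'.trans right)) (.mem (hS'.trans right)) (.mem (hU'.trans right))
    (mono left h) (mono right h') hi ha hc

theorem state_lt_numStates {R : Type} [CommSemiring R] [PartialOrder R] [CanonicallyOrderedAdd R]
    [IsOrderedCancelAddMonoid R] {n h v : R} (hh : h ≤ n) (hv : v < numVertices n) :
    state n h v < numStates n := by
  rw [state, numStates, add_mul, one_mul]
  exact add_lt_add_of_le_of_lt (mul_le_mul_left hh _) hv

theorem exit_lt_numVertices (n : M.Num) : (1 + 1) * n < numVertices n := by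
  rw [numVertices, ← add_assoc, IsV0.lt_add_one_iff]
  exact le_self_add

theorem entry_lt_numVertices (n : M.Num) : (1 + 1) * n + 1 < numVertices n := by
  rw [numVertices, ← add_assoc, IsV0.lt_add_one_iff]

theorem exists_transferBits (n l : M.Num) (X : M.Num → Prop) :
    ∃ w < transferBound n l, TransferBits n l X w := by
  have entry_le := (state_lt_numStates le_rfl (entry_lt_numVertices n)).le
  have exit_le := (state_lt_numStates le_rfl (exit_lt_numVertices n)).le
  have one_le : (1 : M.Num) ≤ l + 1 := le_add_self
  exact ⟨pairNum (entryState n) (pairNum (exitState n) 1),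
    IsV0.lt_add_one_iff.2 (pairNum_mono entry_le (pairNum_mono exit_le one_le)),
    _, entry_le, _, exit_le, 1, one_le, rfl, n, le_rfl, _, entry_lt_numVertices n, n, le_rfl, _,
    exit_lt_numVertices n, ⟨rfl, rfl⟩, .inl ⟨⟨rfl, rfl⟩, rfl, rfl⟩⟩

namespace PfaffianBody

variable {n : M.Num} {X Y P Q S U Y' P' Q' S' U' : M.Str}

theorem len_pos (h : PfaffianBody n X Y P Q S U) : 0 < M.len P := by
  obtain ⟨w, hw, hbits⟩ := exists_transferBits n (M.len X) (M.mem · X)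
  exact zero_le.trans_lt (lt_len_of_mem ((h.1 w hw).2 hbits))

theorem mem_iff (h : PfaffianBody n X Y P Q S U) (z : M.Num) :
    M.mem z Y ↔ PfaffianBits n (M.len X) (M.mem · X) (M.mem · Q) z := by
  obtain ⟨-, -, hY, digits⟩ := h
  by_cases hz : z < M.len Q
  · exact digits z hz
  · have isBelow : IsBelow (M.mem · Q) (M.len Q) := fun _ => lt_len_of_mem
    exact iff_of_false (fun hzY => hz ((lt_len_of_mem hzY).trans_le hY))
      fun hzQ => hz ((((isBelow.row _).row _).row _) z hzQ.2)

theorem transfer_unique (hP : M.len P ≤ transferBound n (M.len X))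
    (hP' : M.len P' ≤ transferBound n (M.len X)) (h : PfaffianBody n X Y P Q S U)
    (h' : PfaffianBody n X Y' P' Q' S' U') : P = P' := by
  refine str_ext fun w => ?_
  by_cases hw : w < transferBound n (M.len X)
  · exact (h.1 w hw).trans (h'.1 w hw).symm
  · exact iff_of_false (fun hwP => hw ((lt_len_of_mem hwP).trans_le hP))
      fun hwP' => hw ((lt_len_of_mem hwP').trans_le hP')

theorem unique (hP : M.len P ≤ transferBound n (M.len X))
    (hP' : M.len P' ≤ transferBound n (M.len X)) (h : PfaffianBody n X Y P Q S U)
    (h' : PfaffianBody n X Y' P' Q' S' U') : Y = Y' := by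
  obtain rfl := transfer_unique hP hP' h h'
  refine str_ext fun z => ?_
  have same_entry : row (row (row (M.mem · Q) (n + 1)) (entryState n)) (exitState n) =
      row (row (row (M.mem · Q') (n + 1)) (entryState n)) (exitState n) :=
    h.2.1.unique h.len_pos h'.2.1 le_rfl (state_lt_numStates le_rfl (entry_lt_numVertices n))
      (state_lt_numStates le_rfl (exit_lt_numVertices n))
  rw [h.mem_iff, h'.mem_iff, PfaffianBits, PfaffianBits, same_entry]

end PfaffianBody

theorem powBound_mono {n k l l' : M.Num} (h : l ≤ l') : powBound n k l ≤ powBound n k l' := by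
  have hB : (k + 1) * (n + l + 1) ≤ (k + 1) * (n + l' + 1) := by gcongr
  exact add_le_add_left (pairNum_mono hB
    (pairNum_mono hB (pairNum_mono hB (pairNum_mono hB (pairNum_mono hB hB))))) 1

theorem exists_pfaffianBody (hM : M.Models powAxiom) (n : M.Num) (X : M.Str) :
    ∃ Y P, M.len P ≤ transferBound n (M.len X) ∧
      let t := powBound (numStates n) (n + 1) (transferBound n (M.len X))
      ∃ Q, M.len Q ≤ t ∧ ∃ S, M.len S ≤ t ∧ ∃ U, M.len U ≤ t ∧ PfaffianBody n X Y P Q S U := by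
  have n_denotes (s : ℕ → M.Str) : TermDenotes Set.univ s ⟨1, fun _ => n⟩ (.var 0) n :=
    .var_of_lt Nat.zero_lt_one
  obtain ⟨P, hP, mem_P⟩ := comprehension
    (BitsDenotes.transferBits (Set.mem_univ 0) (n_denotes fun _ => X)).isSigmaB0Rel
    (transferBound n (M.len X))
  obtain ⟨Q, hQ, S, hS, U, hU, hrun⟩ := exists_isPowRun hM (numStates n) (n + 1) P
  obtain ⟨Y, hY, mem_Y⟩ := comprehension
    (BitsDenotes.pfaffianBits (Set.mem_univ 0) (Set.mem_univ 1)
      (n_denotes (consSeq X fun _ => Q))).isSigmaB0Rel (M.len Q)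
  have bound := powBound_mono (n := numStates n) (k := n + 1) hP
  exact ⟨Y, P, hP, Q, hQ.trans bound, S, hS.trans bound, U, hU.trans bound,
    fun w hw => (mem_P w).trans (and_iff_right hw), hrun, hY,
    fun z hz => (mem_Y z).trans (and_iff_right hz)⟩

theorem eq_of_sat_pfaffianFormula {v : ℕ → M.Num} {s s' : ℕ → M.Str} (hs : s 0 = s' 0)
    (h : pfaffianFormula.Sat M v s) (h' : pfaffianFormula.Sat M v s') : s 1 = s' 1 := by
  rw [sat_pfaffianFormula] at h h'
  rw [← hs] at h'
  obtain ⟨P, hP, Q, -, S, -, U, -, hbody⟩ := h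
  obtain ⟨P', hP', Q', -, S', -, U', -, hbody'⟩ := h'
  exact PfaffianBody.unique hP hP' hbody hbody'

end ValueInModels

theorem proves_existsUnique_pfaffianFormula :
    Proves VSharpL (.exS 2 (.allS 1 (pfaffianFormula.iff (.eqS 1 2)))) := by
  intro M hM v s
  have : IsV0 M := ⟨fun φ h => hM φ (.inl (.inl h)), fun φ h => hM φ (.inl (.inr h))⟩
  obtain ⟨Y, hY⟩ := exists_pfaffianBody (hM powAxiom (.inr (.inr rfl))) (v 0) (s 0)
  let t (Y' : M.Str) : ℕ → M.Str := Function.update (Function.update s 2 Y) 1 Y'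
  have sat_value : pfaffianFormula.Sat M v (t Y) := by
    rw [sat_pfaffianFormula]
    exact hY
  have eq_value {Y' : M.Str} (h : pfaffianFormula.Sat M v (t Y')) : Y' = Y :=
    eq_of_sat_pfaffianFormula (s := t Y') (s' := t Y) rfl h sat_value
  refine ⟨Y, fun Y' => ?_⟩
  suffices pfaffianFormula.Sat M v (t Y') ↔ Y' = Y by
    simp only [Formula.iff, Formula.imp, Formula.Sat, ← imp_iff_not_or]
    exact ⟨fun h => this.1 h, fun h => this.2 h⟩
  exact ⟨eq_value, by rintro rfl; exact sat_value⟩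

/-! ### The standard model -/

theorem NTerm.eval_congr_str {M : Struct} (v : ℕ → M.Num) {s s' : ℕ → M.Str} {t : NTerm}
    (h : Set.EqOn s s' t.strVars) : t.eval M v s = t.eval M v s' := by
  induction t with
  | var x => rfl
  | zero => rfl
  | one => rfl
  | add t u iht ihu =>
    exact congrArg₂ M.add (iht fun k hk => h (.inl hk)) (ihu fun k hk => h (.inr hk))
  | mul t u iht ihu =>
    exact congrArg₂ M.mul (iht fun k hk => h (.inl hk)) (ihu fun k hk => h (.inr hk))
  | len X => exact congrArg M.len (h rfl)

theorem Formula.sat_congr_str {M : Struct} {φ : Formula} (v : ℕ → M.Num) {s s' : ℕ → M.Str}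
    (h : Set.EqOn s s' φ.freeStr) : φ.Sat M v s ↔ φ.Sat M v s' := by
  have eqOn_update {X : ℕ} {φ : Formula} {s s' : ℕ → M.Str} (h : Set.EqOn s s' (φ.freeStr \ {X}))
      (A : M.Str) : Set.EqOn (Function.update s X A) (Function.update s' X A) φ.freeStr := by
    intro k hk
    by_cases hX : k = X
    · rw [hX, Function.update_self, Function.update_self]
    · rw [Function.update_of_ne hX, Function.update_of_ne hX, h ⟨hk, hX⟩]
  induction φ generalizing v s s' with
  | eqN t u =>
    rw [Sat, Sat, NTerm.eval_congr_str v fun k hk => h (.inl hk),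
      NTerm.eval_congr_str v fun k hk => h (.inr hk)]
  | eqS X Y => rw [Sat, Sat, h (.inl rfl), h (.inr rfl)]
  | le t u =>
    rw [Sat, Sat, NTerm.eval_congr_str v fun k hk => h (.inl hk),
      NTerm.eval_congr_str v fun k hk => h (.inr hk)]
  | mem t X => rw [Sat, Sat, NTerm.eval_congr_str v fun k hk => h (.inl hk), h (.inr rfl)]
  | neg φ ih => exact not_congr (ih v h)
  | and φ ψ ih₁ ih₂ =>
    exact and_congr (ih₁ v fun k hk => h (.inl hk)) (ih₂ v fun k hk => h (.inr hk))
  | or φ ψ ih₁ ih₂ =>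
    exact or_congr (ih₁ v fun k hk => h (.inl hk)) (ih₂ v fun k hk => h (.inr hk))
  | allN x φ ih => exact forall_congr' fun a => ih _ h
  | exN x φ ih => exact exists_congr fun a => ih _ h
  | allS X φ ih => exact forall_congr' fun A => ih v (eqOn_update h A)
  | exS X φ ih => exact exists_congr fun A => ih v (eqOn_update h A)

section Strings

variable {X Y : Finset ℕ} {x : ℕ}

theorem lt_sup_succ_of_mem (h : x ∈ X) : x < X.sup Nat.succ :=
  Nat.lt_of_succ_le (Finset.le_sup (f := Nat.succ) h)

theorem mem_of_add_one_eq_sup_succ (h : x + 1 = X.sup Nat.succ) : x ∈ X := by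
  have nonempty : X.Nonempty := by
    rw [Finset.nonempty_iff_ne_empty]
    rintro rfl
    exact Nat.succ_ne_zero x h
  obtain ⟨y, hy, hsup⟩ := Finset.exists_mem_eq_sup X nonempty Nat.succ
  rwa [Nat.succ.inj (h.trans hsup)]

theorem eq_of_sup_succ_eq (hlen : X.sup Nat.succ = Y.sup Nat.succ)
    (hmem : ∀ x < X.sup Nat.succ, (x ∈ X ↔ x ∈ Y)) : X = Y := by
  ext x
  by_cases hx : x < X.sup Nat.succ
  · exact hmem x hx
  · exact iff_of_false (fun h => hx (lt_sup_succ_of_mem h))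
      fun h => hx (hlen ▸ lt_sup_succ_of_mem h)

end Strings

theorem stdModel_models_basic2 {φ : Formula} (hφ : Basic2 φ) : stdModel.Models φ := by
  intro v s
  cases hφ <;> simp only [Formula.imp, Formula.iff, Formula.lt, Formula.bexN, Formula.ballN,
    Formula.Sat, ← imp_iff_not_or]
  case B1 => exact Nat.succ_ne_zero _
  case B2 => exact Nat.succ.inj
  case B3 => exact Nat.add_zero _
  case B4 => exact (Nat.add_assoc _ _ _).symm
  case B5 => exact Nat.mul_zero _
  case B6 => exact Nat.mul_succ _ _
  case B7 => exact fun h => le_antisymm h.1 h.2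
  case B8 => exact Nat.le_add_right _ _
  case B9 => exact Nat.zero_le _
  case B10 => exact Nat.le_total _ _
  case B11 =>
    have le_iff : v 0 ≤ v 1 ↔ v 0 ≤ v 1 + 1 ∧ ¬ v 0 = v 1 + 1 :=
      Nat.lt_succ_iff.symm.trans lt_iff_le_and_ne
    exact ⟨le_iff.1, le_iff.2⟩
  case B12 =>
    intro h
    obtain ⟨m, hm⟩ := Nat.exists_eq_succ_of_ne_zero h
    exact ⟨m, (Nat.le_succ m).trans hm.ge, hm.symm⟩
  case L1 =>
    intro h
    exact lt_iff_le_and_ne.1 (lt_sup_succ_of_mem h)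
  case L2 => exact fun h => mem_of_add_one_eq_sup_succ h
  case SE =>
    rintro ⟨hlen, hmem⟩
    refine eq_of_sup_succ_eq hlen fun x hx => ?_
    have same := hmem x hx.le ⟨hx.le, hx.ne⟩
    exact ⟨same.1, same.2⟩

theorem stdModel_models_sigmaB0Comp {φ : Formula} (hφ : SigmaB0Comp φ) : stdModel.Models φ := by
  classical
  intro v s
  obtain ⟨φ, X, y, z, -, hX, hyz⟩ := hφ
  let A : Finset ℕ :=
    (Finset.range (v y)).filter fun a => φ.Sat stdModel (Function.update v z a) s
  simp only [Formula.bexS, Formula.ballN, Formula.imp, Formula.iff, Formula.lt, Formula.Sat,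
    NTerm.eval, Function.update_self, Function.update_of_ne hyz, ← imp_iff_not_or]
  refine ⟨A, Finset.sup_le fun a ha => Finset.mem_range.1 (Finset.mem_filter.1 ha).1,
    fun a _ ha => ?_⟩
  have mem_A : a ∈ A ↔ φ.Sat stdModel (Function.update v z a) s := by
    rw [Finset.mem_filter, Finset.mem_range, and_iff_right (lt_of_le_of_ne ha.1 ha.2)]
  have sat_update := Formula.sat_congr_str (φ := φ) (M := stdModel) (Function.update v z a)
    (s := Function.update s X A) (s' := s)
    fun k hk => Function.update_of_ne (fun h : k = X => hX (h ▸ hk)) _ _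
  exact ⟨fun h => sat_update.2 (mem_A.1 h), fun h => mem_A.2 (sat_update.1 h)⟩

instance : IsV0 stdModel where
  basic _ := stdModel_models_basic2
  comp _ := stdModel_models_sigmaB0Comp

section BinaryDigits

theorem carry_testBit_iff {w y : ℕ} (m n : ℕ) (hy : y ≤ w) :
    BitVec.carry y (BitVec.ofNat w m) (BitVec.ofNat w n) false = true ↔
      Carry (fun y => m.testBit y) (fun y => n.testBit y) y := by
  induction y with
  | zero => simp [Carry]
  | succ y ih =>
    have getLsbD_ofNat (m : ℕ) : (BitVec.ofNat w m).getLsbD y = m.testBit y := by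
      rw [BitVec.getLsbD_ofNat, decide_eq_true (Nat.lt_of_succ_le hy), Bool.true_and]
    rw [BitVec.carry_succ, getLsbD_ofNat, getLsbD_ofNat,
      carry_add_one fun _ _ => Nat.lt_succ_iff, ← ih (Nat.le_of_succ_le hy)]
    cases m.testBit y <;> cases n.testBit y <;> simp [Bool.atLeastTwo]

theorem testBit_add_iff (m n x : ℕ) :
    (m + n).testBit x ↔ ¬ (¬ (m.testBit x ↔ n.testBit x) ↔
      Carry (fun y => m.testBit y) (fun y => n.testBit y) x) := by
  have getLsbD_ofNat (m : ℕ) : (BitVec.ofNat (x + 1) m).getLsbD x = m.testBit x := by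
    rw [BitVec.getLsbD_ofNat, decide_eq_true (Nat.lt_succ_self x), Bool.true_and]
  have digit := BitVec.getLsbD_add (Nat.lt_succ_self x) (BitVec.ofNat (x + 1) m)
    (BitVec.ofNat (x + 1) n)
  rw [← BitVec.ofNat_add, getLsbD_ofNat, getLsbD_ofNat, getLsbD_ofNat] at digit
  rw [digit, ← carry_testBit_iff m n (Nat.le_succ x)]
  cases m.testBit x <;> cases n.testBit x <;> simp

theorem isSum_testBit {b m n k : ℕ} (h : m + n = k) :
    IsSum b (fun x => m.testBit x) (fun x => n.testBit x) (fun x => k.testBit x) :=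
  fun x _ => h ▸ testBit_add_iff m n x

theorem shift_testBit (m i : ℕ) :
    Shift (fun y => m.testBit y) i = fun x => ((m * 2 ^ i).testBit x : Prop) := by
  ext x
  rw [Shift, Nat.testBit_mul_two_pow, Bool.and_eq_true, decide_eq_true_eq]
  constructor
  · rintro ⟨y, -, rfl, h⟩
    exact ⟨Nat.le_add_left i y, by rwa [Nat.add_sub_cancel]⟩
  · rintro ⟨hi, h⟩
    exact ⟨x - i, Nat.sub_le x i, Nat.sub_add_cancel hi, h⟩

theorem isMulRun_testBit {b l m n : ℕ} {W : ℕ → ℕ → Prop}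
    (hW : ∀ i ≤ l, W i = fun x => ((m * (n % 2 ^ i)).testBit x : Prop)) :
    IsMulRun b l (fun x => m.testBit x) (fun x => n.testBit x) W := by
  have next_digit (i : ℕ) : n % 2 ^ (i + 1) = n % 2 ^ i + 2 ^ i * (n.testBit i).toNat := by
    rw [Nat.mod_pow_succ, Nat.toNat_testBit]
  refine ⟨fun x _ => ?_, fun i hi => ⟨fun h => ?_, fun h x _ => ?_⟩⟩
  · simp [hW 0 (Nat.zero_le l), Nat.mod_one]
  · rw [hW i hi.le, hW (i + 1) hi, shift_testBit]
    refine isSum_testBit ?_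
    rw [next_digit, h, Bool.toNat_true, mul_one, mul_add]
  · rw [hW i hi.le, hW (i + 1) hi, next_digit, Bool.eq_false_of_not_eq_true h, Bool.toNat_false,
      mul_zero, add_zero]

theorem le_of_testBit_of_lt {m x b : ℕ} (hm : m < 2 ^ b) (hx : m.testBit x) : x < b :=
  lt_of_not_ge fun hb => by
    simp [Nat.testBit_eq_false_of_lt (hm.trans_le (Nat.pow_le_pow_right two_pos hb))] at hx

theorem isZero_testBit_iff {m b : ℕ} (hm : m < 2 ^ b) :
    IsZero b (fun x => m.testBit x) ↔ m = 0 := by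
  rw [isZero_iff fun _ => le_of_testBit_of_lt hm]
  refine ⟨fun h => Nat.eq_of_testBit_eq fun x => ?_, fun h x => by simp [h]⟩
  rw [Nat.zero_testBit]
  exact Bool.eq_false_of_not_eq_true (h x)

theorem sameBits_testBit_iff {m n b : ℕ} (hm : m < 2 ^ b) (hn : n < 2 ^ b) :
    SameBits b (fun x => m.testBit x) (fun x => n.testBit x) ↔ m = n := by
  rw [sameBits_iff (fun _ => le_of_testBit_of_lt hm) fun _ => le_of_testBit_of_lt hn]
  refine ⟨fun h => Nat.eq_of_testBit_eq fun x => Bool.eq_iff_iff.2 (iff_of_eq (congrFun h x)), ?_⟩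
  rintro rfl
  rfl

end BinaryDigits

/-- The sign and the digits `a` stand for the integer `z`. The sign of `0` is arbitrary, as it is
for the products and the matrix entries in a run of matrix powering. -/
structure SignedBits.Represents (a : SignedBits ℕ) (z : ℤ) : Prop where
  abs_eq : a.abs = fun x => (z.natAbs.testBit x : Prop)
  neg_of_neg : z < 0 → a.neg
  not_neg_of_pos : 0 < z → ¬ a.neg

section Integers

theorem mem_encodeInt_zero (z : ℤ) : 0 ∈ encodeInt z ↔ z < 0 := by
  by_cases h : z < 0 <;> simp [encodeInt, h]

theorem mem_encodeInt_succ (z : ℤ) (x : ℕ) : x + 1 ∈ encodeInt z ↔ z.natAbs.testBit x := by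
  by_cases h : z < 0 <;> simp [encodeInt, h]

theorem le_of_mem_encodeInt {z : ℤ} {x b : ℕ} (hz : z.natAbs < 2 ^ b) (hx : x ∈ encodeInt z) :
    x ≤ b := by
  rcases x with - | x
  · exact Nat.zero_le b
  · exact le_of_testBit_of_lt hz ((mem_encodeInt_succ z x).1 hx)

theorem natAbs_decodeInt (D : Finset ℕ) : (decodeInt D).natAbs = ∑ x ∈ D.erase 0, 2 ^ (x - 1) := by
  have cast_sum : ∑ x ∈ D.erase 0, (2 : ℤ) ^ (x - 1) = (∑ x ∈ D.erase 0, 2 ^ (x - 1) : ℕ) := by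
    push_cast
    rfl
  rw [decodeInt, cast_sum, Int.natAbs_mul, Int.natAbs_natCast]
  split_ifs <;> simp

theorem testBit_natAbs_decodeInt (D : Finset ℕ) (x : ℕ) :
    (decodeInt D).natAbs.testBit x ↔ x + 1 ∈ D := by
  have injOn_pred : Set.InjOn Nat.pred (D.erase 0) := fun a ha b hb h =>
    Nat.pred_inj (Nat.pos_of_ne_zero (Finset.ne_of_mem_erase ha))
      (Nat.pos_of_ne_zero (Finset.ne_of_mem_erase hb)) h
  have sum_eq : ∑ x ∈ D.erase 0, 2 ^ (x - 1) = ∑ i ∈ (D.erase 0).image Nat.pred, 2 ^ i :=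
    (Finset.sum_image injOn_pred).symm
  rw [natAbs_decodeInt, sum_eq, ← Nat.mem_bitIndices, ← List.mem_toFinset,
    Finset.toFinset_bitIndices_sum_two_pow]
  simp only [Finset.mem_image, Finset.mem_erase]
  constructor
  · rintro ⟨y, ⟨hy, hyD⟩, rfl⟩
    rwa [← Nat.succ_pred_eq_of_ne_zero hy] at hyD
  · exact fun h => ⟨x + 1, ⟨Nat.succ_ne_zero x, h⟩, rfl⟩

theorem represents_decodeInt (D : Finset ℕ) : (signedBits (· ∈ D)).Represents (decodeInt D) := by
  have sum_nonneg : (0 : ℤ) ≤ ∑ x ∈ D.erase 0, 2 ^ (x - 1) :=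
    Finset.sum_nonneg fun _ _ => by positivity
  refine ⟨funext fun x => propext (testBit_natAbs_decodeInt D x).symm, fun h => ?_, fun h h0 => ?_⟩
  · by_contra h0
    replace h0 : 0 ∉ D := h0
    rw [decodeInt, if_neg h0] at h
    linarith
  · replace h0 : 0 ∈ D := h0
    rw [decodeInt, if_pos h0] at h
    linarith

theorem signedBits_encodeInt (z : ℤ) :
    signedBits (· ∈ encodeInt z) = ⟨z < 0, fun x => z.natAbs.testBit x⟩ :=
  congrArg₂ SignedBits.mk (propext (mem_encodeInt_zero z))
    (funext fun x => propext (mem_encodeInt_succ z x))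

theorem represents_encodeInt (z : ℤ) : (signedBits (· ∈ encodeInt z)).Represents z := by
  rw [signedBits_encodeInt]
  exact ⟨rfl, id, fun hz => hz.not_gt⟩

namespace SignedBits.Represents

variable {a c : SignedBits ℕ} {y z : ℤ}

theorem mul (ha : a.Represents y) (hc : c.Represents z) :
    Represents ⟨¬ (a.neg ↔ c.neg), fun x => (y.natAbs * z.natAbs).testBit x⟩ (y * z) := by
  refine ⟨by rw [Int.natAbs_mul], fun h => ?_, fun h => ?_⟩
  · rcases mul_neg_iff.1 h with ⟨hy, hz⟩ | ⟨hy, hz⟩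
    · simp [ha.not_neg_of_pos hy, hc.neg_of_neg hz]
    · simp [ha.neg_of_neg hy, hc.not_neg_of_pos hz]
  · rcases mul_pos_iff.1 h with ⟨hy, hz⟩ | ⟨hy, hz⟩
    · simp [ha.not_neg_of_pos hy, hc.not_neg_of_pos hz]
    · simp [ha.neg_of_neg hy, hc.neg_of_neg hz]

theorem isIntSum {b : ℕ} (ha : a.Represents y) (hc : c.Represents z)
    (hb : (y + z).natAbs < 2 ^ b) :
    IsIntSum b a c (signedBits (· ∈ encodeInt (y + z))) := by
  obtain ⟨σ, A⟩ := a
  obtain ⟨τ, C⟩ := c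
  obtain ⟨hA, hσ, hσ'⟩ := ha
  obtain ⟨hC, hτ, hτ'⟩ := hc
  dsimp only at hA hσ hσ' hC hτ hτ'
  subst hA hC
  simp only [signedBits_encodeInt, IsIntSum, isZero_testBit_iff hb, Int.natAbs_eq_zero]
  have abs_or : z.natAbs ≤ y.natAbs ∨ y.natAbs ≤ z.natAbs := le_total _ _
  by_cases hσt : σ <;> by_cases hτt : τ
  · have hy : y ≤ 0 := not_lt.1 fun h => hσ' h hσt
    have hz : z ≤ 0 := not_lt.1 fun h => hτ' h hτt
    exact .inl ⟨iff_of_true hσt hτt, isSum_testBit (by omega), by simp only [hσt, true_and]; omega⟩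
  · have hy : y ≤ 0 := not_lt.1 fun h => hσ' h hσt
    have hz : 0 ≤ z := not_lt.1 fun h => hτt (hτ h)
    exact .inr ⟨fun h => hτt (h.1 hσt), abs_or.imp
      (fun h => ⟨isSum_testBit (by omega), by simp only [hσt, true_and]; omega⟩)
      fun h => ⟨isSum_testBit (by omega), by simp only [hτt, false_and, iff_false]; omega⟩⟩
  · have hy : 0 ≤ y := not_lt.1 fun h => hσt (hσ h)
    have hz : z ≤ 0 := not_lt.1 fun h => hτ' h hτt
    exact .inr ⟨fun h => hσt (h.2 hτt), abs_or.imp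
      (fun h => ⟨isSum_testBit (by omega), by simp only [hσt, false_and, iff_false]; omega⟩)
      fun h => ⟨isSum_testBit (by omega), by simp only [hτt, true_and]; omega⟩⟩
  · have hy : 0 ≤ y := not_lt.1 fun h => hσt (hσ h)
    have hz : 0 ≤ z := not_lt.1 fun h => hτt (hτ h)
    exact .inl ⟨iff_of_false hσt hτt, isSum_testBit (by omega), by
      simp only [hσt, false_and, iff_false]; omega⟩

theorem eq_neg_iff {b : ℕ} (ha : a.Represents y) (hc : c.Represents z) (hy : y.natAbs < 2 ^ b)
    (hz : z.natAbs < 2 ^ b) :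
    SameBits b a.abs c.abs ∧ (IsZero b a.abs ∨ ¬ (a.neg ↔ c.neg)) ↔ z = -y := by
  rw [ha.abs_eq, hc.abs_eq, sameBits_testBit_iff hy hz, isZero_testBit_iff hy]
  constructor
  · rintro ⟨abs_eq, hy0 | sign_ne⟩
    · omega
    rcases Int.natAbs_eq_natAbs_iff.1 abs_eq with rfl | rfl
    · rcases lt_trichotomy y 0 with hneg | rfl | hpos
      · exact absurd (iff_of_true (ha.neg_of_neg hneg) (hc.neg_of_neg hneg)) sign_ne
      · rfl
      · exact absurd (iff_of_false (ha.not_neg_of_pos hpos) (hc.not_neg_of_pos hpos)) sign_ne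
    · exact (neg_neg z).symm
  · rintro rfl
    refine ⟨(Int.natAbs_neg y).symm, ?_⟩
    rcases lt_trichotomy y 0 with hneg | rfl | hpos
    · exact .inr fun h => hc.not_neg_of_pos (neg_pos.2 hneg) (h.1 (ha.neg_of_neg hneg))
    · exact .inl Int.natAbs_zero
    · exact .inr fun h => ha.not_neg_of_pos hpos (h.2 (hc.neg_of_neg (neg_lt_zero.2 hpos)))

end SignedBits.Represents

end Integers

/-! ### Powers of integer matrices in the standard model -/

/-- The entry of the integer matrix coded by `X`. The indices are not restricted by a dimension. -/
def entry (X : Finset ℕ) (i j : ℕ) : ℤ :=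
  decodeInt ((Finset.range (X.sup Nat.succ)).filter fun x => natPair i (natPair j x) ∈ X)

/-- The entries of the powers of the integer matrix `(e a c)` with indices `a, c < n`, defined by
the recursion that a run of matrix powering follows. -/
def intPow (n : ℕ) (e : ℕ → ℕ → ℤ) : ℕ → ℕ → ℕ → ℤ
  | 0, a, c => if a = c then 1 else 0
  | i + 1, a, c => ∑ l ∈ Finset.range n, intPow n e i a l * e l c

section Pairing

variable {x y x' y' : ℕ}

theorem natPair_right_le (x y : ℕ) : y ≤ natPair x y := le_pairNum_right (M := stdModel) x y

theorem natPair_mono (hx : x ≤ x') (hy : y ≤ y') : natPair x y ≤ natPair x' y' :=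
  pairNum_mono (M := stdModel) hx hy

theorem natPair_inj : natPair x y = natPair x' y' ↔ x = x' ∧ y = y' := by
  refine ⟨fun h => ?_, by rintro ⟨rfl, rfl⟩; rfl⟩
  have sum_le {x y x' y' : ℕ} (h : natPair x y = natPair x' y') : x' + y' ≤ x + y := by
    unfold natPair at h
    by_contra! hlt
    nlinarith
  have sum_eq : x + y = x' + y' := le_antisymm (sum_le h.symm) (sum_le h)
  rw [natPair, natPair, sum_eq] at h
  omega

end Pairing

theorem isBelow_mem (X : Finset ℕ) : IsBelow (R := ℕ) (· ∈ X) (X.sup Nat.succ) :=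
  fun _ => lt_sup_succ_of_mem

theorem isBelow_row {A : ℕ → Prop} {b : ℕ} (hA : IsBelow A b) (i : ℕ) : IsBelow (row A i) b :=
  fun x hx => (natPair_right_le i x).trans_lt (hA _ hx)

theorem isBelow_entry (X : Finset ℕ) (i j : ℕ) :
    IsBelow (row (row (· ∈ X) i) j) (X.sup Nat.succ) :=
  isBelow_row (isBelow_row (isBelow_mem X) i) j

theorem entry_eq_decodeInt {X D : Finset ℕ} {i j : ℕ}
    (h : ∀ x, row (row (· ∈ X) i) j x ↔ x ∈ D) : entry X i j = decodeInt D := by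
  rw [entry]
  congr 1
  ext x
  rw [← h, Finset.mem_filter, Finset.mem_range]
  exact and_iff_right_of_imp (isBelow_entry X i j x)

theorem represents_entry (X : Finset ℕ) (i j : ℕ) :
    (signedBits (row (row (· ∈ X) i) j)).Represents (entry X i j) := by
  classical
  let D := (Finset.range (X.sup Nat.succ)).filter (row (row (· ∈ X) i) j)
  have mem_D (x : ℕ) : row (row (· ∈ X) i) j x ↔ x ∈ D := by
    rw [Finset.mem_filter, Finset.mem_range]
    exact (and_iff_right_of_imp (isBelow_entry X i j x)).symm
  rw [entry_eq_decodeInt mem_D, funext fun x => propext (mem_D x)]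
  exact represents_decodeInt D

theorem SignedBits.Represents.natAbs_lt {A : ℕ → Prop} {z : ℤ} {b : ℕ}
    (h : (signedBits A).Represents z) (hA : IsBelow A b) : z.natAbs < 2 ^ b := by
  refine Nat.lt_pow_two_of_testBit _ fun x hx => Bool.eq_false_of_not_eq_true fun hbit => ?_
  have hAx : A (x + 1) := (iff_of_eq (congrFun h.abs_eq x)).2 hbit
  exact absurd (hA _ hAx) (not_lt.2 (hx.trans (Nat.le_succ x)))

theorem natAbs_entry_lt (X : Finset ℕ) (i j : ℕ) : (entry X i j).natAbs < 2 ^ X.sup Nat.succ :=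
  (represents_entry X i j).natAbs_lt (isBelow_entry X i j)

section Size

theorem natAbs_sum_mul_le {f g : ℕ → ℤ} {l n p q : ℕ} (hl : l ≤ n)
    (hf : ∀ i, (f i).natAbs ≤ 2 ^ p) (hg : ∀ i, (g i).natAbs ≤ 2 ^ q) :
    (∑ i ∈ Finset.range l, f i * g i).natAbs ≤ 2 ^ (p + (n + q)) :=
  calc (∑ i ∈ Finset.range l, f i * g i).natAbs
    _ ≤ ∑ i ∈ Finset.range l, (f i * g i).natAbs := Int.natAbs_sum_le _ _
    _ ≤ (Finset.range l).card • (2 ^ p * 2 ^ q) := by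
      refine Finset.sum_le_card_nsmul _ _ _ fun i _ => ?_
      rw [Int.natAbs_mul]
      exact Nat.mul_le_mul (hf i) (hg i)
    _ = l * (2 ^ p * 2 ^ q) := by rw [Finset.card_range, smul_eq_mul]
    _ ≤ 2 ^ n * (2 ^ p * 2 ^ q) := Nat.mul_le_mul_right _ (hl.trans Nat.lt_two_pow_self.le)
    _ = 2 ^ (p + (n + q)) := by ring

theorem natAbs_intPow_le {n q : ℕ} {e : ℕ → ℕ → ℤ} (he : ∀ i j, (e i j).natAbs ≤ 2 ^ q)
    (i a c : ℕ) : (intPow n e i a c).natAbs ≤ 2 ^ ((n + q) * i) := by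
  induction i generalizing c with
  | zero =>
    rw [intPow]
    split_ifs <;> simp
  | succ i ih => exact natAbs_sum_mul_le le_rfl ih fun l => he l c

end Size

/-- `S` and `U` record the computation of the inner product `∑ l < n, f l * g l`: the rows of `S`
code the partial sums, and the row `i` of the row `l` of `U` is the product of `|f l|` with the
number formed by the first `i` digits of `|g l|`. -/
structure IsDotRun (m n : ℕ) (f g : ℕ → ℤ) (S U : ℕ → Prop) : Prop where
  sums : ∀ l ≤ n, row S l = (· ∈ encodeInt (∑ j ∈ Finset.range l, f j * g j))
  products : ∀ l < n, ∀ i ≤ m,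
    row (row U l) i = fun z => (((f l).natAbs * ((g l).natAbs % 2 ^ i)).testBit z : Prop)

theorem IsDotRun.isInnerProduct {b m n : ℕ} {f g : ℕ → ℤ} {P Q : ℕ → ℕ → Prop} {S U E : ℕ → Prop}
    (h : IsDotRun m n f g S U) (hP : ∀ l < n, (signedBits (P l)).Represents (f l))
    (hQ : ∀ l < n, (signedBits (Q l)).Represents (g l)) (hm : ∀ l < n, (g l).natAbs < 2 ^ m)
    (hE : E = (· ∈ encodeInt (∑ l ∈ Finset.range n, f l * g l))) (hb : IsBelow S b) :
    IsInnerProduct b m n P Q S U E := by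
  have sum_lt (l : ℕ) (hl : l ≤ n) : (∑ j ∈ Finset.range l, f j * g j).natAbs < 2 ^ b :=
    (represents_encodeInt _).natAbs_lt (h.sums l hl ▸ isBelow_row hb l)
  refine ⟨?_, fun l hl => ⟨?_, ?_⟩, ?_⟩
  · rw [h.sums 0 (Nat.zero_le n)]
    simp [IsZero, encodeInt]
  · rw [(hP l hl).abs_eq, (hQ l hl).abs_eq]
    exact isMulRun_testBit (h.products l hl)
  · have sum_succ := Finset.sum_range_succ (fun j => f j * g j) l
    rw [h.sums l hl.le, h.sums (l + 1) hl, h.products l hl m le_rfl, Nat.mod_eq_of_lt (hm l hl),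
      sum_succ]
    exact (represents_encodeInt _).isIntSum ((hP l hl).mul (hQ l hl)) (sum_succ ▸ sum_lt _ hl)
  · rw [h.sums n le_rfl, hE]
    exact fun _ _ => Iff.rfl

theorem isPowSeq_of_isDotRun {b n k : ℕ} {X : Finset ℕ} {Y S U : ℕ → Prop}
    (hY : ∀ i ≤ k, ∀ a < n, ∀ c < n,
      row (row (row Y i) a) c = (· ∈ encodeInt (intPow n (entry X) i a c)))
    (hSU : ∀ i < k, ∀ a < n, ∀ c < n,
      IsDotRun (X.sup Nat.succ) n (intPow n (entry X) i a) (entry X · c)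
        (row (row (row S i) a) c) (row (row (row U i) a) c))
    (hb : IsBelow S b) : IsPowSeq b (X.sup Nat.succ) n k (· ∈ X) Y S U := by
  refine ⟨fun a ha c hc z _ => ?_, fun i hi a ha c hc => (hSU i hi a ha c hc).isInnerProduct
    (fun l hl => ?_) (fun l _ => represents_entry X l c) (fun l _ => natAbs_entry_lt X l c)
    (hY (i + 1) hi a ha c hc) (isBelow_row (isBelow_row (isBelow_row hb i) a) c)⟩
  · rw [hY 0 (Nat.zero_le k) a ha c hc, intPow]
    by_cases hac : a = c
    · change z ∈ encodeInt _ ↔ _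
      rcases z with - | z
      · simp [hac, mem_encodeInt_zero]
      · rw [mem_encodeInt_succ, if_pos hac, Int.natAbs_one,
          Nat.testBit_one_eq_true_iff_self_eq_zero]
        simp [hac]
    · simp [hac, encodeInt]
  · rw [hY i hi.le a ha l hl]
    exact represents_encodeInt _

theorem isPowRun_of_isDotRun {n k : ℕ} {X Y S U : Finset ℕ}
    (hY : ∀ i ≤ k, ∀ a < n, ∀ c < n,
      row (row (row (· ∈ Y) i) a) c = (· ∈ encodeInt (intPow n (entry X) i a c)))
    (hSU : ∀ i < k, ∀ a < n, ∀ c < n,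
      IsDotRun (X.sup Nat.succ) n (intPow n (entry X) i a) (entry X · c)
        (row (row (row (· ∈ S) i) a) c) (row (row (row (· ∈ U) i) a) c)) :
    IsPowRun (M := stdModel) n k X Y S U := by
  have hb : IsBelow (· ∈ S)
      (X.sup Nat.succ + Y.sup Nat.succ + S.sup Nat.succ + U.sup Nat.succ) := fun z hz =>
    (lt_sup_succ_of_mem hz).trans_le ((Nat.le_add_left _ _).trans (Nat.le_add_right _ _))
  exact isPowSeq_of_isDotRun hY hSU hb

section Arrays

variable {d T : ℕ} {F : List ℕ → ℕ → Prop}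

open Classical in
/-- The string of all codes `⟨i₁, ⟨i₂, … ⟨i_d, z⟩⟩⟩` below `T` such that `F [i₁, …, i_d] z`. -/
noncomputable def arrayString (d T : ℕ) (F : List ℕ → ℕ → Prop) : Finset ℕ :=
  (Finset.range T).filter fun w => ∃ is z, is.length = d ∧ w = is.foldr natPair z ∧ F is z

theorem mem_arrayString {w : ℕ} : w ∈ arrayString d T F ↔
    w < T ∧ ∃ is z, is.length = d ∧ w = is.foldr natPair z ∧ F is z := by
  classical
  rw [arrayString, Finset.mem_filter, Finset.mem_range]

theorem sup_arrayString_le : (arrayString d T F).sup Nat.succ ≤ T :=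
  Finset.sup_le fun _ hw => Nat.succ_le_of_lt (mem_arrayString.1 hw).1

theorem foldr_natPair_injective {is js : List ℕ} {y z : ℕ} (hlen : is.length = js.length)
    (h : is.foldr natPair y = js.foldr natPair z) : is = js ∧ y = z := by
  induction is generalizing js with
  | nil =>
    obtain rfl := List.length_eq_zero_iff.1 hlen.symm
    exact ⟨rfl, h⟩
  | cons i is ih =>
    obtain ⟨j, js, rfl⟩ := List.exists_cons_of_length_eq_add_one hlen.symm
    obtain ⟨rfl, tails⟩ := natPair_inj.1 h
    obtain ⟨rfl, rfl⟩ := ih (Nat.succ.inj hlen) tails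
    exact ⟨rfl, rfl⟩

theorem foldr_natPair_le {is : List ℕ} {m z B : ℕ} (hlen : is.length ≤ m)
    (his : ∀ i ∈ is, i ≤ B) (hz : z ≤ B) :
    is.foldr natPair z ≤ (List.replicate m B).foldr natPair B := by
  induction m generalizing is with
  | zero =>
    obtain rfl := List.length_eq_zero_iff.1 (Nat.le_zero.1 hlen)
    exact hz
  | succ m ih =>
    cases is with
    | nil => exact (ih (is := []) (Nat.zero_le m) his).trans (natPair_right_le _ _)
    | cons i is =>
      exact natPair_mono (his i List.mem_cons_self)
        (ih (Nat.le_of_succ_le_succ hlen) fun j hj => his j (List.mem_cons_of_mem i hj))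

theorem mem_arrayString_powBound {n k l z : ℕ} {is : List ℕ} (hlen : is.length = d) (hd : d ≤ 5)
    (his : ∀ i ∈ is, i ≤ (k + 1) * (n + l + 1)) (hF : F is z → z ≤ (k + 1) * (n + l + 1)) :
    is.foldr natPair z ∈ arrayString d (powBound n k l) F ↔ F is z := by
  rw [mem_arrayString]
  constructor
  · rintro ⟨-, js, y, hjs, hcode, h⟩
    obtain ⟨rfl, rfl⟩ := foldr_natPair_injective (hlen.trans hjs.symm) hcode
    exact h
  · refine fun h => ⟨Nat.lt_succ_of_le ?_, is, z, hlen, rfl, h⟩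
    exact foldr_natPair_le (hlen.trans_le hd) his (hF h)

end Arrays

section Run

/-- The string that codes the powers `X⁰, …, Xᵏ` of the `n × n` matrix coded by `X`. -/
noncomputable def powerString (n k : ℕ) (X : Finset ℕ) : Finset ℕ :=
  arrayString 3 (powBound n k (X.sup Nat.succ)) fun
    | [i, a, c], z => z ∈ encodeInt (intPow n (entry X) i a c)
    | _, _ => False

/-- The string that codes the partial sums in the computation of `powerString n k X`. -/
noncomputable def partialSumString (n k : ℕ) (X : Finset ℕ) : Finset ℕ :=
  arrayString 4 (powBound n k (X.sup Nat.succ)) fun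
    | [i, a, c, l], z =>
      z ∈ encodeInt (∑ j ∈ Finset.range l, intPow n (entry X) i a j * entry X j c)
    | _, _ => False

/-- The string that codes the school multiplications in the computation of `powerString n k X`. -/
noncomputable def productString (n k : ℕ) (X : Finset ℕ) : Finset ℕ :=
  arrayString 5 (powBound n k (X.sup Nat.succ)) fun
    | [i, a, c, l, m], z =>
      ((intPow n (entry X) i a l).natAbs * ((entry X l c).natAbs % 2 ^ m)).testBit z
    | _, _ => False

variable {n k i a c l : ℕ} {X : Finset ℕ}

theorem natAbs_intPow_entry_le (n : ℕ) (X : Finset ℕ) (i a c : ℕ) :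
    (intPow n (entry X) i a c).natAbs ≤ 2 ^ ((n + X.sup Nat.succ) * i) :=
  natAbs_intPow_le (fun i j => (natAbs_entry_lt X i j).le) i a c

theorem lt_two_pow_of_le {b m : ℕ} (hi : i ≤ k) (hm : m ≤ 2 ^ ((n + b) * i)) :
    m < 2 ^ ((k + 1) * (n + b + 1)) :=
  hm.trans_lt (Nat.pow_lt_pow_right one_lt_two (by nlinarith [Nat.mul_le_mul_left (n + b) hi]))

theorem row_powerString (hi : i ≤ k) (ha : a < n) (hc : c < n) :
    row (row (row (· ∈ powerString n k X) i) a) c =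
      (· ∈ encodeInt (intPow n (entry X) i a c)) := by
  refine funext fun z => propext (mem_arrayString_powBound (is := [i, a, c]) rfl
    (Nat.le_of_ble_eq_true rfl) ?_ ?_)
  · simp only [List.mem_cons, List.not_mem_nil, or_false, forall_eq_or_imp, forall_eq]
    refine ⟨?_, ?_, ?_⟩ <;> nlinarith
  · exact le_of_mem_encodeInt (lt_two_pow_of_le hi (natAbs_intPow_entry_le n X i a c))

theorem row_partialSumString (hi : i < k) (ha : a < n) (hc : c < n) (hl : l ≤ n) :
    row (row (row (row (· ∈ partialSumString n k X) i) a) c) l =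
      (· ∈ encodeInt (∑ j ∈ Finset.range l, intPow n (entry X) i a j * entry X j c)) := by
  refine funext fun z => propext (mem_arrayString_powBound (is := [i, a, c, l]) rfl
    (Nat.le_of_ble_eq_true rfl) ?_ ?_)
  · simp only [List.mem_cons, List.not_mem_nil, or_false, forall_eq_or_imp, forall_eq]
    refine ⟨?_, ?_, ?_, ?_⟩ <;> nlinarith
  · exact le_of_mem_encodeInt (lt_two_pow_of_le hi (natAbs_sum_mul_le hl
      (natAbs_intPow_entry_le n X i a) fun j => (natAbs_entry_lt X j c).le))

theorem row_productString {m : ℕ} (hi : i < k) (ha : a < n) (hc : c < n) (hl : l < n)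
    (hm : m ≤ X.sup Nat.succ) :
    row (row (row (row (row (· ∈ productString n k X) i) a) c) l) m = fun z =>
      (((intPow n (entry X) i a l).natAbs * ((entry X l c).natAbs % 2 ^ m)).testBit z : Prop) := by
  refine funext fun z => propext (mem_arrayString_powBound (is := [i, a, c, l, m]) rfl
    le_rfl ?_ fun h => (le_of_testBit_of_lt (lt_two_pow_of_le hi ?_) h).le)
  · simp only [List.mem_cons, List.not_mem_nil, or_false, forall_eq_or_imp, forall_eq]
    refine ⟨?_, ?_, ?_, ?_, ?_⟩ <;> nlinarith
  · calc (intPow n (entry X) i a l).natAbs * ((entry X l c).natAbs % 2 ^ m)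
      _ ≤ 2 ^ ((n + X.sup Nat.succ) * i) * 2 ^ X.sup Nat.succ :=
        Nat.mul_le_mul (natAbs_intPow_entry_le n X i a l)
          ((Nat.mod_le _ _).trans (natAbs_entry_lt X l c).le)
      _ = 2 ^ ((n + X.sup Nat.succ) * i + X.sup Nat.succ) := (pow_add _ _ _).symm
      _ ≤ 2 ^ ((n + X.sup Nat.succ) * (i + 1)) := Nat.pow_le_pow_right two_pos (by nlinarith)

theorem isPowRun_powerString (n k : ℕ) (X : Finset ℕ) : IsPowRun (M := stdModel) n k X
    (powerString n k X) (partialSumString n k X) (productString n k X) :=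
  isPowRun_of_isDotRun (fun _ hi _ ha _ hc => row_powerString hi ha hc)
    fun _ hi _ ha _ hc => ⟨fun _ hl => row_partialSumString hi ha hc hl,
      fun _ hl _ hm => row_productString hi ha hc hl hm⟩

end Run

/-! ### The Pfaffian as a sum over all permutations -/

section PermSum

open Matrix

variable {ι : Type*}

/-- The permutation `(i, b) ↦ (τ i, b + ε i)`, which maps pairs to pairs. -/
def pairPerm (τ : Equiv.Perm ι) (ε : ι → Bool) : Equiv.Perm (ι × Bool) :=
  (Equiv.prodCongrRight fun i => if ε i then Equiv.swap false true else 1).trans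
    (Equiv.prodCongrLeft fun _ => τ)

theorem pairPerm_apply (τ : Equiv.Perm ι) (ε : ι → Bool) (i : ι) (b : Bool) :
    pairPerm τ ε (i, b) = (τ i, xor b (ε i)) := by
  cases h : ε i <;> cases b <;> simp [pairPerm, h]

theorem pairPerm_injective : Function.Injective fun x : Equiv.Perm ι × (ι → Bool) =>
    pairPerm x.1 x.2 := by
  rintro ⟨τ, ε⟩ ⟨τ', ε'⟩ h
  have apply_eq (i : ι) : (τ i, ε i) = (τ' i, ε' i) := by
    simpa [pairPerm_apply] using Equiv.congr_fun h (i, false)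
  exact Prod.ext (Equiv.ext fun i => congrArg Prod.fst (apply_eq i))
    (funext fun i => congrArg Prod.snd (apply_eq i))

theorem exists_eq_pairPerm [Finite ι] {σ : Equiv.Perm (ι × Bool)}
    (hσ : ∀ i, (σ (i, false)).1 = (σ (i, true)).1) : ∃ τ ε, pairPerm τ ε = σ := by
  have fst_eq (i : ι) (b : Bool) : (σ (i, b)).1 = (σ (i, false)).1 := by
    cases b
    exacts [rfl, (hσ i).symm]
  have snd_eq (i : ι) : (σ (i, true)).2 = !(σ (i, false)).2 := by
    have hne : σ (i, true) ≠ σ (i, false) := fun h => by simpa using σ.injective h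
    exact Bool.eq_not.2 fun h => hne (Prod.ext (hσ i).symm h)
  have fst_surjective : Function.Surjective fun i => (σ (i, false)).1 := fun j => by
    obtain ⟨⟨i, b⟩, h⟩ := σ.surjective (j, false)
    exact ⟨i, (fst_eq i b).symm.trans (congrArg Prod.fst h)⟩
  refine ⟨Equiv.ofBijective _ (Finite.surjective_iff_bijective.1 fst_surjective),
    fun i => (σ (i, false)).2, Equiv.ext fun ⟨i, b⟩ => ?_⟩
  rw [pairPerm_apply]
  refine Prod.ext (fst_eq i b).symm ?_
  cases b
  · exact Bool.false_xor _
  · exact (Bool.true_xor _).trans (snd_eq i).symm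

variable {K : Type*} [DecidableEq ι] [CommRing K]

/-- The standard symplectic form, block diagonal with blocks `[[0, 1], [-1, 0]]` on the pairs. -/
def symplecticForm (ι K : Type*) [DecidableEq ι] [CommRing K] :
    Matrix (ι × Bool) (ι × Bool) K :=
  fun p q => if p.1 = q.1 then q.2.toNat - p.2.toNat else 0

theorem symplecticForm_transpose : (symplecticForm ι K)ᵀ = -symplecticForm ι K := by
  ext p q
  simp only [transpose_apply, Matrix.neg_apply, symplecticForm, eq_comm (a := q.1)]
  split_ifs <;> simp

variable [Fintype ι]

/-- The contribution of the permutation `σ` to the Pfaffian of a matrix whose rows and columns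
are grouped in pairs `(i, false)`, `(i, true)`: it lists the matching
`{σ (i, false), σ (i, true)}`. -/
def pfaffianTerm (A : Matrix (ι × Bool) (ι × Bool) K) (σ : Equiv.Perm (ι × Bool)) : K :=
  ((Equiv.Perm.sign σ : ℤ) : K) * ∏ i, A (σ (i, false)) (σ (i, true))

/-- The Pfaffian without normalisation: each perfect matching is counted once for each of its
listings. Unlike the sum over matchings it needs no order on the vertices, and its behaviour
under congruence can be read off the expansion of the determinant. -/
def permPfaffian (A : Matrix (ι × Bool) (ι × Bool) K) : K := ∑ σ, pfaffianTerm A σ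

theorem mul_mul_transpose_apply {m n : Type*} [Fintype n] (B : Matrix m n K) (N : Matrix n n K)
    (p q : m) : (B * N * Bᵀ) p q = ∑ z : n × n, B p z.1 * B q z.2 * N z.1 z.2 := by
  rw [Fintype.sum_prod_type_right, mul_apply]
  refine Finset.sum_congr rfl fun y _ => ?_
  rw [mul_apply, transpose_apply, Finset.sum_mul]
  exact Finset.sum_congr rfl fun x _ => mul_right_comm _ _ _

theorem pfaffianTerm_congruence (B N : Matrix (ι × Bool) (ι × Bool) K)
    (σ : Equiv.Perm (ι × Bool)) : pfaffianTerm (B * N * Bᵀ) σ =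
      ∑ g : ι × Bool → ι × Bool, (((Equiv.Perm.sign σ : ℤ) : K) * ∏ p, B (σ p) (g p)) *
        ∏ i, N (g (i, false)) (g (i, true)) := by
  let pairs : (ι × Bool → ι × Bool) ≃ (ι → (ι × Bool) × (ι × Bool)) :=
    (Equiv.curry _ _ _).trans (Equiv.piCongrRight fun _ => Equiv.boolArrowEquivProd _)
  simp only [pfaffianTerm, mul_mul_transpose_apply]
  rw [Finset.prod_univ_sum, Fintype.piFinset_univ, Finset.mul_sum, ← pairs.sum_comp]
  refine Finset.sum_congr rfl fun g _ => ?_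
  rw [Fintype.prod_prod_type, mul_assoc, ← Finset.prod_mul_distrib]
  refine congrArg _ (Finset.prod_congr rfl fun i _ => ?_)
  rw [Fintype.prod_bool, mul_comm (B (σ (i, true)) _)]
  rfl

theorem permPfaffian_congruence (B N : Matrix (ι × Bool) (ι × Bool) K) :
    permPfaffian (B * N * Bᵀ) = B.det * permPfaffian N := by
  have sum_eq_det (g : ι × Bool → ι × Bool) :
      ∑ σ : Equiv.Perm (ι × Bool), ((Equiv.Perm.sign σ : ℤ) : K) * ∏ p, B (σ p) (g p) =
        (B.submatrix id g).det := (det_apply' (B.submatrix id g)).symm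
  simp only [permPfaffian, pfaffianTerm_congruence]
  rw [Finset.sum_comm, Finset.mul_sum]
  refine (Fintype.sum_of_injective (fun τ : Equiv.Perm (ι × Bool) => (τ : _ → _))
    DFunLike.coe_injective _ _ (fun g hg => ?_) fun τ => ?_).symm
  · have not_injective : ¬ g.Injective := fun h =>
      hg ⟨Equiv.ofBijective g (Finite.injective_iff_bijective.1 h), rfl⟩
    obtain ⟨p, q, hpq, hne⟩ := Function.not_injective_iff.1 not_injective
    rw [← Finset.sum_mul, sum_eq_det, det_zero_of_column_eq hne fun k => by
      simp only [submatrix_apply, hpq], zero_mul]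
  · rw [← Finset.sum_mul, sum_eq_det, det_permute', pfaffianTerm]
    ring

theorem sign_pairPerm (τ : Equiv.Perm ι) (ε : ι → Bool) :
    Equiv.Perm.sign (pairPerm τ ε) = ∏ i, if ε i then -1 else 1 := by
  rw [pairPerm, Equiv.Perm.sign_trans, Equiv.Perm.sign_prodCongrRight,
    Equiv.Perm.sign_prodCongrLeft, Fintype.prod_bool, ← sq, Int.units_sq, one_mul]
  exact Finset.prod_congr rfl fun i _ => by split_ifs <;> simp

theorem pfaffianTerm_mul_pairPerm {A : Matrix (ι × Bool) (ι × Bool) K} (hA : Aᵀ = -A)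
    (σ : Equiv.Perm (ι × Bool)) (τ : Equiv.Perm ι) (ε : ι → Bool) :
    pfaffianTerm A (σ * pairPerm τ ε) = pfaffianTerm A σ := by
  have hA' (p q : ι × Bool) : A q p = -A p q := congrFun (congrFun hA p) q
  have prod_eq : ∏ i, A ((σ * pairPerm τ ε) (i, false)) ((σ * pairPerm τ ε) (i, true)) =
      (∏ i, if ε i then (-1 : K) else 1) * ∏ i, A (σ (i, false)) (σ (i, true)) := by
    rw [← Equiv.prod_comp τ fun i => A (σ (i, false)) (σ (i, true)), ← Finset.prod_mul_distrib]
    refine Finset.prod_congr rfl fun i _ => ?_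
    simp only [Equiv.Perm.mul_apply, pairPerm_apply]
    cases h : ε i
    · simp
    · simp [hA' (σ (τ i, false)) (σ (τ i, true))]
  have sign_eq : ((Equiv.Perm.sign (pairPerm τ ε) : ℤ) : K) = ∏ i, if ε i then -1 else 1 := by
    rw [sign_pairPerm]
    push_cast
    exact Finset.prod_congr rfl fun i _ => by split_ifs <;> simp
  have sign_sq : (∏ i, if ε i then (-1 : K) else 1) * (∏ i, if ε i then (-1 : K) else 1) = 1 := by
    rw [← Finset.prod_mul_distrib]
    exact Finset.prod_eq_one fun i _ => by split_ifs <;> simp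
  rw [pfaffianTerm, prod_eq, Equiv.Perm.sign_mul, pfaffianTerm]
  push_cast
  rw [sign_eq]
  linear_combination
    ((Equiv.Perm.sign σ : ℤ) : K) * (∏ i, A (σ (i, false)) (σ (i, true))) * sign_sq

theorem permPfaffian_symplecticForm : permPfaffian (symplecticForm ι K) =
    Fintype.card (Equiv.Perm ι × (ι → Bool)) := by
  rw [permPfaffian, ← Fintype.sum_of_injective _ pairPerm_injective (fun _ => (1 : K)) _
    (fun σ hσ => ?_) fun x => ?_]
  · simp
  · obtain ⟨i, hi⟩ : ∃ i, (σ (i, false)).1 ≠ (σ (i, true)).1 := by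
      by_contra! h
      obtain ⟨τ, ε, rfl⟩ := exists_eq_pairPerm h
      exact hσ ⟨(τ, ε), rfl⟩
    rw [pfaffianTerm, Finset.prod_eq_zero (Finset.mem_univ i) (if_neg hi), mul_zero]
  · rw [← one_mul (pairPerm x.1 x.2), pfaffianTerm_mul_pairPerm symplecticForm_transpose]
    simp [pfaffianTerm, symplecticForm]

end PermSum

section Matching

variable {n : ℕ} {K : Type*} [CommRing K]

/-- The number of the vertex `(i, b)`: the pairs are `{2i, 2i + 1}`. -/
def vertexEquiv (n : ℕ) : Fin n × Bool ≃ Fin (2 * n) where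
  toFun p := ⟨2 * p.1 + p.2.toNat, by
    have := p.1.isLt
    have := p.2.toNat_le
    omega⟩
  invFun v := (⟨v / 2, by omega⟩, decide (v.val % 2 = 1))
  left_inv p := by
    obtain ⟨i, b⟩ := p
    cases b <;> simp [Fin.ext_iff]
    omega
  right_inv v := by
    refine Fin.ext ?_
    by_cases h : v.val % 2 = 1 <;> simp [h] <;> omega

/-- `IsMatching` for permutations of the vertices `(i, b)`. -/
def IsNormal (σ : Equiv.Perm (Fin n × Bool)) : Prop :=
  (∀ i, vertexEquiv n (σ (i, false)) < vertexEquiv n (σ (i, true))) ∧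
    StrictMono fun i => vertexEquiv n (σ (i, false))

theorem existsUnique_lt_not {ι α : Type*} [LinearOrder α] {f : ι × Bool → α}
    (hf : f.Injective) : ∃! δ : ι → Bool, ∀ i, f (i, δ i) < f (i, !δ i) := by
  have at_each (i : ι) : ∃! b : Bool, f (i, b) < f (i, !b) := by
    have hne : f (i, true) ≠ f (i, false) := fun h => by simpa using hf h
    rcases lt_or_gt_of_ne hne with h | h
    · exact ⟨true, h, fun b hb => by cases b; exacts [absurd h hb.not_gt, rfl]⟩
    · exact ⟨false, h, fun b hb => by cases b; exacts [rfl, absurd h hb.not_gt]⟩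
  choose δ hδ unique using at_each
  exact ⟨δ, hδ, fun δ' hδ' => funext fun i => unique i _ (hδ' i)⟩

theorem existsUnique_perm_strictMono {α : Type*} [LinearOrder α] {m : Fin n → α}
    (hm : m.Injective) : ∃! τ : Equiv.Perm (Fin n), StrictMono (m ∘ τ) := by
  refine ⟨Tuple.sort m, (Tuple.monotone_sort m).strictMono_of_injective
    (hm.comp (Tuple.sort m).injective), fun τ hτ => Equiv.ext fun i => hm ?_⟩
  exact congrFun (Tuple.unique_monotone hτ.monotone (Tuple.monotone_sort m)) i

theorem existsUnique_isNormal (σ : Equiv.Perm (Fin n × Bool)) :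
    ∃! x : Equiv.Perm (Fin n) × (Fin n → Bool), IsNormal (σ * pairPerm x.1 x.2) := by
  let f (p : Fin n × Bool) : Fin (2 * n) := vertexEquiv n (σ p)
  have hf : f.Injective := (vertexEquiv n).injective.comp σ.injective
  obtain ⟨δ, hδ, δ_unique⟩ := existsUnique_lt_not hf
  obtain ⟨τ, hτ, τ_unique⟩ := existsUnique_perm_strictMono (m := fun i => f (i, δ i))
    fun i j h => (Prod.ext_iff.1 (hf h)).1
  have isNormal_iff (ρ : Equiv.Perm (Fin n)) (ε : Fin n → Bool) :
      IsNormal (σ * pairPerm ρ ε) ↔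
        (∀ i, f (ρ i, ε i) < f (ρ i, !ε i)) ∧ StrictMono fun i => f (ρ i, ε i) := by
    simp only [IsNormal, Equiv.Perm.mul_apply, pairPerm_apply, Bool.false_xor, Bool.true_xor, f]
  refine ⟨(τ, δ ∘ τ), (isNormal_iff _ _).2 ⟨fun i => hδ (τ i), hτ⟩, ?_⟩
  rintro ⟨ρ, ε⟩ hx
  obtain ⟨pairs, mono⟩ := (isNormal_iff ρ ε).1 hx
  have ε_eq : ε = δ ∘ ρ := by
    rw [← Equiv.comp_symm_eq]
    exact δ_unique _ fun i => by simpa using pairs (ρ.symm i)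
  subst ε_eq
  rw [τ_unique ρ mono]

open Classical in
theorem permPfaffian_eq {A : Matrix (Fin n × Bool) (Fin n × Bool) K} (hA : A.transpose = -A) :
    permPfaffian A = (Fintype.card (Equiv.Perm (Fin n) × (Fin n → Bool)) : K) *
      ∑ σ with IsNormal σ, pfaffianTerm A σ := by
  have term_eq (σ : Equiv.Perm (Fin n × Bool)) : pfaffianTerm A σ =
      ∑ x : Equiv.Perm (Fin n) × (Fin n → Bool),
        if IsNormal (σ * pairPerm x.1 x.2) then pfaffianTerm A (σ * pairPerm x.1 x.2) else 0 := by
    obtain ⟨x, hx, hx'⟩ := existsUnique_isNormal σ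
    rw [Fintype.sum_eq_single x fun y hy => if_neg fun h => hy (hx' y h), if_pos hx,
      pfaffianTerm_mul_pairPerm hA]
  have sum_eq (ρ : Equiv.Perm (Fin n × Bool)) :
      (∑ σ, if IsNormal (σ * ρ) then pfaffianTerm A (σ * ρ) else 0) =
        ∑ σ with IsNormal σ, pfaffianTerm A σ := by
    rw [Finset.sum_filter]
    exact Equiv.sum_comp (Equiv.mulRight ρ) fun σ => if IsNormal σ then pfaffianTerm A σ else 0
  rw [permPfaffian, Finset.sum_congr rfl fun σ _ => term_eq σ, Finset.sum_comm,
    Finset.sum_congr rfl fun x _ => sum_eq _, Finset.sum_const, Finset.card_univ, nsmul_eq_mul]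

open Classical in
theorem pfaffian_eq_sum_isNormal (A : Matrix (Fin (2 * n)) (Fin (2 * n)) ℤ) :
    pfaffian A =
      ∑ σ with IsNormal σ, pfaffianTerm (A.submatrix (vertexEquiv n) (vertexEquiv n)) σ := by
  have vertex_false (i : Fin n) : vertexEquiv n (i, false) = ⟨2 * i, by omega⟩ := rfl
  have vertex_true (i : Fin n) : vertexEquiv n (i, true) = ⟨2 * i + 1, by omega⟩ := rfl
  refine (Finset.sum_equiv (Equiv.permCongr (vertexEquiv n)) (fun σ => ?_) fun σ _ => ?_).symm
  · rw [Finset.mem_filter, Finset.mem_filter]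
    simp only [Finset.mem_univ, true_and, IsNormal, IsMatching, StrictMono,
      ← vertex_false, ← vertex_true, Equiv.permCongr_apply, Equiv.symm_apply_apply]
  · simp only [pfaffianTerm, Equiv.Perm.sign_permCongr, ← vertex_false, ← vertex_true,
      Equiv.permCongr_apply, Equiv.symm_apply_apply, Matrix.submatrix_apply]
    rfl

end Matching

/-! ### Elimination of a pair of vertices -/

section Shear

open Matrix

variable {m n K : Type*} [Fintype m] [Fintype n] [DecidableEq m] [CommRing K]

theorem shear_congruence {N : Matrix m m K} {E W C : Matrix m n K} (hNW : N * W = -C)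
    (hWN : Wᵀ * N = Cᵀ) : (1 + E * Wᵀ) * N * (1 + E * Wᵀ)ᵀ =
      N + E * Cᵀ - C * Eᵀ + E * (Cᵀ * W) * Eᵀ := by
  rw [Matrix.add_mul, Matrix.one_mul, Matrix.mul_assoc E, hWN, transpose_add, transpose_one,
    transpose_mul, transpose_transpose, Matrix.mul_add, Matrix.mul_one, Matrix.add_mul,
    ← Matrix.mul_assoc N, hNW]
  simp only [Matrix.mul_assoc, Matrix.neg_mul]
  abel

theorem det_shear {E W : Matrix m n K} (hWE : Wᵀ * E = 0) : (1 + E * Wᵀ).det = 1 := by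
  classical
  rw [det_one_add_mul_comm, hWE, add_zero, det_one]

end Shear

section Elimination

open Matrix

variable {ι K : Type*} [DecidableEq ι] [CommRing K]

/-- The columns of the unit vectors `(h, false)` and `(h, true)`. -/
def pairColumns (K : Type*) [CommRing K] (h : ι) : Matrix (ι × Bool) Bool K :=
  (1 : Matrix (ι × Bool) (ι × Bool) K).submatrix id (Prod.mk h)

/-- The part of the standard symplectic form on the pair `h`. -/
def pairForm (K : Type*) [CommRing K] (h : ι) : Matrix (ι × Bool) (ι × Bool) K :=
  fun p q => if p.1 = h ∧ q.1 = h then q.2.toNat - p.2.toNat else 0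

theorem pairColumns_mul_mul_transpose [IsDomain K] [CharZero K] {G : Matrix Bool Bool K}
    (hG : Gᵀ = -G) (h : ι) :
    pairColumns K h * G * (pairColumns K h)ᵀ = G false true • pairForm K h := by
  have hG' (b c : Bool) : G c b = -G b c := congrFun (congrFun hG b) c
  have diag_eq_zero (b : Bool) : G b b = 0 := self_eq_neg.1 (hG' b b)
  ext ⟨i, b⟩ ⟨j, c⟩
  simp only [Matrix.mul_apply, Fintype.sum_bool, pairColumns, transpose_apply, submatrix_apply,
    one_apply, Matrix.smul_apply, pairForm, smul_eq_mul]
  by_cases hi : i = h <;> by_cases hj : j = h <;> cases b <;> cases c <;>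
    simp [hi, hj, diag_eq_zero, hG' false true]

variable [Fintype ι]

theorem transpose_mul_pairColumns {h : ι} {W : Matrix (ι × Bool) Bool K}
    (hW : ∀ b c, W (h, b) c = 0) : Wᵀ * pairColumns K h = 0 := by
  ext b c
  simp [pairColumns, Matrix.mul_apply, one_apply, hW]

theorem pairForm_mul {h : ι} {W : Matrix (ι × Bool) Bool K} (hW : ∀ b c, W (h, b) c = 0) :
    pairForm K h * W = 0 := by
  ext p c
  refine Finset.sum_eq_zero fun ⟨i, b⟩ _ => ?_
  change pairForm K h p (i, b) * W (i, b) c = 0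
  by_cases hi : i = h
  · rw [hi, hW, mul_zero]
  · rw [pairForm, if_neg fun hp => hi hp.2, zero_mul]

theorem transpose_mul_pairForm {h : ι} {W : Matrix (ι × Bool) Bool K}
    (hW : ∀ b c, W (h, b) c = 0) : Wᵀ * pairForm K h = 0 := by
  have pairForm_transpose : (pairForm K h)ᵀ = -pairForm K h := by
    ext p q
    by_cases hp : p.1 = h <;> by_cases hq : q.1 = h <;> simp [pairForm, hp, hq]
  rw [← neg_neg (pairForm K h), ← pairForm_transpose, Matrix.mul_neg, ← transpose_mul,
    pairForm_mul hW, transpose_zero, neg_zero]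

theorem sum_symplecticForm_mul (p : ι × Bool) (f : ι × Bool → K) :
    ∑ q, symplecticForm ι K p q * f q = if p.2 then -f (p.1, false) else f (p.1, true) := by
  obtain ⟨i, b⟩ := p
  rw [Fintype.sum_prod_type, Fintype.sum_eq_single i]
  · cases b <;> simp [symplecticForm]
  · intro j hj
    simp [symplecticForm, hj.symm]

theorem permPfaffian_add_smul_pairForm {N : Matrix (ι × Bool) (ι × Bool) K} (hN : Nᵀ = -N)
    {h : ι} (hh : ∀ b q, N (h, b) q = symplecticForm ι K (h, b) q) (β : K) :
    permPfaffian (N + β • pairForm K h) = (1 + β) * permPfaffian N := by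
  have column_eq (q : ι × Bool) (b : Bool) : N q (h, b) = -symplecticForm ι K (h, b) q := by
    rw [← hh]
    exact congrFun (congrFun hN (h, b)) q
  have scale : N + β • pairForm K h =
      diagonal (fun p => if p = (h, false) then 1 + β else 1) * N *
        (diagonal fun p => if p = (h, false) then 1 + β else 1)ᵀ := by
    ext ⟨i, b⟩ ⟨j, c⟩
    rw [diagonal_transpose, mul_diagonal, diagonal_mul, Matrix.add_apply, Matrix.smul_apply,
      pairForm, smul_eq_mul]
    by_cases hi : i = h
    · subst hi
      rw [hh]
      by_cases hj : j = i
      · cases b <;> cases c <;> simp [hj, symplecticForm, add_comm]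
      · simp [hj, Ne.symm hj, symplecticForm]
    · by_cases hj : j = h
      · subst hj
        rw [column_eq]
        simp [hi, Ne.symm hi, symplecticForm]
      · simp [hi, hj]
  rw [scale, permPfaffian_congruence, det_diagonal, Fintype.prod_ite_eq']

/-- This is a Schur complement: the shear with columns `-N⁻¹ * C` clears the rows and columns of
the pair `h`, and changes only the block of this pair. -/
theorem permPfaffian_clear [IsDomain K] [CharZero K] {N : Matrix (ι × Bool) (ι × Bool) K}
    (hN : Nᵀ = -N) (hu : IsUnit N.det) {h : ι}
    (hh : ∀ b q, N (h, b) q = symplecticForm ι K (h, b) q) {C : Matrix (ι × Bool) Bool K}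
    (hC : ∀ b c, C (h, b) c = 0) (α : K) :
    permPfaffian
        (N + pairColumns K h * Cᵀ - C * (pairColumns K h)ᵀ + α • pairForm K h) =
      (1 + α + ∑ v, C v false * (N⁻¹ *ᵥ (C · true)) v) * permPfaffian N := by
  set E := pairColumns K h
  set W : Matrix (ι × Bool) Bool K := -(N⁻¹ * C)
  have hNW : N * W = -C := by rw [Matrix.mul_neg, mul_nonsing_inv_cancel_left _ _ hu]
  have hWN : Wᵀ * N = Cᵀ := by
    have := congrArg transpose hNW
    rw [transpose_mul, hN, Matrix.mul_neg, transpose_neg] at this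
    exact neg_injective this
  have hW (b c : Bool) : W (h, b) c = 0 := by
    have := congrFun (congrFun hNW (h, !b)) c
    simp only [Matrix.mul_apply, hh, sum_symplecticForm_mul, Matrix.neg_apply, hC] at this
    cases b <;> simpa using this
  have hskew : (Cᵀ * W)ᵀ = -(Cᵀ * W) := by
    rw [← hWN, transpose_mul, transpose_mul, transpose_transpose, hN, Matrix.mul_assoc,
      Matrix.neg_mul, Matrix.mul_neg]
  set g := (Cᵀ * W) false true
  have sum_eq : ∑ v, C v false * (N⁻¹ *ᵥ (C · true)) v = -g := by
    rw [← neg_eq_iff_eq_neg, ← Finset.sum_neg_distrib]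
    exact Finset.sum_congr rfl fun v _ => (mul_neg _ _).symm
  have shear := shear_congruence (N := N + (α - g) • pairForm K h) (E := E) (W := W) (C := C)
    (by rw [Matrix.add_mul, Matrix.smul_mul, pairForm_mul hW, smul_zero, add_zero, hNW])
    (by rw [Matrix.mul_add, Matrix.mul_smul, transpose_mul_pairForm hW, smul_zero, add_zero, hWN])
  rw [pairColumns_mul_mul_transpose hskew] at shear
  have target_eq : N + E * Cᵀ - C * Eᵀ + α • pairForm K h =
      (1 + E * Wᵀ) * (N + (α - g) • pairForm K h) * (1 + E * Wᵀ)ᵀ := by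
    rw [shear, sub_smul]
    abel
  rw [target_eq, permPfaffian_congruence, det_shear (transpose_mul_pairColumns hW), one_mul,
    permPfaffian_add_smul_pairForm hN hh, sum_eq]
  ring

end Elimination

/-! ### The Pfaffian as a coefficient of a product of power series -/

section Product

open Matrix

variable {n : ℕ} {K : Type*} [CommRing K]

/-- The standard symplectic form plus the part of `a` on the vertices of the pairs `i ≥ h`. -/
def partialForm (a : Matrix (Fin n × Bool) (Fin n × Bool) K) (h : ℕ) :
    Matrix (Fin n × Bool) (Fin n × Bool) K :=
  symplecticForm (Fin n) K + of fun p q => if h ≤ p.1 ∧ h ≤ q.1 then a p q else 0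

/-- The columns of `a` for the vertices of the pair `h`, up to sign and restricted to the vertices
of the pairs `i > h`. -/
def columnsAbove (a : Matrix (Fin n × Bool) (Fin n × Bool) K) (h : Fin n) :
    Matrix (Fin n × Bool) Bool K :=
  fun v b => if h < v.1 then a (h, b) v else 0

/-- The vector whose entry at `(h, false)` is the factor, up to `1 +`, that splits off when the
pair `h` is eliminated. -/
noncomputable def pivotVector (a : Matrix (Fin n × Bool) (Fin n × Bool) K) (h : Fin n) :
    Fin n × Bool → K :=
  fun v => a v (h, true) + ∑ u, if h < u.1 then
    a v u * ((partialForm a (h + 1))⁻¹ *ᵥ (columnsAbove a h · true)) u else 0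

variable {a : Matrix (Fin n × Bool) (Fin n × Bool) K}

theorem partialForm_zero : partialForm a 0 = symplecticForm (Fin n) K + a := by
  ext p q
  simp [partialForm]

theorem partialForm_self : partialForm a n = symplecticForm (Fin n) K := by
  ext p q
  simp [partialForm]

theorem partialForm_transpose (ha : aᵀ = -a) (h : ℕ) :
    (partialForm a h)ᵀ = -partialForm a h := by
  rw [partialForm, transpose_add, symplecticForm_transpose, neg_add]
  congr 1
  ext p q
  have : a q p = -a p q := congrFun (congrFun ha p) q
  simp only [transpose_apply, Matrix.neg_apply, of_apply, and_comm (a := h ≤ q.1.val), this]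
  split_ifs <;> simp

theorem partialForm_eq_add [IsDomain K] [CharZero K] (ha : aᵀ = -a) (h : Fin n) :
    partialForm a h = partialForm a (h + 1) + pairColumns K h * (columnsAbove a h)ᵀ -
      columnsAbove a h * (pairColumns K h)ᵀ + a (h, false) (h, true) • pairForm K h := by
  have ha' (p q : Fin n × Bool) : a q p = -a p q := congrFun (congrFun ha p) q
  have diag_eq_zero (p : Fin n × Bool) : a p p = 0 := self_eq_neg.1 (ha' p p)
  have lt_or_eq_or_gt (i : Fin n) : (¬ (h : ℕ) ≤ i ∧ ¬ (h : ℕ) + 1 ≤ i ∧ ¬ h < i ∧ i ≠ h) ∨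
      i = h ∨ ((h : ℕ) ≤ i ∧ (h : ℕ) + 1 ≤ i ∧ h < i ∧ i ≠ h) := by
    simp only [Fin.lt_def, Fin.ext_iff, ne_eq]
    omega
  ext ⟨i, b⟩ ⟨j, c⟩
  simp only [partialForm, columnsAbove, Matrix.add_apply, Matrix.sub_apply, Matrix.smul_apply,
    Matrix.mul_apply, Fintype.sum_bool, pairColumns, transpose_apply, pairForm, of_apply,
    submatrix_apply, one_apply, smul_eq_mul, id_eq, Prod.mk.injEq]
  rcases lt_or_eq_or_gt i with ⟨i₁, i₂, i₃, i₄⟩ | rfl | ⟨i₁, i₂, i₃, i₄⟩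
  · simp [i₁, i₂, i₃, i₄]
  · rcases lt_or_eq_or_gt j with ⟨j₁, j₂, j₃, j₄⟩ | rfl | ⟨j₁, -, j₃, j₄⟩
    · simp [j₁, j₂, j₃, j₄]
    · cases b <;> cases c <;> simp [diag_eq_zero, ha' (j, false) (j, true)]
    · cases b <;> simp [j₁, j₃, j₄]
  · rcases lt_or_eq_or_gt j with ⟨j₁, j₂, j₃, j₄⟩ | rfl | ⟨j₁, j₂, -, j₄⟩
    · simp [j₁, j₂, j₃, j₄]
    · cases c <;> simp [i₁, i₃, i₄, ha' _ (i, b), sub_eq_add_neg]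
    · simp [i₁, i₂, i₄, j₁, j₂, j₄]

theorem inv_partialForm_mulVec (ha : aᵀ = -a) {h c : Fin n}
    (hu : IsUnit (partialForm a (h + 1)).det) (hc : h < c) (b : Bool) :
    ((partialForm a (h + 1))⁻¹ *ᵥ (columnsAbove a h · true)) (c, b) =
      if b then -pivotVector a h (c, false) else pivotVector a h (c, true) := by
  set y := (partialForm a (h + 1))⁻¹ *ᵥ (columnsAbove a h · true) with hy
  have mulVec_eq : partialForm a (h + 1) *ᵥ y = (columnsAbove a h · true) := by
    rw [hy, mulVec_mulVec, mul_nonsing_inv _ hu, one_mulVec]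
  have form_eq (b : Bool) : (if b then -y (c, false) else y (c, true)) =
      -pivotVector a h (c, b) := by
    have row_eq := congrFun mulVec_eq (c, b)
    simp only [mulVec, dotProduct, partialForm, Matrix.add_apply, of_apply, add_mul,
      Finset.sum_add_distrib, sum_symplecticForm_mul] at row_eq
    have column_eq : columnsAbove a h (c, b) true = -a (c, b) (h, true) := by
      rw [columnsAbove, if_pos hc]
      exact congrFun (congrFun ha _) _
    have sum_eq : ∑ u : Fin n × Bool,
        (if (h : ℕ) + 1 ≤ c ∧ (h : ℕ) + 1 ≤ u.1 then a (c, b) u else 0) * y u =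
          ∑ u : Fin n × Bool, if h < u.1 then a (c, b) u * y u else 0 := by
      simp only [show (h : ℕ) + 1 ≤ c from hc, true_and, ite_mul, zero_mul]
      rfl
    rw [column_eq, sum_eq] at row_eq
    rw [pivotVector, neg_add, ← row_eq, ← hy, add_neg_cancel_right]
  cases b
  · simpa using form_eq true
  · simpa using form_eq false

theorem pivotVector_eq (ha : aᵀ = -a) (h : Fin n) (hu : IsUnit (partialForm a (h + 1)).det)
    (v : Fin n × Bool) : pivotVector a h v = a v (h, true) + ∑ c, if h < c then
      a v (c, false) * pivotVector a h (c, true) -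
        a v (c, true) * pivotVector a h (c, false) else 0 := by
  rw [pivotVector, Fintype.sum_prod_type]
  refine congrArg _ (Finset.sum_congr rfl fun c _ => ?_)
  rw [Fintype.sum_bool]
  split_ifs with hc
  · rw [inv_partialForm_mulVec ha hu hc, inv_partialForm_mulVec ha hu hc, if_pos rfl,
      if_neg Bool.false_ne_true]
    ring
  · exact add_zero 0

theorem permPfaffian_partialForm [IsDomain K] [CharZero K] (ha : aᵀ = -a) (h : Fin n)
    (hu : IsUnit (partialForm a (h + 1)).det) : permPfaffian (partialForm a h) =
      (1 + pivotVector a h (h, false)) * permPfaffian (partialForm a (h + 1)) := by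
  rw [partialForm_eq_add ha, permPfaffian_clear (partialForm_transpose ha _) hu
    (fun b q => by simp [partialForm]) (fun b c => by simp [columnsAbove]), pivotVector, add_assoc]
  simp only [columnsAbove, ite_mul, zero_mul]

theorem eq_prod_mul_of_forall_eq_mul {M : Type*} [CommMonoid M] (f : ℕ → M) {g : Fin n → M}
    (h : ∀ k : Fin n, f k = g k * f (k + 1)) : f 0 = (∏ k, g k) * f n := by
  induction n generalizing f with
  | zero => simp
  | succ n ih =>
    rw [Fin.prod_univ_succ, mul_assoc, ← ih (fun k => f (k + 1)) fun k => h k.succ]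
    exact h 0

theorem permPfaffian_symplecticForm_add [IsDomain K] [CharZero K] (ha : aᵀ = -a)
    (hu : ∀ h, IsUnit (partialForm a h).det) :
    permPfaffian (symplecticForm (Fin n) K + a) =
      (∏ h, (1 + pivotVector a h (h, false))) * permPfaffian (symplecticForm (Fin n) K) := by
  rw [← partialForm_zero, ← partialForm_self (a := a)]
  exact eq_prod_mul_of_forall_eq_mul (fun h => permPfaffian (partialForm a h)) fun h =>
    permPfaffian_partialForm ha h (hu _)

end Product

section Series

open Matrix PowerSeries

variable {ι R : Type*} [CommRing R]

/-- The matrix `X * A` of power series. -/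
noncomputable def linearTerm (A : Matrix ι ι R) : Matrix ι ι R⟦X⟧ := A.map fun x => X * C x

theorem linearTerm_transpose {A : Matrix ι ι R} (hA : Aᵀ = -A) :
    (linearTerm A)ᵀ = -linearTerm A := by
  ext1 p q
  have : A q p = -A p q := congrFun (congrFun hA p) q
  simp [linearTerm, this]

theorem coeff_prod_C_add_X_mul_C [Fintype ι] (u v : ι → R) :
    coeff (Fintype.card ι) (∏ i, (C (u i) + X * C (v i)) : R⟦X⟧) = ∏ i, v i := by
  have prod_eq : (∏ i, (C (u i) + X * C (v i)) : R⟦X⟧) =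
      (∏ i, (Polynomial.C (u i) + Polynomial.X * Polynomial.C (v i)) : Polynomial R) := by
    rw [← Polynomial.coeToPowerSeries.ringHom_apply, map_prod]
    simp only [Polynomial.coeToPowerSeries.ringHom_apply, Polynomial.coe_add, Polynomial.coe_mul,
      Polynomial.coe_C, Polynomial.coe_X]
  have coeff_eq := Polynomial.coeff_prod_of_natDegree_le (s := Finset.univ)
    (fun i => Polynomial.C (u i) + Polynomial.X * Polynomial.C (v i)) 1
    fun i _ => by compute_degree
  rw [Finset.card_univ, mul_one] at coeff_eq
  rw [prod_eq, Polynomial.coeff_coe, coeff_eq]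
  refine Finset.prod_congr rfl fun i _ => ?_
  rw [Polynomial.coeff_add, Polynomial.coeff_C_succ, zero_add, Polynomial.coeff_X_mul,
    Polynomial.coeff_C_zero]

theorem coeff_permPfaffian [DecidableEq ι] [Fintype ι] (N A : Matrix (ι × Bool) (ι × Bool) R) :
    coeff (Fintype.card ι) (permPfaffian (N.map (C : R →+* R⟦X⟧) + linearTerm A)) =
      permPfaffian A := by
  rw [permPfaffian, map_sum]
  refine Finset.sum_congr rfl fun σ _ => ?_
  rw [pfaffianTerm, ← map_intCast (C : R →+* R⟦X⟧), coeff_C_mul]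
  exact congrArg _ (coeff_prod_C_add_X_mul_C _ _)

theorem isUnit_det_partialForm {n : ℕ} (A : Matrix (Fin n × Bool) (Fin n × Bool) R) (h : ℕ) :
    IsUnit (partialForm (linearTerm A) h).det := by
  have map_eq : (constantCoeff : R⟦X⟧ →+* R).mapMatrix (partialForm (linearTerm A) h) =
      symplecticForm (Fin n) R := by
    ext p q
    simp only [RingHom.mapMatrix_apply, Matrix.map_apply, partialForm, linearTerm, Matrix.add_apply,
      Matrix.of_apply, symplecticForm, map_add]
    split_ifs <;> simp
  rw [isUnit_iff_constantCoeff, RingHom.map_det, map_eq]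
  refine Matrix.isUnit_det_of_right_inverse (B := -symplecticForm (Fin n) R) ?_
  ext ⟨i, b⟩ ⟨j, c⟩
  rw [Matrix.mul_apply, sum_symplecticForm_mul]
  by_cases hij : i = j <;> cases b <;> cases c <;>
    simp [symplecticForm, hij, Matrix.one_apply]

variable [IsDomain R] [CharZero R]

theorem permPfaffian_eq_card_mul_coeff {n : ℕ} {A : Matrix (Fin n × Bool) (Fin n × Bool) R}
    (hA : Aᵀ = -A) : permPfaffian A =
      Fintype.card (Equiv.Perm (Fin n) × (Fin n → Bool)) *
        coeff n (∏ h, (1 + pivotVector (linearTerm A) h (h, false))) := by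
  have map_symplecticForm :
      (symplecticForm (Fin n) R).map (C : R →+* R⟦X⟧) = symplecticForm (Fin n) R⟦X⟧ := by
    ext1 p q
    simp only [symplecticForm, Matrix.map_apply]
    split_ifs <;> simp
  have : CharZero R⟦X⟧ := charZero_of_injective_ringHom (C_injective (R := R))
  have coeff_eq := coeff_permPfaffian (symplecticForm (Fin n) R) A
  rwa [map_symplecticForm, permPfaffian_symplecticForm_add (linearTerm_transpose hA)
    (isUnit_det_partialForm A), permPfaffian_symplecticForm, mul_comm,
    ← map_natCast (C : R →+* R⟦X⟧), coeff_C_mul, Fintype.card_fin, eq_comm] at coeff_eq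

end Series

section NatIndex

open Matrix PowerSeries

/-- The matrix `a` on the vertices `v < 2 * n`, in block form. -/
def pairMatrix (n : ℕ) (a : ℕ → ℕ → ℤ) : Matrix (Fin n × Bool) (Fin n × Bool) ℤ :=
  fun p q => a (vertexEquiv n p) (vertexEquiv n q)

/-- The pivot vectors of `X * a`, with pairs and vertices given by numbers and `0` out of range.
The coefficients of `pivotSeries n a h (2 * h)` sum the weights of the closed walks from the pair
`h` through higher pairs. -/
noncomputable def pivotSeries (n : ℕ) (a : ℕ → ℕ → ℤ) (h v : ℕ) : ℤ⟦X⟧ :=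
  if hv : h < n ∧ v < 2 * n then
    pivotVector (linearTerm (pairMatrix n a)) ⟨h, hv.1⟩ ((vertexEquiv n).symm ⟨v, hv.2⟩)
  else 0

theorem pivotSeries_vertexEquiv {n : ℕ} (a : ℕ → ℕ → ℤ) (h : Fin n) (p : Fin n × Bool) :
    pivotSeries n a h (vertexEquiv n p) =
      pivotVector (linearTerm (pairMatrix n a)) h p := by
  simp [pivotSeries]

variable {n : ℕ} {a : ℕ → ℕ → ℤ}

theorem pairMatrix_transpose (ha : ∀ i < 2 * n, ∀ j < 2 * n, a j i = -a i j) :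
    (pairMatrix n a)ᵀ = -pairMatrix n a := by
  ext p q
  exact ha _ (vertexEquiv n p).isLt _ (vertexEquiv n q).isLt

theorem pivotSeries_eq (ha : ∀ i < 2 * n, ∀ j < 2 * n, a j i = -a i j) {h v : ℕ} (hh : h < n)
    (hv : v < 2 * n) : pivotSeries n a h v = X * (C (a v (2 * h + 1)) +
      ∑ c ∈ Finset.range n, if h < c then C (a v (2 * c)) * pivotSeries n a h (2 * c + 1) -
        C (a v (2 * c + 1)) * pivotSeries n a h (2 * c) else 0) := by
  lift h to Fin n using hh
  obtain ⟨p, rfl⟩ : ∃ p, v = vertexEquiv n p :=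
    ⟨(vertexEquiv n).symm ⟨v, hv⟩, by rw [Equiv.apply_symm_apply]⟩
  have even_eq (c : Fin n) : pivotSeries n a h (2 * c) =
      pivotVector (linearTerm (pairMatrix n a)) h (c, false) :=
    pivotSeries_vertexEquiv a h (c, false)
  have odd_eq (c : Fin n) : pivotSeries n a h (2 * c + 1) =
      pivotVector (linearTerm (pairMatrix n a)) h (c, true) :=
    pivotSeries_vertexEquiv a h (c, true)
  rw [pivotSeries_vertexEquiv, pivotVector_eq (linearTerm_transpose (pairMatrix_transpose ha)) h
    (isUnit_det_partialForm _ _), mul_add, Finset.mul_sum, Finset.sum_range]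
  refine congrArg₂ _ rfl (Finset.sum_congr rfl fun c _ => ?_)
  rw [even_eq, odd_eq, mul_ite, mul_zero, mul_sub, ← mul_assoc, ← mul_assoc]
  rfl

theorem pfaffian_eq_coeff_prod (ha : ∀ i < 2 * n, ∀ j < 2 * n, a j i = -a i j) :
    pfaffian (n := n) (of fun i j => a i j) =
      coeff n (∏ h ∈ Finset.range n, (1 + pivotSeries n a h (2 * h))) := by
  classical
  have card_ne_zero : (Fintype.card (Equiv.Perm (Fin n) × (Fin n → Bool)) : ℤ) ≠ 0 :=
    mod_cast Fintype.card_ne_zero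
  have hA := pairMatrix_transpose ha
  have prod_eq : ∏ h ∈ Finset.range n, (1 + pivotSeries n a h (2 * h)) =
      ∏ h, (1 + pivotVector (linearTerm (pairMatrix n a)) h (h, false)) := by
    rw [Finset.prod_range]
    exact Finset.prod_congr rfl fun h _ => congrArg _ (pivotSeries_vertexEquiv a h (h, false))
  rw [prod_eq]
  refine mul_left_cancel₀ card_ne_zero ?_
  rw [← permPfaffian_eq_card_mul_coeff hA, permPfaffian_eq hA, pfaffian_eq_sum_isNormal]
  rfl

end NatIndex

/-! ### The Pfaffian as an entry of a power of the transfer matrix -/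

section Powers

open PowerSeries Finset

theorem intPow_succ' {D : ℕ} {e : ℕ → ℕ → ℤ} (k : ℕ) {p r : ℕ} (hp : p < D) (hr : r < D) :
    intPow D e (k + 1) p r = ∑ q ∈ range D, e p q * intPow D e k q r := by
  induction k generalizing r with
  | zero => simp [intPow, hp, hr]
  | succ k ih =>
    rw [intPow, sum_congr rfl fun q hq => by rw [ih (mem_range.1 hq)]]
    simp only [sum_mul, intPow, mul_sum, mul_assoc]
    exact sum_comm

theorem coeff_eq_intPow {D r : ℕ} {e : ℕ → ℕ → ℤ} {Ψ : ℕ → ℤ⟦X⟧} (hr : r < D)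
    (hΨ : ∀ p < D, Ψ p = (if p = r then 1 else 0) + X * ∑ q ∈ range D, C (e p q) * Ψ q)
    (k : ℕ) {p : ℕ} (hp : p < D) : coeff k (Ψ p) = intPow D e k p r := by
  induction k generalizing p with
  | zero =>
    rw [hΨ p hp, map_add, coeff_zero_X_mul, add_zero, intPow]
    split_ifs <;> simp
  | succ k ih =>
    rw [hΨ p hp, map_add, coeff_succ_X_mul, map_sum, intPow_succ' k hp hr,
      sum_congr rfl fun q hq => by rw [coeff_C_mul, ih (mem_range.1 hq)]]
    split_ifs <;> simp [coeff_one]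

end Powers

section States

variable {n h v : ℕ}

theorem state_div_numVertices (hv : v < numVertices n) : state n h v / numVertices n = h := by
  rw [state, mul_comm, Nat.mul_add_div (Nat.zero_lt_of_lt hv), Nat.div_eq_of_lt hv, add_zero]

theorem state_mod_numVertices (hv : v < numVertices n) : state n h v % numVertices n = v :=
  Nat.mul_add_mod_of_lt hv

theorem exists_state_eq {p : ℕ} (hp : p < numStates n) :
    ∃ h ≤ n, ∃ v < numVertices n, state n h v = p :=
  ⟨p / numVertices n, Nat.lt_succ_iff.1 (Nat.div_lt_of_lt_mul (by rwa [mul_comm])),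
    p % numVertices n, Nat.mod_lt _ (Nat.succ_pos _), Nat.div_add_mod' _ _⟩

theorem sum_range_mul_eq {N : Type*} [AddCommMonoid N] (m k : ℕ) (f : ℕ → N) :
    ∑ q ∈ Finset.range (m * k), f q =
      ∑ i ∈ Finset.range m, ∑ j ∈ Finset.range k, f (i * k + j) := by
  induction m with
  | zero => simp
  | succ m ih => rw [Nat.succ_mul, Finset.sum_range_add, ih, Finset.sum_range_succ]

end States

section Walks

open PowerSeries Finset

/-- The entry of the transfer matrix at the states `(h, v)` and `(h', v')`. A walk goes from the
entry state to the first vertex of some pair, follows closed walks with increasing heads, and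
stops in the exit state `(n, 2 * n)`. -/
def walkWeight (n : ℕ) (a : ℕ → ℕ → ℤ) (h v h' v' : ℕ) : ℤ :=
  if h = n ∧ v = 2 * n + 1 then if v' = 2 * h' then 1 else 0
  else if h < n ∧ v < 2 * n then
    if h < h' then if v' = 2 * h' then a v (2 * h + 1) else 0
    else if h' = h ∧ h < v' / 2 ∧ v' < 2 * n then
      if v' % 2 = 0 then a (v' + 1) v else a v (v' - 1)
    else 0
  else 0

/-- The product of the factors `1 + z j (2 * j)` for the pairs `j ≥ m`. -/
noncomputable def tailProd (n : ℕ) (z : ℕ → ℕ → ℤ⟦X⟧) (m : ℕ) : ℤ⟦X⟧ :=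
  ∏ j ∈ Ico m n, (1 + z j (2 * j))

/-- The generating function of the walks from the state `(h, v)` to the exit state, where `z h v`
is the one of the walks from `(h, v)` to the end of the current closed walk. -/
noncomputable def walkSeries (n : ℕ) (z : ℕ → ℕ → ℤ⟦X⟧) (h v : ℕ) : ℤ⟦X⟧ :=
  if h < n ∧ v < 2 * n then z h v * tailProd n z (h + 1)
  else if h = n ∧ v = 2 * n + 1 then X * tailProd n z 0
  else if h = n ∧ v = 2 * n then 1 else 0

variable {n m h v h' : ℕ} {a : ℕ → ℕ → ℤ} {z : ℕ → ℕ → ℤ⟦X⟧}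

theorem walkSeries_of_lt (z : ℕ → ℕ → ℤ⟦X⟧) (hh : h < n) (hv : v < 2 * n) :
    walkSeries n z h v = z h v * tailProd n z (h + 1) :=
  if_pos ⟨hh, hv⟩

theorem walkSeries_exitState (n : ℕ) (z : ℕ → ℕ → ℤ⟦X⟧) : walkSeries n z n (2 * n) = 1 := by
  simp [walkSeries]

theorem walkSeries_entryState (n : ℕ) (z : ℕ → ℕ → ℤ⟦X⟧) :
    walkSeries n z n (2 * n + 1) = X * tailProd n z 0 := by
  simp [walkSeries]

/-- Expanding the product, the first nontrivial factor decides where the next closed walk starts. -/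
theorem sum_walkSeries (z : ℕ → ℕ → ℤ⟦X⟧) (hm : m ≤ n) :
    ∑ h ∈ Ico m (n + 1), walkSeries n z h (2 * h) = tailProd n z m := by
  rw [sum_Ico_succ_top hm, walkSeries_exitState]
  induction hm using Nat.decreasingInduction with
  | self => simp [tailProd]
  | of_succ m hm ih =>
    have tailProd_eq : tailProd n z m = (1 + z m (2 * m)) * tailProd n z (m + 1) :=
      prod_eq_prod_Ico_succ_bot hm _
    rw [sum_eq_sum_Ico_succ_bot hm, add_assoc, ih, tailProd_eq, walkSeries_of_lt z hm (by lia)]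
    ring

theorem sum_walkWeight_entryState (z : ℕ → ℕ → ℤ⟦X⟧) (a : ℕ → ℕ → ℤ) (hh' : h' ≤ n) :
    ∑ v' ∈ range (2 * n + 2), C (walkWeight n a n (2 * n + 1) h' v') * walkSeries n z h' v' =
      walkSeries n z h' (2 * h') := by
  rw [sum_eq_single_of_mem (2 * h') (mem_range.2 (by lia))]
  · simp [walkWeight]
  · intro v' _ hv'
    simp [walkWeight, hv']

theorem sum_walkWeight_of_gt (z : ℕ → ℕ → ℤ⟦X⟧) (a : ℕ → ℕ → ℤ) (hh : h < n) (hh' : h' < h)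
    (v : ℕ) (s : Finset ℕ) :
    ∑ v' ∈ s, C (walkWeight n a h v h' v') * walkSeries n z h' v' = 0 := by
  refine sum_eq_zero fun v' _ => ?_
  simp [walkWeight, hh.ne, hh'.ne, hh'.le.not_gt]

theorem sum_walkWeight_of_lt (z : ℕ → ℕ → ℤ⟦X⟧) (a : ℕ → ℕ → ℤ) (hh : h < h') (hh' : h' ≤ n)
    (hv : v < 2 * n) :
    ∑ v' ∈ range (2 * n + 2), C (walkWeight n a h v h' v') * walkSeries n z h' v' =
      C (a v (2 * h + 1)) * walkSeries n z h' (2 * h') := by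
  rw [sum_eq_single_of_mem (2 * h') (mem_range.2 (by lia))]
  · simp [walkWeight, (hh.trans_le hh').ne, hh.trans_le hh', hv, hh]
  · intro v' _ hv'
    simp [walkWeight, (hh.trans_le hh').ne, hh, hv']

theorem walkWeight_self (hh : h < n) (hv : v < 2 * n) (v' : ℕ) : walkWeight n a h v h v' =
    if h < v' / 2 ∧ v' < 2 * n then if v' % 2 = 0 then a (v' + 1) v else a v (v' - 1) else 0 := by
  simp [walkWeight, hh.ne, hh, hv]

theorem sum_walkWeight_self (ha : ∀ i < 2 * n, ∀ j < 2 * n, a j i = -a i j) (hh : h < n)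
    (hv : v < 2 * n) :
    ∑ v' ∈ range (2 * n + 2), C (walkWeight n a h v h v') * walkSeries n z h v' =
      (∑ c ∈ range n, if h < c then C (a v (2 * c)) * z h (2 * c + 1) -
        C (a v (2 * c + 1)) * z h (2 * c) else 0) * tailProd n z (h + 1) := by
  simp only [walkWeight_self hh hv]
  rw [show 2 * n + 2 = (n + 1) * 2 by ring, sum_range_mul_eq, sum_range_succ, sum_mul]
  have last_eq_zero : ∑ b ∈ range 2, C (if h < (n * 2 + b) / 2 ∧ n * 2 + b < 2 * n then
      if (n * 2 + b) % 2 = 0 then a (n * 2 + b + 1) v else a v (n * 2 + b - 1) else 0) *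
        walkSeries n z h (n * 2 + b) = 0 :=
    sum_eq_zero fun b _ => by rw [if_neg (by lia), map_zero, zero_mul]
  rw [last_eq_zero, add_zero]
  refine sum_congr rfl fun c hc => ?_
  rw [mem_range] at hc
  rw [sum_range_succ, sum_range_one, add_zero, mul_comm c 2]
  by_cases hhc : h < c
  · rw [if_pos (by lia), if_pos (by lia), if_pos (by lia), if_neg (by lia), if_pos hhc,
      walkSeries_of_lt z hh (by lia), walkSeries_of_lt z hh (by lia), ha v hv _ (by lia),
      Nat.add_sub_cancel, map_neg]
    ring
  · rw [if_neg (by lia), if_neg (by lia), if_neg hhc, map_zero, zero_mul, zero_mul, zero_mul,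
      add_zero]

theorem sum_walkWeight (ha : ∀ i < 2 * n, ∀ j < 2 * n, a j i = -a i j) (hh : h < n)
    (hv : v < 2 * n) :
    ∑ h' ∈ range (n + 1), ∑ v' ∈ range (2 * n + 2),
        C (walkWeight n a h v h' v') * walkSeries n z h' v' =
      (C (a v (2 * h + 1)) + ∑ c ∈ range n, if h < c then
        C (a v (2 * c)) * z h (2 * c + 1) - C (a v (2 * c + 1)) * z h (2 * c) else 0) *
        tailProd n z (h + 1) := by
  rw [← sum_range_add_sum_Ico _ (show h + 1 ≤ n + 1 by lia), sum_range_succ,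
    sum_eq_zero fun h' hh' => sum_walkWeight_of_gt z a hh (mem_range.1 hh') v _,
    sum_walkWeight_self ha hh hv, ← sum_walkSeries z hh, zero_add, add_mul, add_comm,
    mul_sum _ _ (C (a v (2 * h + 1)))]
  refine congrArg₂ _ (sum_congr rfl fun h' hh' => ?_) rfl
  rw [mem_Ico] at hh'
  exact sum_walkWeight_of_lt z a hh'.1 (Nat.lt_succ_iff.1 hh'.2) hv

theorem walkSeries_eq (ha : ∀ i < 2 * n, ∀ j < 2 * n, a j i = -a i j)
    (hz : ∀ h < n, ∀ v < 2 * n, z h v = X * (C (a v (2 * h + 1)) + ∑ c ∈ range n, if h < c then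
      C (a v (2 * c)) * z h (2 * c + 1) - C (a v (2 * c + 1)) * z h (2 * c) else 0)) (h v : ℕ) :
    walkSeries n z h v = (if h = n ∧ v = 2 * n then 1 else 0) +
      X * ∑ h' ∈ range (n + 1), ∑ v' ∈ range (2 * n + 2),
        C (walkWeight n a h v h' v') * walkSeries n z h' v' := by
  by_cases hinner : h < n ∧ v < 2 * n
  · obtain ⟨hh, hv⟩ := hinner
    rw [sum_walkWeight ha hh hv, walkSeries_of_lt z hh hv, if_neg (by lia), zero_add, ← mul_assoc,
      ← hz h hh v hv]
  by_cases hentry : h = n ∧ v = 2 * n + 1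
  · obtain ⟨rfl, rfl⟩ := hentry
    rw [walkSeries_entryState, if_neg (by lia), zero_add, ← sum_walkSeries z (Nat.zero_le h),
      ← range_eq_Ico]
    refine congrArg _ (sum_congr rfl fun h' hh' => (sum_walkWeight_entryState z a ?_).symm)
    exact Nat.lt_succ_iff.1 (mem_range.1 hh')
  · rw [walkSeries, if_neg hinner, if_neg hentry, left_eq_add]
    simp [walkWeight, hinner, hentry]

theorem intPow_entryState_exitState (ha : ∀ i < 2 * n, ∀ j < 2 * n, a j i = -a i j)
    {e : ℕ → ℕ → ℤ} (he : ∀ h ≤ n, ∀ v < numVertices n, ∀ h' ≤ n, ∀ v' < numVertices n,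
      e (state n h v) (state n h' v') = walkWeight n a h v h' v') :
    intPow (numStates n) e (n + 1) (entryState n) (exitState n) =
      pfaffian (n := n) (Matrix.of fun i j => a i j) := by
  set z := pivotSeries n a
  let Ψ (p : ℕ) : ℤ⟦X⟧ := walkSeries n z (p / numVertices n) (p % numVertices n)
  have Ψ_state {h v : ℕ} (hv : v < numVertices n) : Ψ (state n h v) = walkSeries n z h v := by
    simp only [Ψ, state_div_numVertices hv, state_mod_numVertices hv]
  have entry_lt : 2 * n + 1 < numVertices n := Nat.lt_succ_self _
  have exit_lt : 2 * n < numVertices n := Nat.lt_succ_of_lt (Nat.lt_succ_self _)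
  have recursion : ∀ p < numStates n, Ψ p = (if p = exitState n then 1 else 0) +
      X * ∑ q ∈ range (numStates n), C (e p q) * Ψ q := by
    intro p hp
    obtain ⟨h, hh, v, hv, rfl⟩ := exists_state_eq hp
    have state_eq_iff : state n h v = exitState n ↔ h = n ∧ v = 2 * n := by
      refine ⟨fun heq => ⟨?_, ?_⟩, fun ⟨hhn, hvn⟩ => by rw [hhn, hvn]; rfl⟩
      · rw [← state_div_numVertices (h := h) hv, heq]
        exact state_div_numVertices exit_lt
      · rw [← state_mod_numVertices (h := h) hv, heq]
        exact state_mod_numVertices exit_lt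
    rw [Ψ_state hv, walkSeries_eq ha fun h hh v hv => pivotSeries_eq ha hh hv, numStates,
      sum_range_mul_eq]
    simp only [state_eq_iff]
    refine congrArg (_ + X * ·) (sum_congr rfl fun h' hh' => sum_congr rfl fun v' hv' => ?_)
    rw [mem_range] at hh' hv'
    exact congrArg₂ (C · * ·) (he h hh v hv h' (Nat.lt_succ_iff.1 hh') v' hv').symm
      (Ψ_state hv').symm
  calc intPow (numStates n) e (n + 1) (entryState n) (exitState n)
    _ = coeff (n + 1) (Ψ (state n n (2 * n + 1))) :=
      (coeff_eq_intPow (state_lt_numStates le_rfl exit_lt) recursion (n + 1)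
        (state_lt_numStates le_rfl entry_lt)).symm
    _ = coeff n (∏ h ∈ range n, (1 + pivotSeries n a h (2 * h))) := by
      rw [Ψ_state entry_lt, walkSeries_entryState, coeff_succ_X_mul, tailProd, ← range_eq_Ico]
    _ = pfaffian (n := n) (Matrix.of fun i j => a i j) := (pfaffian_eq_coeff_prod ha).symm

end Walks

/-! ### The formula in the standard model -/

section TransferMatrix

variable {n : ℕ}

section Steps

variable {X : ℕ → Prop} {h v h' v' z : ℕ}

theorem stepBits_entry :
    StepBits n X n (2 * n + 1) h' v' z ↔ v' = 2 * h' ∧ z = 1 := by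
  simp [StepBits]

theorem stepBits_of_lt_head (hh : h < n) (hv : v < 2 * n) (hlt : h < h') :
    StepBits n X h v h' v' z ↔ v' = 2 * h' ∧ row (row X v) (2 * h + 1) z := by
  simp [StepBits, hh, hh.ne, hv, hlt, hlt.ne']

theorem stepBits_of_not_lt_head (hh : h < n) (hv : v < 2 * n) (hlt : ¬ h < h') :
    StepBits n X h v h' v' z ↔ (h' = h ∧ h < v' / 2 ∧ v' < 2 * n) ∧
      if v' % 2 = 0 then row (row X (v' + 1)) v z else row (row X v) (v' - 1) z := by
  simp only [StepBits, Nat.reduceAdd, hh, hh.ne, hv, hlt, false_and, and_self, true_and, false_or]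
  constructor
  · rintro ⟨rfl, c, hc, hhc, ⟨rfl, hz⟩ | ⟨rfl, hz⟩⟩
    · exact ⟨⟨rfl, by omega, by omega⟩, by rwa [if_pos (by omega)]⟩
    · exact ⟨⟨rfl, by omega, by omega⟩, by rwa [if_neg (by omega)]⟩
  · rintro ⟨⟨rfl, hhv, hv'⟩, hz⟩
    refine ⟨rfl, v' / 2, by omega, hhv, ?_⟩
    split_ifs at hz with heven
    · have : 2 * (v' / 2) = v' := by omega
      exact .inl ⟨this.symm, by rwa [this]⟩
    · have : 2 * (v' / 2) = v' - 1 := by omega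
      exact .inr ⟨by omega, by rwa [this]⟩

theorem not_stepBits (hentry : ¬ (h = n ∧ v = 2 * n + 1)) (hvertex : ¬ (h < n ∧ v < 2 * n)) :
    ¬ StepBits n X h v h' v' z := by
  simp [StepBits, hentry, hvertex]

theorem transitionBits_state_iff (hh : h ≤ n) (hv : v < numVertices n) (hh' : h' ≤ n)
    (hv' : v' < numVertices n) :
    TransitionBits n X (state n h v) (state n h' v') z ↔ StepBits n X h v h' v' z := by
  have state_inj {h v k u : ℕ} (hv : v < numVertices n) (hu : u < numVertices n)
      (heq : state n h v = state n k u) : h = k ∧ v = u :=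
    ⟨by rw [← state_div_numVertices (h := h) hv, heq, state_div_numVertices hu],
      by rw [← state_mod_numVertices (h := h) hv, heq, state_mod_numVertices hu]⟩
  constructor
  · rintro ⟨k, -, u, hu, k', -, u', hu', ⟨hp, hq⟩, hstep⟩
    obtain ⟨rfl, rfl⟩ := state_inj hv hu hp
    obtain ⟨rfl, rfl⟩ := state_inj hv' hu' hq
    exact hstep
  · exact fun hstep => ⟨h, hh, v, hv, h', hh', v', hv', ⟨rfl, rfl⟩, hstep⟩

end Steps

theorem StepBits.le_of_isBelow {X : ℕ → Prop} {b h v h' v' z : ℕ} (hX : IsBelow X b)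
    (hstep : StepBits n X h v h' v' z) : z ≤ b + 1 := by
  have le_of_digit {i j : ℕ} (hz : row (row X i) j z) : z ≤ b + 1 :=
    (isBelow_row (isBelow_row hX i) j z hz).le.trans (Nat.le_succ b)
  rcases hstep with ⟨-, -, rfl⟩ | ⟨-, ⟨-, hz⟩ | ⟨-, c, -, -, ⟨-, hz⟩ | ⟨-, hz⟩⟩⟩
  · exact Nat.le_add_left 1 b
  all_goals exact le_of_digit hz

open Classical in
/-- The code of the transfer matrix of the matrix coded by `X`. -/
noncomputable def transferString (n : ℕ) (X : Finset ℕ) : Finset ℕ :=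
  {w ∈ Finset.range (transferBound n (X.sup Nat.succ)) | TransferBits n (X.sup Nat.succ) (· ∈ X) w}

theorem mem_transferString {X : Finset ℕ} {w : ℕ} : w ∈ transferString n X ↔
    w < transferBound n (X.sup Nat.succ) ∧ TransferBits n (X.sup Nat.succ) (· ∈ X) w := by
  classical
  rw [transferString, Finset.mem_filter, Finset.mem_range]

theorem mem_transferString_iff_of_lt {X : Finset ℕ} (w : ℕ)
    (hw : w < transferBound n (X.sup Nat.succ)) :
    w ∈ transferString n X ↔ TransferBits n (X.sup Nat.succ) (· ∈ X) w :=
  mem_transferString.trans (and_iff_right hw)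

theorem sup_transferString_le (n : ℕ) (X : Finset ℕ) :
    (transferString n X).sup Nat.succ ≤ transferBound n (X.sup Nat.succ) :=
  Finset.sup_le fun _ hw => (mem_transferString.1 hw).1

theorem row_transferString (X : Finset ℕ) (p q : ℕ) :
    row (row (· ∈ transferString n X) p) q = TransitionBits n (· ∈ X) p q := by
  refine funext fun z => propext (mem_transferString.trans ⟨?_, fun h => ?_⟩)
  · rintro ⟨-, p', -, q', -, z', -, hcode, h⟩
    obtain ⟨rfl, hcode'⟩ := natPair_inj.1 hcode
    obtain ⟨rfl, rfl⟩ := natPair_inj.1 hcode'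
    exact h
  · obtain ⟨k, hk, u, hu, k', hk', u', hu', ⟨rfl, rfl⟩, hstep⟩ := id h
    have hp := (state_lt_numStates hk hu).le
    have hq := (state_lt_numStates hk' hu').le
    have hz := hstep.le_of_isBelow (isBelow_mem X)
    exact ⟨Nat.lt_succ_of_le (natPair_mono hp (natPair_mono hq hz)), _, hp, _, hq, z, hz, rfl, h⟩

section Entries

variable {X Y : Finset ℕ} {i j i' j' : ℕ}

theorem entry_congr (h : row (row (· ∈ X) i) j = row (row (· ∈ Y) i') j') :
    entry X i j = entry Y i' j' := by
  refine entry_eq_decodeInt fun x => ?_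
  rw [h, Finset.mem_filter, Finset.mem_range]
  exact (and_iff_right_of_imp (isBelow_entry Y i' j' x)).symm

theorem entry_eq_zero (h : ∀ x, ¬ row (row (· ∈ X) i) j x) : entry X i j = 0 :=
  (entry_eq_decodeInt (D := ∅) fun x => by simp [h x]).trans (by simp [decodeInt])

theorem entry_eq_one (h : ∀ x, row (row (· ∈ X) i) j x ↔ x = 1) : entry X i j = 1 :=
  (entry_eq_decodeInt (D := {1}) fun x => by simp [h x]).trans (by simp [decodeInt])

end Entries

theorem entry_transferString {X : Finset ℕ} {h v h' v' : ℕ} (hh : h ≤ n) (hv : v < numVertices n)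
    (hh' : h' ≤ n) (hv' : v' < numVertices n) :
    entry (transferString n X) (state n h v) (state n h' v') =
      walkWeight n (entry X) h v h' v' := by
  have digit_iff (z : ℕ) : row (row (· ∈ transferString n X) (state n h v)) (state n h' v') z ↔
      StepBits n (· ∈ X) h v h' v' z :=
    (iff_of_eq (congrFun (row_transferString X _ _) z)).trans
      (transitionBits_state_iff hh hv hh' hv')
  unfold walkWeight
  split_ifs with hentry hmove hvertex hhead hmove hvisit heven
  · obtain ⟨rfl, rfl⟩ := hentry
    exact entry_eq_one fun z => by rw [digit_iff, stepBits_entry, and_iff_right hmove]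
  · obtain ⟨rfl, rfl⟩ := hentry
    exact entry_eq_zero fun z => by rw [digit_iff, stepBits_entry, not_and]; exact (absurd · hmove)
  · refine entry_congr (funext fun z => propext ?_)
    rw [digit_iff, stepBits_of_lt_head hvertex.1 hvertex.2 hhead, and_iff_right hmove]
  · refine entry_eq_zero fun z => ?_
    rw [digit_iff, stepBits_of_lt_head hvertex.1 hvertex.2 hhead, not_and]
    exact (absurd · hmove)
  · refine entry_congr (funext fun z => propext ?_)
    rw [digit_iff, stepBits_of_not_lt_head hvertex.1 hvertex.2 hhead, and_iff_right hvisit,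
      if_pos heven]
  · refine entry_congr (funext fun z => propext ?_)
    rw [digit_iff, stepBits_of_not_lt_head hvertex.1 hvertex.2 hhead, and_iff_right hvisit,
      if_neg heven]
  · refine entry_eq_zero fun z => ?_
    rw [digit_iff, stepBits_of_not_lt_head hvertex.1 hvertex.2 hhead, not_and]
    exact (absurd · hvisit)
  · exact entry_eq_zero fun z => by rw [digit_iff]; exact not_stepBits hentry hvertex

end TransferMatrix

section Value

theorem isSkew_iff {d : ℕ} {X : Finset ℕ} : IsSkew d (X.sup Nat.succ) (· ∈ X) ↔
    (decodeMatrix d X).transpose = -decodeMatrix d X := by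
  have entry_iff (i j : ℕ) := (represents_entry X i j).eq_neg_iff (represents_entry X j i)
    (natAbs_entry_lt X i j) (natAbs_entry_lt X j i)
  simp only [IsSkew, entry_iff]
  refine ⟨fun h => ?_, fun h i hi j hj => congrFun (congrFun h ⟨i, hi⟩) ⟨j, hj⟩⟩
  ext i j
  exact h i i.isLt j j.isLt

theorem row_powerString_transferString {n : ℕ} {X : Finset ℕ}
    (h : (decodeMatrix (2 * n) X).transpose = -decodeMatrix (2 * n) X) :
    row (row (row (· ∈ powerString (numStates n) (n + 1) (transferString n X)) (n + 1))
      (entryState n)) (exitState n) = (· ∈ encodeInt (pfaffian (decodeMatrix (2 * n) X))) := by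
  have entry_lt : entryState n < numStates n := state_lt_numStates le_rfl (Nat.lt_succ_self _)
  have exit_lt : exitState n < numStates n :=
    state_lt_numStates le_rfl (Nat.lt_succ_of_lt (Nat.lt_succ_self _))
  rw [row_powerString le_rfl entry_lt exit_lt, intPow_entryState_exitState
    (fun i hi j hj => congrFun (congrFun h ⟨i, hi⟩) ⟨j, hj⟩)
    fun _ hh _ hv _ hh' _ hv' => entry_transferString hh hv hh' hv']
  rfl

theorem mem_pfaffianString_iff {n : ℕ} {X : Finset ℕ} {z : ℕ} :
    z ∈ pfaffianString n X ↔ PfaffianBits n (X.sup Nat.succ) (· ∈ X)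
      (· ∈ powerString (numStates n) (n + 1) (transferString n X)) z := by
  have skew_iff : IsSkew ((1 + 1) * n) (X.sup Nat.succ) (· ∈ X) ↔ _ := isSkew_iff (d := 2 * n)
  rw [PfaffianBits, skew_iff, pfaffianString]
  by_cases h : (decodeMatrix (2 * n) X).transpose = -decodeMatrix (2 * n) X
  · simp only [if_pos h]
    rw [row_powerString_transferString h]
    exact (and_iff_right h).symm
  · simp only [if_neg h]
    exact iff_of_false (Finset.notMem_empty z) fun hz => h hz.1

theorem sup_pfaffianString_le (n : ℕ) (X : Finset ℕ) : (pfaffianString n X).sup Nat.succ ≤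
    (powerString (numStates n) (n + 1) (transferString n X)).sup Nat.succ :=
  Finset.sup_le fun z hz =>
    isBelow_row (isBelow_row (isBelow_row (isBelow_mem _) _) _) _ z (mem_pfaffianString_iff.1 hz).2

theorem pfaffianBody_pfaffianString (n : ℕ) (X : Finset ℕ) :
    PfaffianBody (M := stdModel) n X (pfaffianString n X) (transferString n X)
      (powerString (numStates n) (n + 1) (transferString n X))
      (partialSumString (numStates n) (n + 1) (transferString n X))
      (productString (numStates n) (n + 1) (transferString n X)) :=
  ⟨mem_transferString_iff_of_lt, isPowRun_powerString _ _ _, sup_pfaffianString_le n X,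
    fun _ _ => mem_pfaffianString_iff⟩

theorem sat_pfaffianFormula_pfaffianString {v : ℕ → ℕ} {s : ℕ → Finset ℕ}
    (hs : s 1 = pfaffianString (v 0) (s 0)) : pfaffianFormula.Sat stdModel v s := by
  have bound : powBound (numStates (v 0)) (v 0 + 1) ((transferString (v 0) (s 0)).sup Nat.succ) ≤
      powBound (numStates (v 0)) (v 0 + 1) (transferBound (v 0) ((s 0).sup Nat.succ)) :=
    powBound_mono (M := stdModel) (sup_transferString_le (v 0) (s 0))
  rw [sat_pfaffianFormula, hs]
  exact ⟨_, sup_transferString_le _ _, _, le_trans sup_arrayString_le bound, _,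
    le_trans sup_arrayString_le bound, _, le_trans sup_arrayString_le bound,
    pfaffianBody_pfaffianString _ _⟩

theorem pfaffianFormula_sat_stdModel (v : ℕ → ℕ) (s : ℕ → Finset ℕ) :
    pfaffianFormula.Sat stdModel v s ↔ s 1 = pfaffianString (v 0) (s 0) := by
  refine ⟨fun h => ?_, sat_pfaffianFormula_pfaffianString⟩
  let s' : ℕ → Finset ℕ := Function.update s 1 (pfaffianString (v 0) (s 0))
  have hs' : pfaffianFormula.Sat stdModel v s' := sat_pfaffianFormula_pfaffianString rfl
  exact eq_of_sat_pfaffianFormula (M := stdModel) (s := s) (s' := s') rfl h hs'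

end Value

end TwoSorted

theorem mainTheorem6 :
    TwoSorted.SigmaB1Definable TwoSorted.VSharpL 1 1
      (fun x X => TwoSorted.pfaffianString (x 0) (X 0)) :=
  ⟨TwoSorted.pfaffianFormula, TwoSorted.pfaffianFormula_isSigmaB1,
    TwoSorted.pfaffianFormula_freeNum, TwoSorted.pfaffianFormula_freeStr,
    TwoSorted.pfaffianFormula_sat_stdModel, TwoSorted.proves_existsUnique_pfaffianFormula⟩
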